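/- Manifolds are finite-dimensional, smooth, without boundary, Hausdorff and $\sigma$-compact; vector bundles are smooth, real, of finite rank. Let $p:E\to B$ be a smooth submersion, $\mathcal K\to E$ a Lie algebroid (anchor $\sharp_{\mathcal K}$, bracket $[\cdot,\cdot]_{\mathcal K}$) with $p_*\circ\sharp_{\mathcal K}=0$, and $A_B\to B$ a Lie algebroid with anchor $\sharp_B$. An extension of $A_B$ by $\mathcal K$ covering $p$ is a Lie algebroid $A_E\to E$ together with a fibrewise surjective Lie algebroid morphism $\pi:A_E\to A_B$ covering $p$ and an injective Lie algebroid morphism $\iota:\mathcal K\to A_E$ covering $\mathrm{id}_E$ whose image is $\ker\pi$. (A Lie algebroid morphism is a vector bundle homomorphism whose pullback of forms commutes with the Lie algebroid differentials.) Two extensions $(A_E,\pi,\iota)$, $(A_E',\pi',\iota')$ are equivalent if there is a Lie algebroid isomorphism $\Phi:A_E\to A_E'$ covering $\mathrm{id}_E$ with $\Phi\circ\iota=\iota'$ and $\pi'\circ\Phi=\pi$. An Ehresmann connection on an extension is a smooth subbundle $H\subset A_E$ complementary to $\ker\pi$; its horizontal lift $h:\Gamma(A_B)\to\Gamma(H)$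 sends $\alpha$ to the unique section of $H$ with $\pi\circ h(\alpha)=\alpha\circ p$. A derivation of $\mathcal K$ is an $\mathbb R$-linear map $D:\Gamma(\mathcal K)\to\Gamma(\mathcal K)$ together with a vector field $s_D$ on $E$ (its symbol) such that $D(f\kappa)=fD\kappa+s_D(f)\kappa$, $D[\kappa_1,\kappa_2]=[D\kappa_1,\kappa_2]+[\kappa_1,D\kappa_2]$ and $\sharp_{\mathcal K}(D\kappa)=[s_D,\sharp_{\mathcal K}\kappa]$; equality of derivations means equality of operators and of symbols, commutators and linear combinations are taken componentwise, and $\mathrm{ad}_\delta=[\delta,\cdot]_{\mathcal K}$ has symbol $\sharp_{\mathcal K}\delta$. Let $C^\infty(B)$ act on $\Gamma(\mathcal K)$ and on vector fields of $E$ through $p$. Let $\Omega^k(A_B)\otimes\Gamma(\mathcal K)$ (tensor product over $C^\infty(B)$) be the space of alternating $C^\infty(B)$-multilinear maps $\Gamma(A_B)^k\to\Gamma(\mathcal K)$. A couple $(D,\omega)$ consists of a $C^\infty(B)$-linear map $\alpha\mapsto D_\alpha$ from $\Gamma(A_B)$ to derivations of $\mathcal K$ such that $s_{D_\alpha}$ is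 $p$-related to $\sharp_B\alpha$ for every $\alpha$, and of $\omega\in\Omega^2(A_B)\otimes\Gamma(\mathcal K)$. For $\theta\in\Omega^k(A_B)\otimes\Gamma(\mathcal K)$ put $$\partial_H\theta(\alpha_0,\dots,\alpha_k)=\sum_{i}(-1)^iD_{\alpha_i}\theta(\alpha_0,\dots,\widehat{\alpha_i},\dots,\alpha_k)+\sum_{i<j}(-1)^{i+j}\theta([\alpha_i,\alpha_j],\alpha_0,\dots,\widehat{\alpha_i},\dots,\widehat{\alpha_j},\dots,\alpha_k).$$ The couple is admissible if $\partial_H\omega=0$ and $\mathrm{Curv}_D=\mathrm{ad}\circ\omega$, where $\mathrm{Curv}_D(\alpha,\beta)=[D_\alpha,D_\beta]-D_{[\alpha,\beta]}$. Write $(D,\omega)\sim(D',\omega')$ if there is $\Delta\in\Omega^1(A_B)\otimes\Gamma(\mathcal K)$ with $$D'=D+\mathrm{ad}\circ\Delta,\qquad \omega'=\omega+\partial_H\Delta+[\Delta\wedge\Delta]_{\mathcal K},\qquad [\Delta\wedge\Delta]_{\mathcal K}(\alpha,\beta)=[\Delta(\alpha),\Delta(\beta)]_{\mathcal K},$$ where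 $\partial_H$ is formed with $D$. Theorem. Equivalence of extensions and $\sim$ on admissible couples are equivalence relations. Every extension of $A_B$ by $\mathcal K$ covering $p$ admits an Ehresmann connection, and each Ehresmann connection, with horizontal lift $h$, determines a unique admissible couple $(D,\omega)$ with $$\iota(D_\alpha\kappa)=[h(\alpha),\iota\kappa]_{A_E},\qquad s_{D_\alpha}=\sharp_{A_E}h(\alpha),\qquad \iota(\omega(\alpha,\beta))=[h(\alpha),h(\beta)]_{A_E}-h([\alpha,\beta]_{A_B}).$$ Sending an extension to the class of the couple of any of its Ehresmann connections is a well-defined bijection from the set of equivalence classes of extensions of $A_B$ by $\mathcal K$ covering $p$ onto the set of $\sim$-classes of admissible couples. -/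

import Mathlib

open Bundle Manifold Set
open scoped Manifold ContDiff

universe v

noncomputable section

namespace LieExt

/-! ### Smooth vector bundles and their sections

Manifolds are finite-dimensional smooth manifolds without boundary, modelled on `EM`. -/

/-- A smooth real vector bundle of finite rank over the manifold `M`. -/
structure VBundle (EM : Type*) [NormedAddCommGroup EM] [NormedSpace ℝ EM]
    (M : Type*) [TopologicalSpace M] [ChartedSpace EM M] where
  /-- the model fibre -/
  F : Type v
  [normedF : NormedAddCommGroup F]
  [spaceF : NormedSpace ℝ F]
  [finF : FiniteDimensional ℝ F]
  /-- the fibres -/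
  V : M → Type v
  [addV : ∀ x, AddCommGroup (V x)]
  [modV : ∀ x, Module ℝ (V x)]
  [topV : ∀ x, TopologicalSpace (V x)]
  [topTotal : TopologicalSpace (TotalSpace F V)]
  [fiberBundle : FiberBundle F V]
  [vectorBundle : VectorBundle ℝ F V]
  [smoothBundle : ContMDiffVectorBundle ∞ F V 𝓘(ℝ, EM)]

attribute [instance] VBundle.normedF VBundle.spaceF VBundle.finF VBundle.addV VBundle.modV
  VBundle.topV VBundle.topTotal VBundle.fiberBundle VBundle.vectorBundle VBundle.smoothBundle

section OneBase

variable {EM : Type*} [NormedAddCommGroup EM] [NormedSpace ℝ EM]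
  {M : Type*} [TopologicalSpace M] [ChartedSpace EM M]

/-- The smooth sections of a vector bundle. -/
abbrev VBundle.Sec (A : VBundle.{v} EM M) := Cₛ^∞⟮𝓘(ℝ, EM); A.F, A.V⟯

/-- The product of a smooth function and a smooth section. -/
def VBundle.fsmul (A : VBundle.{v} EM M) (f : C^∞⟮𝓘(ℝ, EM), M; ℝ⟯) (s : A.Sec) : A.Sec :=
  ⟨fun x => f x • s x, f.contMDiff.smul_section s.contMDiff⟩

/-- The smooth vector fields on `M`. -/
abbrev VField (EM : Type*) [NormedAddCommGroup EM] [NormedSpace ℝ EM]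
    (M : Type*) [TopologicalSpace M] [ChartedSpace EM M] [IsManifold 𝓘(ℝ, EM) ∞ M] :=
  Cₛ^∞⟮𝓘(ℝ, EM); EM, (TangentSpace 𝓘(ℝ, EM) : M → Type _)⟯

/-! ### Lie algebroids -/

/-- A Lie algebroid over `M`: a vector bundle, a vector bundle homomorphism (the anchor) to the
tangent bundle, and a real Lie bracket on smooth sections, with the Leibniz rule, such that the
anchor is a Lie algebra homomorphism into vector fields. -/
structure LieAlgebroid (EM : Type*) [NormedAddCommGroup EM] [NormedSpace ℝ EM]
    (M : Type*) [TopologicalSpace M] [ChartedSpace EM M] [IsManifold 𝓘(ℝ, EM) ∞ M]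
    extends VBundle.{v} EM M where
  /-- the anchor, fibrewise -/
  anchor : ∀ x : M, V x →ₗ[ℝ] TangentSpace 𝓘(ℝ, EM) x
  contMDiff_anchor :
    ContMDiff (𝓘(ℝ, EM).prod 𝓘(ℝ, F)) (𝓘(ℝ, EM).prod 𝓘(ℝ, EM)) ∞
      (fun a : TotalSpace F V => (⟨a.1, anchor a.1 a.2⟩ : TangentBundle 𝓘(ℝ, EM) M))
  /-- the bracket of sections -/
  bracket : toVBundle.Sec →ₗ[ℝ] toVBundle.Sec →ₗ[ℝ] toVBundle.Sec
  leibniz : ∀ (f : C^∞⟮𝓘(ℝ, EM), M; ℝ⟯) (α β : toVBundle.Sec) (x : M),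
    bracket α (toVBundle.fsmul f β) x =
      f x • bracket α β x + mvfderiv 𝓘(ℝ, EM) f x (anchor x (α x)) • β x
  skew : ∀ α β : toVBundle.Sec, bracket α β = -bracket β α
  anchor_bracket : ∀ (α β : toVBundle.Sec) (x : M),
    anchor x (bracket α β x) =
      VectorField.mlieBracket 𝓘(ℝ, EM) (fun y => anchor y (α y)) (fun y => anchor y (β y)) x
  jacobi : ∀ α β γ : toVBundle.Sec,
    bracket (bracket α β) γ + bracket (bracket β γ) α + bracket (bracket γ α) β = 0

end OneBase

/-! ### The Koszul formula

The same alternating sum defines the Lie algebroid differential and the covariant differential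
associated with a connection. -/

section Koszul

variable {Γ W : Type*} [AddCommGroup W]

/-- The terms `∑_{i<j} (-1)^{i+j} θ([α_i, α_j], α_0, …, α̂_i, …, α̂_j, …, α_k)` of the Koszul
formula; there are none if `θ` has degree `0`. The indices of the formula are `i.castSucc < j`. -/
def koszulBracketTerms (br : Γ → Γ → Γ) :
    (k : ℕ) → ((Fin k → Γ) → W) → (Fin (k + 1) → Γ) → W
  | 0, _, _ => 0
  | n + 1, θ, α => ∑ j : Fin (n + 2), ∑ i : Fin (n + 1),
      if i.castSucc < j then
        (-1 : ℤ) ^ ((i : ℕ) + (j : ℕ)) •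
          θ (Fin.cons (br (α i.castSucc) (α j)) (i.removeNth (j.removeNth α)))
      else 0

/-- The Koszul formula
`∑_i (-1)^i ρ(α_i) θ(α_0, …, α̂_i, …, α_k) + ∑_{i<j} (-1)^{i+j} θ([α_i, α_j], …)`. -/
def koszul (br : Γ → Γ → Γ) (ρ : Γ → W → W) {k : ℕ} (θ : (Fin k → Γ) → W)
    (α : Fin (k + 1) → Γ) : W :=
  ∑ i : Fin (k + 1), (-1 : ℤ) ^ (i : ℕ) • ρ (α i) (θ (i.removeNth α)) +
    koszulBracketTerms br k θ α

end Koszul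

/-! ### Forms and morphisms of Lie algebroids -/

section Morphisms

variable {EM : Type*} [NormedAddCommGroup EM] [NormedSpace ℝ EM]
  {M : Type*} [TopologicalSpace M] [ChartedSpace EM M]
  {EN : Type*} [NormedAddCommGroup EN] [NormedSpace ℝ EN]
  {N : Type*} [TopologicalSpace N] [ChartedSpace EN N]

/-- A `k`-form on `A`, i.e. a smooth section of `Λ^k A^*`: a family of alternating forms on the
fibres that takes smooth sections to smooth functions. -/
structure VBundle.AltForm (A : VBundle.{v} EM M) (k : ℕ) where
  toFun : ∀ x : M, (A.V x) [⋀^Fin k]→ₗ[ℝ] ℝ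
  smooth : ∀ α : Fin k → A.Sec,
    ContMDiff 𝓘(ℝ, EM) 𝓘(ℝ, ℝ) ∞ (fun x => toFun x (fun i => α i x))

/-- Evaluation of a form on sections. -/
def VBundle.AltForm.eval {A : VBundle.{v} EM M} {k : ℕ} (u : A.AltForm k) (α : Fin k → A.Sec) :
    M → ℝ := fun x => u.toFun x (fun i => α i x)

/-- The Lie algebroid differential `d_A`, given by the Koszul formula, of the map
`θ : Γ(A)^k → C^∞(M)` defined by a `k`-form. -/
def LieAlgebroid.d [IsManifold 𝓘(ℝ, EM) ∞ M] (A : LieAlgebroid.{v} EM M) {k : ℕ}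
    (θ : (Fin k → A.Sec) → M → ℝ) (α : Fin (k + 1) → A.Sec) : M → ℝ :=
  koszul (fun a b => A.bracket a b)
    (fun a f x => mvfderiv 𝓘(ℝ, EM) f x (A.anchor x (a x))) θ α

/-- The pullback `Φ^* u` of a form by a bundle map `Φ` covering `φ`, evaluated on sections. -/
def pullbackEval {A : VBundle.{v} EM M} {A' : VBundle.{v} EN N} (φ : M → N)
    (Φ : ∀ x, A.V x →ₗ[ℝ] A'.V (φ x)) {k : ℕ} (u : A'.AltForm k) (α : Fin k → A.Sec) : M → ℝ :=
  fun x => u.toFun (φ x) (fun i => Φ x (α i x))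

/-- A Lie algebroid homomorphism covering `φ`: a smooth vector bundle homomorphism `Φ` covering
`φ` with `d ∘ Φ^* = Φ^* ∘ d` on forms of every degree. Here `w` being the form `d u` is
expressed by its values on sections. -/
structure IsMorphism [IsManifold 𝓘(ℝ, EM) ∞ M] [IsManifold 𝓘(ℝ, EN) ∞ N]
    (A : LieAlgebroid.{v} EM M) (A' : LieAlgebroid.{v} EN N) (φ : M → N)
    (Φ : ∀ x, A.V x →ₗ[ℝ] A'.V (φ x)) : Prop where
  contMDiff : ContMDiff (𝓘(ℝ, EM).prod 𝓘(ℝ, A.F)) (𝓘(ℝ, EN).prod 𝓘(ℝ, A'.F)) ∞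
    (fun a : TotalSpace A.F A.V => (⟨φ a.1, Φ a.1 a.2⟩ : TotalSpace A'.F A'.V))
  d_pullback : ∀ (k : ℕ) (u : A'.AltForm k) (w : A'.AltForm (k + 1)),
    w.eval = A'.d u.eval → pullbackEval φ Φ w = A.d (pullbackEval φ Φ u)

end Morphisms

/-! ### Derivations -/

section Derivations

variable {EM : Type*} [NormedAddCommGroup EM] [NormedSpace ℝ EM]
  {M : Type*} [TopologicalSpace M] [ChartedSpace EM M] [IsManifold 𝓘(ℝ, EM) ∞ M]

/-- A derivation of a Lie algebroid: an operator on sections together with its symbol. -/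
structure LieAlgebroid.Der (A : LieAlgebroid.{v} EM M) where
  op : A.Sec →ₗ[ℝ] A.Sec
  symbol : VField EM M
  map_fsmul : ∀ (f : C^∞⟮𝓘(ℝ, EM), M; ℝ⟯) (α : A.Sec) (x : M),
    op (A.fsmul f α) x = f x • op α x + mvfderiv 𝓘(ℝ, EM) f x (symbol x) • α x
  map_bracket : ∀ α β : A.Sec, op (A.bracket α β) = A.bracket (op α) β + A.bracket α (op β)
  anchor_op : ∀ (α : A.Sec) (x : M),
    A.anchor x (op α x) =
      VectorField.mlieBracket 𝓘(ℝ, EM) symbol (fun y => A.anchor y (α y)) x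

end Derivations

/-! ### Extensions, connections and couples -/

section Extensions

variable {EE : Type*} [NormedAddCommGroup EE] [NormedSpace ℝ EE]
  {E : Type*} [TopologicalSpace E] [ChartedSpace EE E] [IsManifold 𝓘(ℝ, EE) ∞ E]
  {EB : Type*} [NormedAddCommGroup EB] [NormedSpace ℝ EB]
  {B : Type*} [TopologicalSpace B] [ChartedSpace EB B] [IsManifold 𝓘(ℝ, EB) ∞ B]

/-- An extension of `A` by `K` covering `p`: a Lie algebroid `total` over `E` with a fibrewise
surjective Lie algebroid morphism `proj : total → A` covering `p`, together with an identification
`incl` (an injective Lie algebroid morphism covering the identity) of `K` with the kernel of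
`proj`. -/
structure Extension (p : C^∞⟮𝓘(ℝ, EE), E; 𝓘(ℝ, EB), B⟯)
    (K : LieAlgebroid.{v} EE E) (A : LieAlgebroid.{v} EB B) where
  total : LieAlgebroid.{v} EE E
  proj : ∀ x, total.V x →ₗ[ℝ] A.V (p x)
  incl : ∀ x, K.V x →ₗ[ℝ] total.V x
  proj_morphism : IsMorphism total A p proj
  incl_morphism : IsMorphism K total id incl
  proj_surjective : ∀ x, Function.Surjective (proj x)
  incl_injective : ∀ x, Function.Injective (incl x)
  exact : ∀ x, LinearMap.range (incl x) = LinearMap.ker (proj x)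

variable {p : C^∞⟮𝓘(ℝ, EE), E; 𝓘(ℝ, EB), B⟯}
  {K : LieAlgebroid.{v} EE E} {A : LieAlgebroid.{v} EB B}

/-- Equivalence of extensions: a Lie algebroid isomorphism of the total algebroids covering the
identity of `E` and compatible with the identity maps of `K` and of `A`. -/
def Extension.Equivalent (X Y : Extension p K A) : Prop :=
  ∃ Φ : ∀ x, X.total.V x ≃ₗ[ℝ] Y.total.V x,
    IsMorphism X.total Y.total id (fun x => (Φ x).toLinearMap) ∧
    IsMorphism Y.total X.total id (fun x => (Φ x).symm.toLinearMap) ∧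
    (∀ (x : E) (k : K.V x), Φ x (X.incl x k) = Y.incl x k) ∧
    (∀ (x : E) (a : X.total.V x), Y.proj x (Φ x a) = X.proj x a)

/-- An Ehresmann connection on an extension: a distribution `H` complementary to the kernel of
`proj`. It is smooth: for each section `α` of `A`, the section of `H` that projects
onto `α` is smooth; this is the horizontal lift `lift α`. -/
structure Extension.Connection (X : Extension p K A) where
  H : ∀ x, Submodule ℝ (X.total.V x)
  isCompl : ∀ x, IsCompl (LinearMap.ker (X.proj x)) (H x)
  lift : A.Sec → X.total.Sec
  lift_mem : ∀ (α : A.Sec) (x : E), lift α x ∈ H x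
  proj_lift : ∀ (α : A.Sec) (x : E), X.proj x (lift α x) = α (p x)

/-- An element of `Ω^k(A) ⊗ Γ(K)`, the tensor product being over `C^∞(B)`: an alternating
`C^∞(B)`-multilinear map from sections of `A` to sections of `K`, where `C^∞(B)` acts on `Γ(K)`
through `p`. -/
structure KForm (p : C^∞⟮𝓘(ℝ, EE), E; 𝓘(ℝ, EB), B⟯)
    (K : LieAlgebroid.{v} EE E) (A : LieAlgebroid.{v} EB B) (k : ℕ) where
  toFun : (Fin k → A.Sec) → K.Sec
  map_update_add : ∀ (α : Fin k → A.Sec) (i : Fin k) (β γ : A.Sec),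
    toFun (Function.update α i (β + γ)) =
      toFun (Function.update α i β) + toFun (Function.update α i γ)
  map_update_fsmul : ∀ (α : Fin k → A.Sec) (i : Fin k) (g : C^∞⟮𝓘(ℝ, EB), B; ℝ⟯) (β : A.Sec),
    toFun (Function.update α i (A.fsmul g β)) =
      K.fsmul (g.comp p) (toFun (Function.update α i β))
  map_eq_zero_of_eq : ∀ (α : Fin k → A.Sec) (i j : Fin k), α i = α j → i ≠ j → toFun α = 0

/-- A couple `(D, ω)`, with `ω` called `form`: a `C^∞(B)`-linear map `D` from sections of `A` to
derivations of `K` such that the symbol of `D α` projects onto the anchor of `α`, and a `2`-form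
`ω` on `A` with values in sections of `K`. A derivation is an operator with its symbol, so linearity is required of
both. -/
structure Couple (p : C^∞⟮𝓘(ℝ, EE), E; 𝓘(ℝ, EB), B⟯)
    (K : LieAlgebroid.{v} EE E) (A : LieAlgebroid.{v} EB B) where
  D : A.Sec → K.Der
  D_add_op : ∀ (α β : A.Sec) (κ : K.Sec), (D (α + β)).op κ = (D α).op κ + (D β).op κ
  D_add_symbol : ∀ (α β : A.Sec) (x : E),
    (D (α + β)).symbol x = (D α).symbol x + (D β).symbol x
  D_fsmul_op : ∀ (g : C^∞⟮𝓘(ℝ, EB), B; ℝ⟯) (α : A.Sec) (κ : K.Sec),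
    (D (A.fsmul g α)).op κ = K.fsmul (g.comp p) ((D α).op κ)
  D_fsmul_symbol : ∀ (g : C^∞⟮𝓘(ℝ, EB), B; ℝ⟯) (α : A.Sec) (x : E),
    (D (A.fsmul g α)).symbol x = g (p x) • (D α).symbol x
  symbol_projects : ∀ (α : A.Sec) (x : E),
    mfderiv 𝓘(ℝ, EE) 𝓘(ℝ, EB) p x ((D α).symbol x) = A.anchor (p x) (α (p x))
  form : KForm p K A 2

/-- The covariant differential `∂_H` associated with `D`. -/
def Couple.covD (c : Couple p K A) {k : ℕ} (θ : KForm p K A k) (α : Fin (k + 1) → A.Sec) :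
    K.Sec :=
  koszul (fun a b => A.bracket a b) (fun a κ => (c.D a).op κ) θ.toFun α

/-- Admissible couples: `∂_H ω = 0` and `Curv_D = ad ∘ ω`, where
`Curv_D (α, β) = [D α, D β] - D [α, β]`. The latter is an equality of derivations, i.e. of their
operators and of their symbols (the symbol of the inner derivation `ad δ` is `♯ δ`). -/
structure Couple.IsAdmissible (c : Couple p K A) : Prop where
  closed : ∀ α : Fin 3 → A.Sec, c.covD c.form α = 0
  curv_op : ∀ (α β : A.Sec) (κ : K.Sec),
    (c.D α).op ((c.D β).op κ) - (c.D β).op ((c.D α).op κ) - (c.D (A.bracket α β)).op κ =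
      K.bracket (c.form.toFun ![α, β]) κ
  curv_symbol : ∀ (α β : A.Sec) (x : E),
    VectorField.mlieBracket 𝓘(ℝ, EE) (c.D α).symbol (c.D β).symbol x -
      (c.D (A.bracket α β)).symbol x = K.anchor x (c.form.toFun ![α, β] x)

/-- Admissible couples. -/
abbrev AdmissibleCouple (p : C^∞⟮𝓘(ℝ, EE), E; 𝓘(ℝ, EB), B⟯)
    (K : LieAlgebroid.{v} EE E) (A : LieAlgebroid.{v} EB B) :=
  {c : Couple p K A // c.IsAdmissible}

/-- `c'` is the gauge transform of `c` by `Δ`: `D' = D + ad ∘ Δ` (as derivations) and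
`ω' = ω + ∂_H Δ + [Δ ∧ Δ]`. -/
structure IsGaugeTransform (Δ : KForm p K A 1) (c c' : Couple p K A) : Prop where
  op : ∀ (α : A.Sec) (κ : K.Sec),
    (c'.D α).op κ = (c.D α).op κ + K.bracket (Δ.toFun ![α]) κ
  symbol : ∀ (α : A.Sec) (x : E),
    (c'.D α).symbol x = (c.D α).symbol x + K.anchor x (Δ.toFun ![α] x)
  form : ∀ α β : A.Sec,
    c'.form.toFun ![α, β] = c.form.toFun ![α, β] + c.covD Δ ![α, β] +
      K.bracket (Δ.toFun ![α]) (Δ.toFun ![β])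

/-- Gauge equivalence of admissible couples. -/
def GaugeEquivalent (c c' : AdmissibleCouple p K A) : Prop :=
  ∃ Δ : KForm p K A 1, IsGaugeTransform Δ c.1 c'.1

/-- The couple `c = (D, ω)` is the one determined by the connection `h` on the extension `X`:
`D_α κ = [h α, κ]`, with symbol the anchor of `h α`, and `ω(α, β) = [h α, h β] - h [α, β]`;
sections of `K` are viewed as sections of the total algebroid through `incl`. -/
structure IsCoupleOf (X : Extension p K A) (h : X.Connection) (c : Couple p K A) : Prop where
  op : ∀ (α : A.Sec) (κ : K.Sec) (κ' : X.total.Sec), (∀ x, κ' x = X.incl x (κ x)) →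
    ∀ x, X.incl x ((c.D α).op κ x) = X.total.bracket (h.lift α) κ' x
  symbol : ∀ (α : A.Sec) (x : E), (c.D α).symbol x = X.total.anchor x (h.lift α x)
  form : ∀ (α β : A.Sec) (x : E),
    X.incl x (c.form.toFun ![α, β] x) =
      X.total.bracket (h.lift α) (h.lift β) x - h.lift (A.bracket α β) x

end Extensions

end LieExt

end

/-! A connection splits the projection, so that as a bundle the total algebroid becomes the direct
sum of the pullback of `A` and of `K`. The bracket is then governed by the single formula [h(α)+κ,
h(β)+λ] = h([α,β]) + ω(α,β) + D_α λ − D_β κ + [κ,λ], where κ and λ are viewed in the total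
algebroid. Sections of the form h(α)+κ pass through every vector, and the Leibniz rule extends the
formula to all sections. This is the origin of the couple and the reason that it determines the
extension.

The Jacobi identity on three such sections splits by type: three lifts give ∂_H ω = 0, two lifts and
a section of `K` give Curv_D = ad ∘ ω on operators, one lift and two sections of `K` say that D_α is
a derivation, and the last case is Jacobi in `K`. Compatibility of the anchor with brackets gives
the equation for symbols. Read in one direction, this proves `IsCoupleOf.isAdmissible`; read in the
other, it gives `Couple.IsAdmissible.jacobi_genSec` and `Couple.IsAdmissible.anchor_genSec`.

Two connections on one extension differ by a 1-form Δ with values in `K`, and expanding the brackets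
of h + Δ gives exactly the gauge transformation (`IsCoupleOf.iff_isGaugeTransform`). Hence the class
of the couple is well defined. For injectivity, a gauge transformation is realised by a change of
connection on one of the extensions; the couples then agree, and matching horizontal and vertical
parts is an equivalence (`Extension.equivalent_of_isCoupleOf`). Connections exist because local
splittings can be averaged with a partition of unity.

For surjectivity the bracket must be built on all sections of the direct sum, not only on
pulled-back ones. Its horizontal part is defined by duality: a 1-form u on `A` takes on it the value
ρ(s)(u(t)) − ρ(t)(u(s)) − (du)(s,t), where ρ is the new anchor. This avoids any choice of an
expansion in pulled-back sections. The defect of the anchor and the Jacobiator are linear over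
functions, so it suffices that they vanish on generators (`LieAlgebroid.ofGenerators`).

Morphisms are defined through forms. Degrees 0 and 1 of d ∘ Φ^* = Φ^* ∘ d yield compatibility with
anchors and with brackets of related sections; the converse `IsMorphism.of_related` uses that the
Koszul differential is tensorial. Every passage between sections and fibres rests on global sections
and coordinate forms that restrict to a frame near a given point, with a cutoff function. -/

set_option linter.unusedSectionVars false

noncomputable section

namespace LieExt

/-! ### Smooth sections along a map -/

section Along

variable {EM : Type*} [NormedAddCommGroup EM] [NormedSpace ℝ EM]
  {M : Type*} [TopologicalSpace M] [ChartedSpace EM M]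
  {EN : Type*} [NormedAddCommGroup EN] [NormedSpace ℝ EN]
  {HN : Type*} [TopologicalSpace HN] {J : ModelWithCorners ℝ EN HN}
  {N : Type*} [TopologicalSpace N] [ChartedSpace HN N]

/-- Smoothness at a point of a section `t` of the bundle `A` along a map `φ`. -/
def VBundle.SmoothAlongAt (A : VBundle.{v} EM M) (J : ModelWithCorners ℝ EN HN) (φ : N → M)
    (t : ∀ n, A.V (φ n)) (n₀ : N) : Prop :=
  ContMDiffAt J (𝓘(ℝ, EM).prod 𝓘(ℝ, A.F)) ∞ (fun n => (⟨φ n, t n⟩ : TotalSpace A.F A.V)) n₀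

namespace VBundle.SmoothAlongAt

variable {A : VBundle.{v} EM M} {φ : N → M} {t t' : ∀ n, A.V (φ n)} {n₀ : N}

lemma iff_coord : A.SmoothAlongAt J φ t n₀ ↔ ContMDiffAt J 𝓘(ℝ, EM) ∞ φ n₀ ∧
    ContMDiffAt J 𝓘(ℝ, A.F) ∞ (fun n => (trivializationAt A.F A.V (φ n₀) ⟨φ n, t n⟩).2) n₀ :=
  contMDiffAt_totalSpace

lemma base (h : A.SmoothAlongAt J φ t n₀) : ContMDiffAt J 𝓘(ℝ, EM) ∞ φ n₀ := (iff_coord.1 h).1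

lemma eventually_mem (hφ : ContMDiffAt J 𝓘(ℝ, EM) ∞ φ n₀) :
    ∀ᶠ n in nhds n₀, φ n ∈ (trivializationAt A.F A.V (φ n₀)).baseSet :=
  hφ.continuousAt.eventually ((trivializationAt A.F A.V (φ n₀)).open_baseSet.mem_nhds
    (FiberBundle.mem_baseSet_trivializationAt' _))

lemma add (h : A.SmoothAlongAt J φ t n₀) (h' : A.SmoothAlongAt J φ t' n₀) :
    A.SmoothAlongAt J φ (fun n => t n + t' n) n₀ := by
  refine iff_coord.2 ⟨h.base, ((iff_coord.1 h).2.add (iff_coord.1 h').2).congr_of_eventuallyEq ?_⟩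
  filter_upwards [eventually_mem (A := A) h.base] with n hn
  exact ((trivializationAt A.F A.V (φ n₀)).linear ℝ hn).1 _ _

lemma smul {f : N → ℝ} (hf : ContMDiffAt J 𝓘(ℝ, ℝ) ∞ f n₀) (h : A.SmoothAlongAt J φ t n₀) :
    A.SmoothAlongAt J φ (fun n => f n • t n) n₀ := by
  refine iff_coord.2 ⟨h.base, (hf.smul (iff_coord.1 h).2).congr_of_eventuallyEq ?_⟩
  filter_upwards [eventually_mem (A := A) h.base] with n hn
  exact ((trivializationAt A.F A.V (φ n₀)).linear ℝ hn).2 _ _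

lemma congr (h : A.SmoothAlongAt J φ t n₀) (e : ∀ᶠ n in nhds n₀, t' n = t n) :
    A.SmoothAlongAt J φ t' n₀ := by
  refine ContMDiffAt.congr_of_eventuallyEq h ?_
  filter_upwards [e] with n hn
  rw [hn]

lemma zero (hφ : ContMDiffAt J 𝓘(ℝ, EM) ∞ φ n₀) : A.SmoothAlongAt J φ (fun _ => 0) n₀ :=
  ((contMDiff_zeroSection ℝ A.V).contMDiffAt (x := φ n₀)).comp n₀ hφ

lemma sum {ι : Type*} {s : Finset ι} {t : ι → ∀ n, A.V (φ n)}
    (hφ : ContMDiffAt J 𝓘(ℝ, EM) ∞ φ n₀) (h : ∀ i ∈ s, A.SmoothAlongAt J φ (t i) n₀) :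
    A.SmoothAlongAt J φ (fun n => ∑ i ∈ s, t i n) n₀ := by
  classical
  induction s using Finset.induction_on with
  | empty => simpa using zero hφ
  | insert i s hi ih =>
    simp only [Finset.sum_insert hi]
    exact (h _ (s.mem_insert_self i)).add (ih fun i a => h _ (s.mem_insert_of_mem a))

/-- Global frames recover a vector only up to the cutoff function; this lemma divides by it where it
does not vanish. -/
lemma of_smul {f : N → ℝ} (hf : ContMDiffAt J 𝓘(ℝ, ℝ) ∞ f n₀) (h0 : f n₀ ≠ 0)
    (h : A.SmoothAlongAt J φ (fun n => f n • t n) n₀) : A.SmoothAlongAt J φ t n₀ := by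
  refine (h.smul (hf.inv₀ h0)).congr ?_
  filter_upwards [hf.continuousAt.eventually_ne h0] with n hn
  rw [smul_smul, inv_mul_cancel₀ hn, one_smul]

lemma of_section (s : A.Sec) (hφ : ContMDiffAt J 𝓘(ℝ, EM) ∞ φ n₀) :
    A.SmoothAlongAt J φ (fun n => s (φ n)) n₀ :=
  (s.contMDiff.contMDiffAt (x := φ n₀)).comp n₀ hφ

end VBundle.SmoothAlongAt

end Along

/-! ### Global frames with cutoff -/

section Frames

variable {EM : Type*} [NormedAddCommGroup EM] [NormedSpace ℝ EM]
  {M : Type*} [TopologicalSpace M] [ChartedSpace EM M]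

lemma VBundle.fsmul_apply (A : VBundle.{v} EM M) (f : C^∞⟮𝓘(ℝ, EM), M; ℝ⟯) (s : A.Sec) (x : M) :
    A.fsmul f s x = f x • s x := rfl

/-- With this instance, identities among products of functions and sections reduce to the module
axioms. -/
instance VBundle.secModule (A : VBundle.{v} EM M) : Module C^∞⟮𝓘(ℝ, EM), M; ℝ⟯ A.Sec where
  smul f s := A.fsmul f s
  one_smul s := by ext x; exact one_smul ℝ (s x)
  mul_smul f g s := by ext x; exact mul_smul (f x) (g x) (s x)
  smul_zero f := by ext x; exact smul_zero (f x)
  smul_add f s t := by ext x; exact smul_add (f x) (s x) (t x)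
  add_smul f g s := by ext x; exact add_smul (f x) (g x) (s x)
  zero_smul s := by ext x; exact zero_smul ℝ (s x)

lemma VBundle.smul_eq_fsmul (A : VBundle.{v} EM M) (f : C^∞⟮𝓘(ℝ, EM), M; ℝ⟯) (s : A.Sec) :
    f • s = A.fsmul f s := rfl

/-- The section given by a smooth map along the identity. -/
def VBundle.mkSec (A : VBundle.{v} EM M) (s : ∀ x, A.V x)
    (h : ∀ x, A.SmoothAlongAt 𝓘(ℝ, EM) id s x) : A.Sec := ⟨s, fun x => h x⟩

/-- Global sections and coordinate forms which restrict to a frame and its dual frame near `y`. -/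
structure VBundle.Frame (A : VBundle.{v} EM M) (y : M) where
  n : ℕ
  cut : C^∞⟮𝓘(ℝ, EM), M; ℝ⟯
  cut_self : cut y = 1
  sec : Fin n → A.Sec
  coord : Fin n → ∀ x, A.V x →ₗ[ℝ] ℝ
  contMDiff_coord : ∀ i, ContMDiff (𝓘(ℝ, EM).prod 𝓘(ℝ, A.F)) 𝓘(ℝ, ℝ) ∞
    (fun a : TotalSpace A.F A.V => coord i a.1 a.2)
  sum_coord : ∀ x v, ∑ i, coord i x v • sec i x = cut x • v
  coord_sec : ∀ i j, coord i y (sec j y) = if i = j then 1 else 0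

variable [FiniteDimensional ℝ EM] [T2Space M]

/-- A bump function supported in the base set of a trivialization multiplies both the local frame
and the dual coordinates; each product extends smoothly by zero. -/
instance VBundle.nonempty_frame [IsManifold 𝓘(ℝ, EM) ∞ M] (A : VBundle.{v} EM M) (y : M) :
    Nonempty (A.Frame y) := by
  set e := trivializationAt A.F A.V y with he
  have hy : y ∈ e.baseSet := FiberBundle.mem_baseSet_trivializationAt' _
  obtain ⟨ψ, -, hψ⟩ := (SmoothBumpFunction.nhds_basis_tsupport (I := 𝓘(ℝ, EM)) y).mem_iff.1
    (e.open_baseSet.mem_nhds hy)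
  let b := Module.finBasis ℝ A.F
  have hs : ∀ i, ContMDiff 𝓘(ℝ, EM) (𝓘(ℝ, EM).prod 𝓘(ℝ, A.F)) ∞
      (fun x => TotalSpace.mk' A.F x ((⇑ψ • e.localFrame b i) x)) := fun i =>
    ContMDiffOn.smul_section_of_tsupport ψ.contMDiff.contMDiffOn e.open_baseSet hψ
      (e.contMDiffOn_localFrame_baseSet ∞ b i)
  have hsupp : ∀ x, x ∉ e.baseSet → ψ x = 0 := fun x hx =>
    image_eq_zero_of_notMem_tsupport fun h => hx (hψ h)
  let c : Fin _ → ∀ x, A.V x →ₗ[ℝ] ℝ := fun i x =>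
    ψ x • (b.coord i ∘ₗ (e.linearMapAt ℝ x))
  have hc : ∀ i x v, x ∈ e.baseSet → c i x v = ψ x * b.coord i (e ⟨x, v⟩).2 := by
    intro i x v hx
    simp [c, e.coe_linearMapAt_of_mem hx]
  -- The cutoff is the square of the bump function because the sections and the coordinates each
  -- contribute one factor.
  refine ⟨⟨_, ⟨fun x => ψ x * ψ x, ψ.contMDiff.mul ψ.contMDiff⟩, ?_, fun i => ⟨_, hs i⟩, c, ?_, ?_, ?_⟩⟩
  · show ψ y * ψ y = 1
    simp
  · intro i a
    by_cases ha : a.1 ∈ tsupport ψ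
    · have hsrc : a ∈ e.source := e.mem_source.2 (hψ ha)
      have h1 : ContMDiffAt (𝓘(ℝ, EM).prod 𝓘(ℝ, A.F)) 𝓘(ℝ, A.F) ∞
          (fun a : TotalSpace A.F A.V => (e a).2) a :=
        (contMDiff_snd.contMDiffAt (x := e a)).comp a
          (e.contMDiffOn.contMDiffAt (e.open_source.mem_nhds hsrc))
      have h2 : ContMDiffAt (𝓘(ℝ, EM).prod 𝓘(ℝ, A.F)) 𝓘(ℝ, ℝ) ∞
          (fun a : TotalSpace A.F A.V => b.coord i (e a).2) a :=
        ((LinearMap.toContinuousLinearMap (b.coord i)).contDiff.contMDiff.contMDiffAt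
          (x := (e a).2)).comp a h1
      have h3 : ContMDiffAt (𝓘(ℝ, EM).prod 𝓘(ℝ, A.F)) 𝓘(ℝ, ℝ) ∞
          (fun a : TotalSpace A.F A.V => ψ a.1) a :=
        (ψ.contMDiff.contMDiffAt (x := a.1)).comp a (contMDiff_proj A.V).contMDiffAt
      refine (h3.mul h2).congr_of_eventuallyEq ?_
      filter_upwards [e.open_source.mem_nhds hsrc] with a' ha'
      exact hc i a'.1 a'.2 (e.mem_source.1 ha')
    · have : (fun a : TotalSpace A.F A.V => c i a.1 a.2) =ᶠ[nhds a] fun _ => 0 := by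
        have h0 : ∀ᶠ x in nhds a.1, x ∉ tsupport ψ :=
          (isClosed_tsupport ψ).isOpen_compl.mem_nhds ha
        filter_upwards [(FiberBundle.continuous_proj A.F A.V).continuousAt.eventually h0] with a' ha'
        simp [c, image_eq_zero_of_notMem_tsupport ha']
      exact contMDiffAt_const.congr_of_eventuallyEq this
  · intro x v
    show ∑ i, c i x v • (ψ x • e.localFrame b i x) = (ψ x * ψ x) • v
    by_cases hx : x ∈ e.baseSet
    · conv_rhs => rw [← (e.basisAt b hx).sum_repr v]
      rw [Finset.smul_sum]
      refine Finset.sum_congr rfl fun i _ => ?_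
      rw [smul_smul, smul_smul, hc i x v hx, e.localFrame_apply_of_mem_baseSet b hx]
      congr 1
      simp [Trivialization.basisAt]
      ring
    · simp [hsupp x hx]
  · intro i j
    show c i y (ψ y • e.localFrame b j y) = _
    have h1 : b.coord i (e ⟨y, e.basisAt b hy j⟩).2 = (e.basisAt b hy).repr (e.basisAt b hy j) i := by
      simp [Trivialization.basisAt]
    rw [ψ.eq_one, one_smul, hc i y _ hy, ψ.eq_one, one_mul, e.localFrame_apply_of_mem_baseSet b hy,
      h1, Module.Basis.repr_self, Finsupp.single_apply]
    simp only [eq_comm]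

end Frames
end LieExt

namespace LieExt

/-! ### Smoothness of determinants and adjugates -/

section Det

variable {EN : Type*} [NormedAddCommGroup EN] [NormedSpace ℝ EN]
  {HN : Type*} [TopologicalSpace HN] {J : ModelWithCorners ℝ EN HN}
  {N : Type*} [TopologicalSpace N] [ChartedSpace HN N]

lemma contMDiffAt_det {n : ℕ} {Q : N → Matrix (Fin n) (Fin n) ℝ} {x : N}
    (h : ∀ i j, ContMDiffAt J 𝓘(ℝ, ℝ) ∞ (fun y => Q y i j) x) :
    ContMDiffAt J 𝓘(ℝ, ℝ) ∞ (fun y => (Q y).det) x := by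
  simp only [Matrix.det_apply']
  exact ContMDiffAt.sum fun σ _ => contMDiffAt_const.mul (contMDiffAt_finsetProd fun i _ => h _ _)

lemma contMDiffAt_adjugate {n : ℕ} {Q : N → Matrix (Fin n) (Fin n) ℝ} {x : N}
    (h : ∀ i j, ContMDiffAt J 𝓘(ℝ, ℝ) ∞ (fun y => Q y i j) x) (i j : Fin n) :
    ContMDiffAt J 𝓘(ℝ, ℝ) ∞ (fun y => (Q y).adjugate i j) x := by
  simp only [Matrix.adjugate_apply]
  refine contMDiffAt_det fun k l => ?_
  by_cases hk : k = j
  · subst hk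
    simp only [Matrix.updateRow_self]
    exact contMDiffAt_const
  · simp only [Matrix.updateRow_ne hk]
    exact h k l

end Det

/-! ### Tensoriality and smoothness tested on frames -/

section Frames

variable {EM : Type*} [NormedAddCommGroup EM] [NormedSpace ℝ EM]
  {M : Type*} [TopologicalSpace M] [ChartedSpace EM M]

/-- A smooth `1`-form, as a family of functionals. -/
structure VBundle.Form1 (A : VBundle.{v} EM M) where
  toFun : ∀ x, A.V x →ₗ[ℝ] ℝ
  smooth : ∀ s : A.Sec, ContMDiff 𝓘(ℝ, EM) 𝓘(ℝ, ℝ) ∞ (fun x => toFun x (s x))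

namespace VBundle.Form1

variable {A : VBundle.{v} EM M}

def toAltForm (u : A.Form1) : A.AltForm 1 where
  toFun x := AlternatingMap.ofSubsingleton ℝ (A.V x) ℝ 0 (u.toFun x)
  smooth α := u.smooth (α 0)

/-- The function obtained by evaluating a `1`-form on a section. -/
def ev (u : A.Form1) (s : A.Sec) : C^∞⟮𝓘(ℝ, EM), M; ℝ⟯ := ⟨fun x => u.toFun x (s x), u.smooth s⟩

end VBundle.Form1

namespace VBundle.Frame

variable {A : VBundle.{v} EM M} {y : M} (fr : A.Frame y)

def form (i : Fin fr.n) : A.Form1 where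
  toFun := fr.coord i
  smooth s := (fr.contMDiff_coord i).comp s.contMDiff

lemma eq_sum (v : A.V y) : v = ∑ i, fr.coord i y v • fr.sec i y := by
  rw [fr.sum_coord, fr.cut_self, one_smul]

lemma sum_form (s : A.Sec) : ∑ i, A.fsmul ((fr.form i).ev s) (fr.sec i) = A.fsmul fr.cut s := by
  ext x
  have h : ∀ t : Finset (Fin fr.n), (∑ i ∈ t, A.fsmul ((fr.form i).ev s) (fr.sec i)) x =
      ∑ i ∈ t, fr.coord i x (s x) • fr.sec i x := by
    intro t
    induction t using Finset.induction_on with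
    | empty => rfl
    | insert a t ha ih =>
      rw [Finset.sum_insert ha, Finset.sum_insert ha, ContMDiffSection.coe_add, Pi.add_apply, ih]
      rfl
  rw [h, fr.sum_coord]
  rfl

end VBundle.Frame

variable [FiniteDimensional ℝ EM] [T2Space M] [IsManifold 𝓘(ℝ, EM) ∞ M]

section

variable (A : VBundle.{v} EM M)

/-- A chosen frame near `y`. -/
def VBundle.frame (y : M) : A.Frame y := Classical.choice (A.nonempty_frame y)

lemma VBundle.Sec.coe_sum {ι : Type*} (t : Finset ι) (s : ι → A.Sec) (x : M) :
    (∑ i ∈ t, s i) x = ∑ i ∈ t, s i x := by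
  induction t using Finset.cons_induction with
  | empty => rfl
  | cons a t ha ih =>
    rw [Finset.sum_cons, Finset.sum_cons, ContMDiffSection.coe_add, Pi.add_apply, ih]

/-- A global section with prescribed value at `y`. -/
def VBundle.extend (y : M) (v : A.V y) : A.Sec :=
  ∑ i, (A.frame y).coord i y v • (A.frame y).sec i

@[simp] lemma VBundle.extend_self (y : M) (v : A.V y) : A.extend y v y = v := by
  rw [VBundle.extend, VBundle.Sec.coe_sum]
  exact ((A.frame y).eq_sum v).symm

variable {A}

/-- The coordinate forms of a frame at the point already separate vectors. Identities in a fibre can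
thus be checked after pairing with 1-forms. -/
lemma VBundle.eq_of_forall_form {y : M} {v w : A.V y}
    (h : ∀ u : A.Form1, u.toFun y v = u.toFun y w) : v = w := by
  rw [(A.frame y).eq_sum v, (A.frame y).eq_sum w]
  exact Finset.sum_congr rfl fun i _ => by
    rw [show (A.frame y).coord i y v = _ from h ((A.frame y).form i)]; rfl

lemma VBundle.exists_form {y : M} (l : A.V y →ₗ[ℝ] ℝ) : ∃ u : A.Form1, u.toFun y = l := by
  refine ⟨⟨fun x => ∑ i, l ((A.frame y).sec i y) • (A.frame y).coord i x, fun s => ?_⟩, ?_⟩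
  · simp only [LinearMap.sum_apply, LinearMap.smul_apply]
    exact ContMDiff.sum fun i _ => contMDiff_const.mul (((A.frame y).form i).smooth s)
  · ext v
    conv_rhs => rw [(A.frame y).eq_sum v]
    simp [mul_comm]

/-- An operator on sections that is linear over functions at `y` depends only on values at `y`. -/
lemma VBundle.tensorial {W : Type*} [AddCommGroup W] [Module ℝ W] {y : M} (T : A.Sec → W)
    (hadd : ∀ s t, T (s + t) = T s + T t) (hsmul : ∀ f s, T (A.fsmul f s) = f y • T s)
    {s t : A.Sec} (h : s y = t y) : T s = T t := by
  let T' : A.Sec →+ W := AddMonoidHom.mk' T hadd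
  have key : ∀ s, T s = ∑ i, (A.frame y).coord i y (s y) • T ((A.frame y).sec i) := by
    intro s
    -- Multiplication by the cutoff changes nothing at `y`, while the product is a finite
    -- combination of the frame sections with smooth coefficients; so `T s` sees only the
    -- coefficients at `y`.
    have h1 : T (A.fsmul (A.frame y).cut s) = T s := by
      rw [hsmul, (A.frame y).cut_self, one_smul]
    rw [← h1, ← (A.frame y).sum_form s]
    exact (map_sum T' _ _).trans (Finset.sum_congr rfl fun i _ => hsmul _ _)
  rw [key s, key t, h]

/-- The linear map on the fibre at `y` induced by an operator that is linear over functions. -/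
def VBundle.tensorMap {W : Type*} [AddCommGroup W] [Module ℝ W] (y : M) (T : A.Sec → W)
    (hadd : ∀ s t, T (s + t) = T s + T t) (hsmul : ∀ f s, T (A.fsmul f s) = f y • T s) :
    A.V y →ₗ[ℝ] W where
  toFun v := T (A.extend y v)
  map_add' v w := by
    rw [← hadd]
    exact VBundle.tensorial T hadd hsmul (by simp)
  map_smul' c v := by
    rw [RingHom.id_apply, ← show (ContMDiffMap.const c : C^∞⟮𝓘(ℝ, EM), M; ℝ⟯) y • T _ = c • T _ from rfl,
      ← hsmul]
    exact VBundle.tensorial T hadd hsmul (by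
      rw [VBundle.fsmul_apply, VBundle.extend_self, VBundle.extend_self]; rfl)

lemma VBundle.tensorMap_apply {W : Type*} [AddCommGroup W] [Module ℝ W] {y : M} {T : A.Sec → W}
    (hadd : ∀ s t, T (s + t) = T s + T t) (hsmul : ∀ f s, T (A.fsmul f s) = f y • T s)
    (s : A.Sec) : VBundle.tensorMap y T hadd hsmul (s y) = T s :=
  VBundle.tensorial T hadd hsmul (by simp)

end

section Along

universe v'

variable {EN : Type*} [NormedAddCommGroup EN] [NormedSpace ℝ EN]
  {HN : Type*} [TopologicalSpace HN] {J : ModelWithCorners ℝ EN HN}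
  {N : Type*} [TopologicalSpace N] [ChartedSpace HN N]
  {A : VBundle.{v} EM M} {φ : N → M} {n₀ : N}

lemma VBundle.Frame.contMDiffAt_coord {y : M} (fr : A.Frame y) (i : Fin fr.n) {t : ∀ n, A.V (φ n)}
    (h : A.SmoothAlongAt J φ t n₀) : ContMDiffAt J 𝓘(ℝ, ℝ) ∞ (fun n => fr.coord i (φ n) (t n)) n₀ :=
  ((fr.contMDiff_coord i).contMDiffAt (x := (⟨φ n₀, t n₀⟩ : TotalSpace A.F A.V))).comp n₀ h

lemma VBundle.Frame.eventually_cut_ne (fr : A.Frame (φ n₀))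
    (hφ : ContMDiffAt J 𝓘(ℝ, EM) ∞ φ n₀) : ∀ᶠ n in nhds n₀, fr.cut (φ n) ≠ 0 := by
  have h : ContinuousAt (fun n => fr.cut (φ n)) n₀ :=
    (fr.cut.contMDiff.continuous.continuousAt).comp hφ.continuousAt
  exact h.eventually_ne (by rw [fr.cut_self]; exact one_ne_zero)

/-- A fibrewise linear map with smooth values on the sections of a frame is smooth. -/
lemma VBundle.Frame.smooth_map {EM' : Type*} [NormedAddCommGroup EM'] [NormedSpace ℝ EM']
    {M' : Type*} [TopologicalSpace M'] [ChartedSpace EM' M'] {A' : VBundle.{v'} EM' M'}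
    {ψ : N → M'} (fr : A.Frame (φ n₀)) (Ψ : ∀ n, A.V (φ n) →ₗ[ℝ] A'.V (ψ n))
    (hψ : ContMDiffAt J 𝓘(ℝ, EM') ∞ ψ n₀)
    (h : ∀ i, A'.SmoothAlongAt J ψ (fun n => Ψ n (fr.sec i (φ n))) n₀)
    {t : ∀ n, A.V (φ n)} (ht : A.SmoothAlongAt J φ t n₀) :
    A'.SmoothAlongAt J ψ (fun n => Ψ n (t n)) n₀ := by
  have h1 : A'.SmoothAlongAt J ψ
      (fun n => ∑ i, fr.coord i (φ n) (t n) • Ψ n (fr.sec i (φ n))) n₀ :=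
    SmoothAlongAt.sum hψ fun i _ => (h i).smul (fr.contMDiffAt_coord i ht)
  refine SmoothAlongAt.of_smul (f := fun n => fr.cut (φ n))
    ((fr.cut.contMDiff.contMDiffAt).comp n₀ ht.base) ?_ (h1.congr ?_)
  · rw [fr.cut_self]; exact one_ne_zero
  · filter_upwards with n
    simp_rw [← map_smul, ← map_sum, fr.sum_coord]

/-- A section along a map is smooth if its coordinates are. -/
lemma VBundle.Frame.smooth_of_coord (fr : A.Frame (φ n₀)) (hφ : ContMDiffAt J 𝓘(ℝ, EM) ∞ φ n₀)
    {t : ∀ n, A.V (φ n)}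
    (h : ∀ i, ContMDiffAt J 𝓘(ℝ, ℝ) ∞ (fun n => fr.coord i (φ n) (t n)) n₀) :
    A.SmoothAlongAt J φ t n₀ := by
  refine SmoothAlongAt.of_smul (f := fun n => fr.cut (φ n))
    ((fr.cut.contMDiff.contMDiffAt).comp n₀ hφ) (by rw [fr.cut_self]; exact one_ne_zero) ?_
  refine (SmoothAlongAt.sum (s := Finset.univ) hφ fun i _ =>
    (SmoothAlongAt.of_section (fr.sec i) hφ).smul (h i)).congr ?_
  filter_upwards with n
  rw [fr.sum_coord]

/-- A form is only required to be smooth on sections of the bundle itself. Expanding each argument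
in a frame reduces the general case to that one; multilinearity produces the `k`-th power of the
cutoff, which is divided out near the point. -/
lemma VBundle.AltForm.smooth_along {k : ℕ} (u : A.AltForm k) {t : Fin k → ∀ n, A.V (φ n)}
    (hφ : ContMDiffAt J 𝓘(ℝ, EM) ∞ φ n₀) (ht : ∀ i, A.SmoothAlongAt J φ (t i) n₀) :
    ContMDiffAt J 𝓘(ℝ, ℝ) ∞ (fun n => u.toFun (φ n) (fun i => t i n)) n₀ := by
  let fr := A.frame (φ n₀)
  have h1 : ContMDiffAt J 𝓘(ℝ, ℝ) ∞ (fun n => ∑ r : Fin k → Fin fr.n,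
      (∏ i, fr.coord (r i) (φ n) (t i n)) * u.toFun (φ n) (fun i => fr.sec (r i) (φ n))) n₀ := by
    refine ContMDiffAt.sum fun r _ => ContMDiffAt.mul ?_ ?_
    · exact contMDiffAt_finsetProd fun i _ => fr.contMDiffAt_coord _ (ht i)
    · exact ((u.smooth fun i => fr.sec (r i)).contMDiffAt (x := φ n₀)).comp n₀ hφ
  have hc : ContMDiffAt J 𝓘(ℝ, ℝ) ∞ (fun n => fr.cut (φ n) ^ k) n₀ :=
    ((fr.cut.contMDiff.contMDiffAt).comp n₀ hφ).pow k
  have h2 := (hc.inv₀ (by rw [fr.cut_self]; simp)).mul h1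
  refine h2.congr_of_eventuallyEq ?_
  filter_upwards [fr.eventually_cut_ne hφ] with n hn
  have h3 : u.toFun (φ n) (fun i => fr.cut (φ n) • t i n) =
      fr.cut (φ n) ^ k • u.toFun (φ n) (fun i => t i n) := by
    have := (u.toFun (φ n)).toMultilinearMap.map_smul_univ (fun _ => fr.cut (φ n)) (fun i => t i n)
    simpa using this
  have h4 : u.toFun (φ n) (fun i => fr.cut (φ n) • t i n) = ∑ r : Fin k → Fin fr.n,
      (∏ i, fr.coord (r i) (φ n) (t i n)) * u.toFun (φ n) (fun i => fr.sec (r i) (φ n)) := by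
    simp_rw [← fr.sum_coord]
    have := (u.toFun (φ n)).toMultilinearMap.map_sum
      (fun i (j : Fin fr.n) => fr.coord j (φ n) (t i n) • fr.sec j (φ n))
    refine this.trans (Finset.sum_congr rfl fun r _ => ?_)
    exact (u.toFun (φ n)).toMultilinearMap.map_smul_univ _ _
  have : (fr.cut (φ n) ^ k) ≠ 0 := pow_ne_zero _ hn
  simp only [Pi.mul_apply]
  rw [← h4, h3, smul_eq_mul, ← mul_assoc, inv_mul_cancel₀ this, one_mul]

lemma VBundle.Form1.smooth_along (u : A.Form1) {t : ∀ n, A.V (φ n)}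
    (ht : A.SmoothAlongAt J φ t n₀) :
    ContMDiffAt J 𝓘(ℝ, ℝ) ∞ (fun n => u.toFun (φ n) (t n)) n₀ :=
  u.toAltForm.smooth_along ht.base (t := fun _ => t) fun _ => ht

/-- A fibrewise linear map taking sections to smooth sections is smooth. -/
lemma VBundle.contMDiff_of_sections {EM' : Type*} [NormedAddCommGroup EM'] [NormedSpace ℝ EM']
    {M' : Type*} [TopologicalSpace M'] [ChartedSpace EM' M'] {A' : VBundle.{v'} EM' M'}
    {ψ : M → M'} (Ψ : ∀ x, A.V x →ₗ[ℝ] A'.V (ψ x)) (hψ : ContMDiff 𝓘(ℝ, EM) 𝓘(ℝ, EM') ∞ ψ)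
    (h : ∀ s : A.Sec, ∀ x, A'.SmoothAlongAt 𝓘(ℝ, EM) ψ (fun x => Ψ x (s x)) x) :
    ContMDiff (𝓘(ℝ, EM).prod 𝓘(ℝ, A.F)) (𝓘(ℝ, EM').prod 𝓘(ℝ, A'.F)) ∞
      (fun a : TotalSpace A.F A.V => (⟨ψ a.1, Ψ a.1 a.2⟩ : TotalSpace A'.F A'.V)) := by
  intro a
  have hp : ContMDiffAt (𝓘(ℝ, EM).prod 𝓘(ℝ, A.F)) 𝓘(ℝ, EM) ∞
    (fun a : TotalSpace A.F A.V => a.1) a := (contMDiff_proj A.V).contMDiffAt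
  exact (A.frame a.1).smooth_map (φ := fun a : TotalSpace A.F A.V => a.1)
    (ψ := fun a : TotalSpace A.F A.V => ψ a.1) (n₀ := a) (fun a => Ψ a.1)
    ((hψ.contMDiffAt (x := a.1)).comp a hp)
    (fun i => ContMDiffAt.comp a (h ((A.frame a.1).sec i) a.1) hp)
    (t := fun a => a.2) contMDiffAt_id

end Along

/-- The coordinates of a section are determined smoothly by its image under an injective map. -/
lemma VBundle.smooth_of_injective {A A' : VBundle.{v} EM M} (Ψ : ∀ x, A.V x →ₗ[ℝ] A'.V x)
    (hinj : ∀ x, Function.Injective (Ψ x))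
    (hΨ : ∀ s : A.Sec, ∀ x, A'.SmoothAlongAt 𝓘(ℝ, EM) id (fun x => Ψ x (s x)) x)
    {t : ∀ x, A.V x} {y : M} (ht : A'.SmoothAlongAt 𝓘(ℝ, EM) id (fun x => Ψ x (t x)) y) :
    A.SmoothAlongAt 𝓘(ℝ, EM) id t y := by
  let fr := A.frame y
  obtain ⟨l, hl⟩ := (Ψ y).exists_leftInverse_of_injective (LinearMap.ker_eq_bot.2 (hinj y))
  -- These forms pull back at `y` to the coordinates of the frame. The matrix `Q` of their values on
  -- the image of the frame is therefore the identity at `y`, and invertible nearby.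
  choose w hw using fun j => VBundle.exists_form (A := A') (fr.coord j y ∘ₗ l)
  let Q : M → Matrix (Fin fr.n) (Fin fr.n) ℝ := fun x i j => (w j).toFun x (Ψ x (fr.sec i x))
  have hQ : ∀ i j, ContMDiffAt 𝓘(ℝ, EM) 𝓘(ℝ, ℝ) ∞ (fun x => Q x i j) y :=
    fun i j => (w j).smooth_along (hΨ (fr.sec i) y)
  have hQy : Q y = 1 := by
    ext i j
    have h1 : l (Ψ y (fr.sec i y)) = fr.sec i y := LinearMap.congr_fun hl _
    simp only [Q]
    rw [hw j, LinearMap.comp_apply, h1, fr.coord_sec, Matrix.one_apply]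
    simp only [eq_comm]
  have hb : ∀ x j, fr.cut x * (w j).toFun x (Ψ x (t x)) = ∑ i, fr.coord i x (t x) * Q x i j := by
    intro x j
    simp only [Q, ← smul_eq_mul, ← map_smul, ← map_sum, fr.sum_coord]
  refine fr.smooth_of_coord contMDiffAt_id fun k => ?_
  -- Cramer's rule: the coordinates satisfy a linear system with matrix `Q` and smooth right-hand
  -- side, and the adjugate solves it up to the determinant.
  have hdet : ∀ x, (Q x).det * fr.coord k x (t x) =
      ∑ j, fr.cut x * (w j).toFun x (Ψ x (t x)) * (Q x).adjugate j k := by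
    intro x
    have h1 := congrFun (Matrix.vecMul_vecMul (fun i => fr.coord i x (t x)) (Q x) (Q x).adjugate) k
    rw [Matrix.mul_adjugate, Matrix.vecMul_smul, Matrix.vecMul_one] at h1
    simp only [hb]
    exact h1.symm
  have hd : ContMDiffAt 𝓘(ℝ, EM) 𝓘(ℝ, ℝ) ∞ (fun x => (Q x).det) y := contMDiffAt_det hQ
  have hy : (Q y).det ≠ 0 := by rw [hQy]; simp
  have h2 : ContMDiffAt 𝓘(ℝ, EM) 𝓘(ℝ, ℝ) ∞
      (fun x => ∑ j, fr.cut x * (w j).toFun x (Ψ x (t x)) * (Q x).adjugate j k) y :=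
    ContMDiffAt.sum fun j _ => (fr.cut.contMDiff.contMDiffAt.mul ((w j).smooth_along ht)).mul
      (contMDiffAt_adjugate hQ j k)
  refine ((hd.inv₀ hy).mul h2).congr_of_eventuallyEq ?_
  filter_upwards [hd.continuousAt.eventually_ne hy] with x hx
  simp only [Pi.mul_apply]
  rw [← hdet, ← mul_assoc, inv_mul_cancel₀ hx, one_mul]
  rfl

end Frames
end LieExt

namespace LieExt

universe u

/-! ### Vector fields as derivations of functions -/

section VectorFields

variable {EM : Type u} [NormedAddCommGroup EM] [NormedSpace ℝ EM] [FiniteDimensional ℝ EM]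
  {M : Type*} [TopologicalSpace M] [T2Space M] [ChartedSpace EM M] [IsManifold 𝓘(ℝ, EM) ∞ M]

variable (EM M) in
/-- The tangent bundle. -/
def tangentVBundle : VBundle.{u} EM M where
  F := EM
  V := TangentSpace 𝓘(ℝ, EM)

lemma contMDiff_mvfderiv (f : C^∞⟮𝓘(ℝ, EM), M; ℝ⟯) (V : VField EM M) :
    ContMDiff 𝓘(ℝ, EM) 𝓘(ℝ, ℝ) ∞ (fun x => mvfderiv 𝓘(ℝ, EM) f x (V x)) :=
  ((contMDiff_snd_tangentBundle_modelSpace ℝ 𝓘(ℝ, ℝ)).comp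
    (f.contMDiff.contMDiff_tangentMap (by simp))).comp V.contMDiff

/-- The derivative of a function along a vector field. -/
def VField.der (V : VField EM M) (f : C^∞⟮𝓘(ℝ, EM), M; ℝ⟯) : C^∞⟮𝓘(ℝ, EM), M; ℝ⟯ :=
  ⟨_, contMDiff_mvfderiv f V⟩

lemma VField.der_apply (V : VField EM M) (f : C^∞⟮𝓘(ℝ, EM), M; ℝ⟯) (x : M) :
    VField.der V f x = mvfderiv 𝓘(ℝ, EM) f x (V x) := rfl

lemma ContMDiffMap.mdiffAt (f : C^∞⟮𝓘(ℝ, EM), M; ℝ⟯) (x : M) :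
    MDifferentiableAt 𝓘(ℝ, EM) 𝓘(ℝ, ℝ) f x := f.contMDiff.mdifferentiable (by simp) x

lemma mvfderiv_map_add (f g : C^∞⟮𝓘(ℝ, EM), M; ℝ⟯) (x : M) (v : TangentSpace 𝓘(ℝ, EM) x) :
    mvfderiv 𝓘(ℝ, EM) (f + g) x v = mvfderiv 𝓘(ℝ, EM) f x v + mvfderiv 𝓘(ℝ, EM) g x v :=
  DFunLike.congr_fun (mvfderiv_add (ContMDiffMap.mdiffAt f x) (ContMDiffMap.mdiffAt g x)) v

lemma mvfderiv_map_mul (f g : C^∞⟮𝓘(ℝ, EM), M; ℝ⟯) (x : M) (v : TangentSpace 𝓘(ℝ, EM) x) :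
    mvfderiv 𝓘(ℝ, EM) (f * g) x v =
      f x * mvfderiv 𝓘(ℝ, EM) g x v + g x * mvfderiv 𝓘(ℝ, EM) f x v :=
  DFunLike.congr_fun (mvfderiv_mul (ContMDiffMap.mdiffAt f x) (ContMDiffMap.mdiffAt g x)) v

lemma VField.der_add_fun (V : VField EM M) (f g : C^∞⟮𝓘(ℝ, EM), M; ℝ⟯) :
    VField.der V (f + g) = VField.der V f + VField.der V g := by
  ext x; exact mvfderiv_map_add f g x _

lemma VField.der_mul (V : VField EM M) (f g : C^∞⟮𝓘(ℝ, EM), M; ℝ⟯) :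
    VField.der V (f * g) = f * VField.der V g + g * VField.der V f := by
  ext x; exact mvfderiv_map_mul f g x _

lemma VField.der_add (V W : VField EM M) (f : C^∞⟮𝓘(ℝ, EM), M; ℝ⟯) :
    VField.der (V + W) f = VField.der V f + VField.der W f := by
  ext x; exact map_add (mvfderiv 𝓘(ℝ, EM) f x) (V x) (W x)

lemma minSmoothness_le_infty (n : ℕ) : minSmoothness ℝ (n : WithTop ℕ∞) ≤ ∞ := by
  rw [minSmoothness_of_isRCLikeNormedField]
  exact mod_cast le_top

/-- The Lie bracket of smooth vector fields. -/
def VField.lie (V W : VField EM M) : VField EM M :=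
  ⟨VectorField.mlieBracket 𝓘(ℝ, EM) V W, fun x => by
    have : CompleteSpace EM := FiniteDimensional.complete ℝ EM
    have : IsManifold 𝓘(ℝ, EM) (minSmoothness ℝ 2) M :=
      IsManifold.of_le (n := ∞) (minSmoothness_le_infty 2)
    have : IsManifold 𝓘(ℝ, EM) ((⊤ : ℕ∞) + 1 : WithTop ℕ∞) M := ‹IsManifold 𝓘(ℝ, EM) ∞ M›
    exact ContMDiffAt.mlieBracket_vectorField (m := ⊤) (n := ⊤) (V.contMDiff x) (W.contMDiff x)
      (by simp)⟩

lemma VField.lie_apply (V W : VField EM M) (x : M) :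
    VField.lie V W x = VectorField.mlieBracket 𝓘(ℝ, EM) V W x := rfl

lemma VField.lie_swap (V W : VField EM M) : VField.lie V W = -VField.lie W V := by
  ext x; exact VectorField.mlieBracket_swap_apply

lemma VField.lie_add_right (V W W' : VField EM M) :
    VField.lie V (W + W') = VField.lie V W + VField.lie V W' := by
  have : CompleteSpace EM := FiniteDimensional.complete ℝ EM
  ext x
  exact VectorField.mlieBracket_add_right W.mdifferentiableAt W'.mdifferentiableAt

/-- The product of a smooth function and a vector field. -/
abbrev VField.fsmul (f : C^∞⟮𝓘(ℝ, EM), M; ℝ⟯) (V : VField EM M) : VField EM M :=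
  (tangentVBundle EM M).fsmul f V

lemma VField.lie_fsmul_right (f : C^∞⟮𝓘(ℝ, EM), M; ℝ⟯) (V W : VField EM M) :
    VField.lie V (VField.fsmul f W) =
      VField.fsmul (VField.der V f) W + VField.fsmul f (VField.lie V W) := by
  have : CompleteSpace EM := FiniteDimensional.complete ℝ EM
  ext x
  exact VectorField.mlieBracket_smul_right (ContMDiffMap.mdiffAt f x) W.mdifferentiableAt

lemma VField.leibniz (U V W : VField EM M) :
    VField.lie U (VField.lie V W) = VField.lie (VField.lie U V) W + VField.lie V (VField.lie U W) := by
  have : CompleteSpace EM := FiniteDimensional.complete ℝ EM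
  have : IsManifold 𝓘(ℝ, EM) (minSmoothness ℝ 3) M :=
    IsManifold.of_le (n := ∞) (minSmoothness_le_infty 3)
  have h2 : minSmoothness ℝ 2 ≤ ∞ := minSmoothness_le_infty 2
  ext x
  exact VectorField.leibniz_identity_mlieBracket_apply ((U.contMDiff x).of_le h2)
    ((V.contMDiff x).of_le h2) ((W.contMDiff x).of_le h2)

/-- Apply the Jacobi identity for vector fields to `V`, `W` and f·Z: after the Leibniz rule has been
used throughout, what survives is the claim multiplied by `Z`. Since `Z` can be prescribed at a
point, the factor may be cancelled. -/
lemma VField.der_lie (V W : VField EM M) (f : C^∞⟮𝓘(ℝ, EM), M; ℝ⟯) :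
    VField.der (VField.lie V W) f = VField.der V (VField.der W f) - VField.der W (VField.der V f) := by
  have key : ∀ Z : VField EM M, VField.fsmul (VField.der (VField.lie V W) f) Z =
      VField.fsmul (VField.der V (VField.der W f) - VField.der W (VField.der V f)) Z := by
    intro Z
    have h := VField.leibniz V W (VField.fsmul f Z)
    have h0 := VField.leibniz V W Z
    simp only [VField.lie_fsmul_right, VField.lie_add_right, h0] at h
    have e : ∀ (g h : C^∞⟮𝓘(ℝ, EM), M; ℝ⟯) (Z : VField EM M),
        VField.fsmul (g - h) Z = VField.fsmul g Z - VField.fsmul h Z :=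
      fun g h Z => sub_smul (M := (tangentVBundle EM M).Sec) g h Z
    have e' : ∀ (g : C^∞⟮𝓘(ℝ, EM), M; ℝ⟯) (Z Y : VField EM M),
        VField.fsmul g (Z + Y) = VField.fsmul g Z + VField.fsmul g Y :=
      fun g Z Y => smul_add (A := (tangentVBundle EM M).Sec) g Z Y
    rw [e']at h
    rw [e]
    have h' := h.symm
    rw [← sub_eq_zero] at h' ⊢
    rw [← h']
    abel
  ext x
  -- In dimension zero there is no nonzero `Z` to cancel, but all derivatives vanish.
  by_cases hs : Subsingleton EM
  · have h0 : ∀ (g : C^∞⟮𝓘(ℝ, EM), M; ℝ⟯) (U : VField EM M), VField.der U g x = 0 := fun g U => by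
      rw [VField.der_apply, show U x = 0 from Subsingleton.elim (α := EM) _ _, map_zero]
    show _ = VField.der V (VField.der W f) x - VField.der W (VField.der V f) x
    rw [h0, h0, h0, sub_zero]
  · rw [not_subsingleton_iff_nontrivial] at hs
    obtain ⟨z, hz⟩ := exists_ne (0 : EM)
    have h := DFunLike.congr_fun (key ((tangentVBundle EM M).extend x z)) x
    have h1 : (tangentVBundle EM M).extend x z x = z := VBundle.extend_self _ _ _
    have h2 : ∀ g : C^∞⟮𝓘(ℝ, EM), M; ℝ⟯, VField.fsmul g ((tangentVBundle EM M).extend x z) x =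
        (g x • z : EM) := fun g => congrArg (fun w : EM => g x • w) h1
    exact smul_left_injective ℝ (M := EM) hz ((h2 _).symm.trans (h.trans (h2 _)))

/-- A linear functional of the chart, cut off by a bump function, is a global smooth function; its
derivative separates two different tangent vectors because the derivative of the chart is injective.
-/
lemma eq_of_mvfderiv_eq {y : M} {v w : TangentSpace 𝓘(ℝ, EM) y}
    (h : ∀ f : C^∞⟮𝓘(ℝ, EM), M; ℝ⟯, mvfderiv 𝓘(ℝ, EM) f y v = mvfderiv 𝓘(ℝ, EM) f y w) :
    v = w := by
  by_contra hvw
  obtain ⟨ψ⟩ : Nonempty (SmoothBumpFunction 𝓘(ℝ, EM) y) := inferInstance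
  have hinv := (isInvertible_mfderiv_extChartAt (I := 𝓘(ℝ, EM)) (mem_extChartAt_source y))
  have hne : mfderiv 𝓘(ℝ, EM) 𝓘(ℝ, EM) (extChartAt 𝓘(ℝ, EM) y) y v ≠
      mfderiv 𝓘(ℝ, EM) 𝓘(ℝ, EM) (extChartAt 𝓘(ℝ, EM) y) y w := fun e => hvw (hinv.injective e)
  obtain ⟨l, hl⟩ := SeparatingDual.exists_separating_of_ne (R := ℝ) (V := EM) hne
  have hs : ContMDiff 𝓘(ℝ, EM) 𝓘(ℝ, ℝ) ∞ (fun x => ψ x • l (extChartAt 𝓘(ℝ, EM) y x)) := by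
    refine ψ.contMDiff_smul (g := fun x => l (extChartAt 𝓘(ℝ, EM) y x)) ?_
    intro x hx
    exact (l.contDiff.contMDiff.contMDiffAt.comp x (contMDiffAt_extChartAt' hx)).contMDiffWithinAt
  have hl' : MDifferentiableAt 𝓘(ℝ, EM) 𝓘(ℝ, ℝ) l (extChartAt 𝓘(ℝ, EM) y y) :=
    l.contDiff.contMDiff.mdifferentiable (n := ∞) (by simp) _
  have hc : MDifferentiableAt 𝓘(ℝ, EM) 𝓘(ℝ, EM) (extChartAt 𝓘(ℝ, EM) y) y :=
    (contMDiffAt_extChartAt (n := ∞)).mdifferentiableAt (by simp)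
  have key : ∀ u : TangentSpace 𝓘(ℝ, EM) y,
      mvfderiv 𝓘(ℝ, EM) (fun x => ψ x • l (extChartAt 𝓘(ℝ, EM) y x)) y u =
      l (mfderiv 𝓘(ℝ, EM) 𝓘(ℝ, EM) (extChartAt 𝓘(ℝ, EM) y) y u) := by
    intro u
    have h1 : (fun x => ψ x • l (extChartAt 𝓘(ℝ, EM) y x)) =ᶠ[nhds y]
        (l ∘ extChartAt 𝓘(ℝ, EM) y) := by
      filter_upwards [ψ.eventuallyEq_one] with x hx
      rw [hx]; exact one_smul _ _
    have h2 : mvfderiv 𝓘(ℝ, EM) (fun x => ψ x • l (extChartAt 𝓘(ℝ, EM) y x)) y u =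
        mvfderiv 𝓘(ℝ, EM) (l ∘ extChartAt 𝓘(ℝ, EM) y) y u :=
      congrArg (fun D : TangentSpace 𝓘(ℝ, EM) y →L[ℝ] ℝ => D u) h1.mfderiv_eq
    rw [h2, mvfderiv_comp_apply y hl' hc]
    show mfderiv 𝓘(ℝ, EM) 𝓘(ℝ, ℝ) l _ _ = _
    rw [mfderiv_eq_fderiv, l.fderiv]
    rfl
  have := h ⟨_, hs⟩
  exact hl ((key v).symm.trans (this.trans (key w)))

end VectorFields

/-! ### Anchor and action on functions at the level of sections -/

section Algebroid

variable {EM : Type u} [NormedAddCommGroup EM] [NormedSpace ℝ EM] [FiniteDimensional ℝ EM]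
  {M : Type*} [TopologicalSpace M] [T2Space M] [ChartedSpace EM M] [IsManifold 𝓘(ℝ, EM) ∞ M]
  (A : LieAlgebroid.{v} EM M)

namespace LieAlgebroid

/-- The anchor on sections. -/
def anchorSec (s : A.Sec) : VField EM M :=
  ⟨fun x => A.anchor x (s x), A.contMDiff_anchor.comp s.contMDiff⟩

lemma anchorSec_add (s t : A.Sec) : A.anchorSec (s + t) = A.anchorSec s + A.anchorSec t := by
  ext x; exact map_add (A.anchor x) (s x) (t x)

lemma anchorSec_bracket (s t : A.Sec) :
    A.anchorSec (A.bracket s t) = VField.lie (A.anchorSec s) (A.anchorSec t) := by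
  ext x; exact A.anchor_bracket s t x

/-- The action of sections on functions through the anchor. -/
def act (s : A.Sec) (f : C^∞⟮𝓘(ℝ, EM), M; ℝ⟯) : C^∞⟮𝓘(ℝ, EM), M; ℝ⟯ := VField.der (A.anchorSec s) f

lemma act_apply (s : A.Sec) (f : C^∞⟮𝓘(ℝ, EM), M; ℝ⟯) (x : M) :
    A.act s f x = mvfderiv 𝓘(ℝ, EM) f x (A.anchor x (s x)) := rfl

lemma act_add_left (s t : A.Sec) (f : C^∞⟮𝓘(ℝ, EM), M; ℝ⟯) :
    A.act (s + t) f = A.act s f + A.act t f := by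
  rw [act, anchorSec_add, VField.der_add]; rfl

lemma act_fsmul_left (g : C^∞⟮𝓘(ℝ, EM), M; ℝ⟯) (s : A.Sec) (f : C^∞⟮𝓘(ℝ, EM), M; ℝ⟯) :
    A.act (A.fsmul g s) f = g * A.act s f := by
  ext x
  show mvfderiv 𝓘(ℝ, EM) f x (A.anchor x (g x • s x)) = g x * _
  rw [map_smul, map_smul]; rfl

lemma act_add (s : A.Sec) (f g : C^∞⟮𝓘(ℝ, EM), M; ℝ⟯) :
    A.act s (f + g) = A.act s f + A.act s g := VField.der_add_fun _ _ _

lemma act_mul (s : A.Sec) (f g : C^∞⟮𝓘(ℝ, EM), M; ℝ⟯) :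
    A.act s (f * g) = f * A.act s g + g * A.act s f := VField.der_mul _ _ _

lemma bracket_fsmul_right (f : C^∞⟮𝓘(ℝ, EM), M; ℝ⟯) (s t : A.Sec) :
    A.bracket s (A.fsmul f t) = A.fsmul f (A.bracket s t) + A.fsmul (A.act s f) t := by
  ext x; exact A.leibniz f s t x

end LieAlgebroid

end Algebroid

end LieExt

namespace LieExt

/-! ### The Koszul differential is tensorial -/

section KoszulTensor

variable {R Γ W : Type*} [CommRing R] [AddCommGroup Γ] [Module R Γ] [AddCommGroup W] [Module R W]

lemma removeNth_succ_cons {α : Type*} {k : ℕ} (i : Fin (k + 1)) (a : α) (r : Fin (k + 1) → α) :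
    i.succ.removeNth (Fin.cons a r : Fin (k + 2) → α) = Fin.cons a (i.removeNth r) := by
  ext j
  refine Fin.cases ?_ (fun j => ?_) j
  · simp [Fin.removeNth_apply]
  · simp [Fin.removeNth_apply]

lemma removeNth_zero_cons {α : Type*} {k : ℕ} (a : α) (r : Fin k → α) :
    (0 : Fin (k + 1)).removeNth (Fin.cons a r : Fin (k + 1) → α) = r := by
  simp

lemma alternating_update {k : ℕ} (θ : Γ [⋀^Fin (k + 1)]→ₗ[R] W) (r : Fin (k + 1) → Γ)
    (j : Fin (k + 1)) (b : Γ) :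
    θ (Function.update r j b) = (-1 : ℤ) ^ (j : ℕ) • θ (Fin.cons b (j.removeNth r)) := by
  rw [← Fin.insertNth_removeNth, AlternatingMap.map_insertNth]
  rfl

lemma alternating_cons_swap {k : ℕ} (θ : Γ [⋀^Fin (k + 2)]→ₗ[R] W) (a b : Γ) (r : Fin k → Γ) :
    θ (Fin.cons a (Fin.cons b r)) = -θ (Fin.cons b (Fin.cons a r)) := by
  rw [← θ.map_swap (Fin.cons b (Fin.cons a r)) (Fin.zero_ne_one)]
  congr 1
  ext j
  refine Fin.cases ?_ (fun j => Fin.cases ?_ (fun j => ?_) j) j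
  · simp
  · simp
  · have h0 : j.succ.succ ≠ (0 : Fin (k + 2)) := Fin.succ_ne_zero _
    have h1 : j.succ.succ ≠ (1 : Fin (k + 2)) := by
      exact fun e => Fin.succ_ne_zero j (Fin.succ_injective _ (e.trans Fin.succ_zero_eq_one.symm))
    simp [Function.comp, Equiv.swap_apply_of_ne_of_ne h0 h1]

variable (br : Γ → Γ → Γ) (ρ : Γ → W → W) (X : Γ → R → R)

/-- A bracket on a module `Γ` and an action of `Γ` on a module `W` by first-order operators with
symbol `X`. -/
structure IsKoszulData : Prop where
  br_add : ∀ a b c, br a (b + c) = br a b + br a c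
  br_smul : ∀ a (f : R) b, br a (f • b) = f • br a b + X a f • b
  br_skew : ∀ a b, br a b = -br b a
  act_add_left : ∀ a b w, ρ (a + b) w = ρ a w + ρ b w
  act_smul_left : ∀ (f : R) a w, ρ (f • a) w = f • ρ a w
  act_add : ∀ a w w', ρ a (w + w') = ρ a w + ρ a w'
  act_smul : ∀ a (f : R) w, ρ a (f • w) = f • ρ a w + X a f • w

variable {br ρ X}

/-- Cartan's formula for the Koszul differential. -/
lemma koszul_cons {k : ℕ} (θ : Γ [⋀^Fin (k + 1)]→ₗ[R] W) (a : Γ)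
    (r : Fin (k + 1) → Γ) :
    koszul br ρ θ (Fin.cons a r) =
      ρ a (θ r) - ∑ j, θ (Function.update r j (br a (r j))) - koszul br ρ (θ.curryLeft a) r := by
  have h1 : ∑ i : Fin (k + 2), (-1 : ℤ) ^ (i : ℕ) •
        ρ ((Fin.cons a r : Fin (k + 2) → Γ) i) (θ (i.removeNth (Fin.cons a r : Fin (k + 2) → Γ))) =
      ρ a (θ r) - ∑ i : Fin (k + 1), (-1 : ℤ) ^ (i : ℕ) •
        ρ (r i) (θ.curryLeft a (i.removeNth r)) := by
    rw [Fin.sum_univ_succ, sub_eq_add_neg, ← Finset.sum_neg_distrib]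
    congr 1
    · simp
    · refine Finset.sum_congr rfl fun i _ => ?_
      rw [removeNth_succ_cons, Fin.cons_succ, Fin.val_succ, pow_succ, mul_neg_one, neg_smul]
      rfl
  -- Pairs whose smaller index is 0 give the sum over `j`. In every other pair both indices exceed
  -- their values in `r` by one, which does not affect the sign; moving the bracket past `a` gives
  -- the overall minus.
  have h2 : koszulBracketTerms br (k + 1) θ (Fin.cons a r) =
      -∑ j, θ (Function.update r j (br a (r j))) - koszulBracketTerms br k (θ.curryLeft a) r := by
    show ∑ j : Fin (k + 2), ∑ i : Fin (k + 1), _ = _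
    rw [Fin.sum_univ_succ]
    have h0 : ∀ i : Fin (k + 1), ¬ (i.castSucc < (0 : Fin (k + 2))) := fun i => Fin.not_lt_zero _
    simp only [h0, if_false, Finset.sum_const_zero, zero_add]
    refine (Finset.sum_congr rfl fun j _ => Fin.sum_univ_succ _).trans ?_
    rw [Finset.sum_add_distrib, sub_eq_add_neg]
    congr 1
    · rw [← Finset.sum_neg_distrib]
      refine Finset.sum_congr rfl fun j _ => ?_
      rw [if_pos (by simp), removeNth_succ_cons, removeNth_zero_cons, alternating_update]
      simp [pow_succ]
    · cases k with
      | zero => simp [koszulBracketTerms]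
      | succ n =>
        show _ = -∑ j : Fin (n + 2), ∑ i : Fin (n + 1), _
        rw [← Finset.sum_neg_distrib]
        refine Finset.sum_congr rfl fun j _ => ?_
        rw [← Finset.sum_neg_distrib]
        refine Finset.sum_congr rfl fun i _ => ?_
        have hlt : (i.succ.castSucc < j.succ) ↔ i.castSucc < j := by
          rw [← Fin.succ_castSucc, Fin.succ_lt_succ_iff]
        simp only [hlt]
        split_ifs with hij
        · rw [removeNth_succ_cons, removeNth_succ_cons, ← Fin.succ_castSucc, Fin.cons_succ,
            Fin.cons_succ, alternating_cons_swap, smul_neg]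
          congr 1
          have : (-1 : ℤ) ^ ((i.succ : ℕ) + (j.succ : ℕ)) = (-1) ^ ((i : ℕ) + (j : ℕ)) := by
            rw [Fin.val_succ, Fin.val_succ, show (i : ℕ) + 1 + (j + 1) = i + j + 2 by ring, pow_add]
            simp
          rw [this]
          rfl
        · simp
  rw [koszul, h1, h2, koszul]
  abel

lemma koszul_add (h : IsKoszulData br ρ X) {k : ℕ} (θ θ' : Γ [⋀^Fin k]→ₗ[R] W)
    (α : Fin (k + 1) → Γ) :
    koszul br ρ (θ + θ' : Γ [⋀^Fin k]→ₗ[R] W) α = koszul br ρ θ α + koszul br ρ θ' α := by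
  have h1 : koszulBracketTerms br k (θ + θ' : Γ [⋀^Fin k]→ₗ[R] W) α =
      koszulBracketTerms br k θ α + koszulBracketTerms br k θ' α := by
    cases k with
    | zero => simp [koszulBracketTerms]
    | succ n =>
      show ∑ j : Fin (n + 2), ∑ i : Fin (n + 1), _ =
        ∑ j : Fin (n + 2), ∑ i : Fin (n + 1), _ + ∑ j : Fin (n + 2), ∑ i : Fin (n + 1), _
      simp only [← Finset.sum_add_distrib]
      refine Finset.sum_congr rfl fun j _ => Finset.sum_congr rfl fun i _ => ?_
      split_ifs
      · rw [AlternatingMap.add_apply, smul_add]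
      · simp
  rw [koszul, koszul, koszul, h1]
  simp only [AlternatingMap.add_apply, h.act_add, smul_add, Finset.sum_add_distrib]
  abel

/-- The correction term is df ∧ θ, written out. -/
lemma koszul_smul (h : IsKoszulData br ρ X) {k : ℕ} (f : R) (θ : Γ [⋀^Fin k]→ₗ[R] W)
    (α : Fin (k + 1) → Γ) :
    koszul br ρ (f • θ : Γ [⋀^Fin k]→ₗ[R] W) α = f • koszul br ρ θ α +
      ∑ i : Fin (k + 1), (-1 : ℤ) ^ (i : ℕ) • X (α i) f • θ (i.removeNth α) := by
  have h1 : koszulBracketTerms br k (f • θ : Γ [⋀^Fin k]→ₗ[R] W) α =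
      f • koszulBracketTerms br k θ α := by
    cases k with
    | zero => simp [koszulBracketTerms]
    | succ n =>
      show ∑ j : Fin (n + 2), ∑ i : Fin (n + 1), _ = f • ∑ j : Fin (n + 2), ∑ i : Fin (n + 1), _
      simp only [Finset.smul_sum]
      refine Finset.sum_congr rfl fun j _ => Finset.sum_congr rfl fun i _ => ?_
      split_ifs
      · rw [AlternatingMap.smul_apply, smul_comm]
      · simp
  rw [koszul, koszul, h1]
  simp only [AlternatingMap.smul_apply, h.act_smul, smul_add, Finset.sum_add_distrib,
    Finset.smul_sum]
  simp only [smul_comm f ((-1 : ℤ) ^ _)]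
  abel

lemma IsKoszulData.br_add_left (h : IsKoszulData br ρ X) (a b c : Γ) :
    br (a + b) c = br a c + br b c := by
  rw [h.br_skew, h.br_add, h.br_skew c a, h.br_skew c b]; abel

lemma IsKoszulData.br_smul_left (h : IsKoszulData br ρ X) (f : R) (a b : Γ) :
    br (f • a) b = f • br a b - X b f • a := by
  rw [h.br_skew, h.br_smul, h.br_skew b a, smul_neg]; abel

/-- The Koszul differential of an alternating multilinear map is additive in each argument. -/
lemma koszul_update_add (h : IsKoszulData br ρ X) {k : ℕ} (θ : Γ [⋀^Fin k]→ₗ[R] W)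
    (α : Fin (k + 1) → Γ) (i : Fin (k + 1)) (b b' : Γ) :
    koszul br ρ θ (Function.update α i (b + b')) =
      koszul br ρ θ (Function.update α i b) + koszul br ρ θ (Function.update α i b') := by
  induction k with
  | zero =>
    obtain rfl : i = 0 := Subsingleton.elim (α := Fin 1) _ _
    simp [koszul, koszulBracketTerms, h.act_add_left]
  | succ k ih =>
    obtain ⟨a, r, rfl⟩ : ∃ a r, α = Fin.cons a r := ⟨α 0, Fin.tail α, (Fin.cons_self_tail α).symm⟩
    refine Fin.cases ?_ (fun i => ?_) i
    · simp only [Fin.update_cons_zero]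
      rw [koszul_cons, koszul_cons, koszul_cons]
      simp only [h.act_add_left, h.br_add_left, θ.map_update_add, Finset.sum_add_distrib]
      rw [show θ.curryLeft (b + b') = θ.curryLeft b + θ.curryLeft b' from map_add _ _ _,
        koszul_add h]
      abel
    · simp only [← Fin.cons_update]
      rw [koszul_cons, koszul_cons, koszul_cons, ih]
      have : ∀ j, θ (Function.update (Function.update r i (b + b')) j
            (br a (Function.update r i (b + b') j))) =
          θ (Function.update (Function.update r i b) j (br a (Function.update r i b j))) +
          θ (Function.update (Function.update r i b') j (br a (Function.update r i b' j))) := by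
        intro j
        by_cases hj : j = i
        · subst hj
          simp [h.br_add, θ.map_update_add]
        · simp only [Function.update_of_ne hj, Function.update_comm (Ne.symm hj),
            θ.map_update_add]
      simp only [this, Finset.sum_add_distrib, θ.map_update_add, h.act_add]
      abel

/-- The Koszul differential of an alternating multilinear map is homogeneous in each argument. -/
lemma koszul_update_smul (h : IsKoszulData br ρ X) {k : ℕ} (θ : Γ [⋀^Fin k]→ₗ[R] W)
    (α : Fin (k + 1) → Γ) (i : Fin (k + 1)) (f : R) (b : Γ) :
    koszul br ρ θ (Function.update α i (f • b)) = f • koszul br ρ θ (Function.update α i b) := by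
  induction k with
  | zero =>
    obtain rfl : i = 0 := Subsingleton.elim (α := Fin 1) _ _
    simp [koszul, koszulBracketTerms, h.act_smul_left]
  | succ k ih =>
    obtain ⟨a, r, rfl⟩ : ∃ a r, α = Fin.cons a r := ⟨α 0, Fin.tail α, (Fin.cons_self_tail α).symm⟩
    refine Fin.cases ?_ (fun i => ?_) i
    · simp only [Fin.update_cons_zero]
      rw [koszul_cons, koszul_cons,
        show θ.curryLeft (f • b) = f • θ.curryLeft b from map_smul _ _ _, koszul_smul h]
      -- The derivatives of `f` arising from the brackets with f·b cancel the df ∧ θ term of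
      -- `koszul_smul`, applied to the contraction of `θ` with `b`.
      have : ∀ j, θ (Function.update r j (br (f • b) (r j))) =
          f • θ (Function.update r j (br b (r j))) -
            (-1 : ℤ) ^ (j : ℕ) • X (r j) f • θ.curryLeft b (j.removeNth r) := by
        intro j
        rw [h.br_smul_left, θ.map_update_sub, θ.map_update_smul, θ.map_update_smul,
          alternating_update θ r j b, smul_comm (X (r j) f)]
        rfl
      simp only [this, h.act_smul_left, Finset.sum_sub_distrib, smul_sub, Finset.smul_sum]
      abel
    · simp only [← Fin.cons_update]
      rw [koszul_cons, koszul_cons, ih, θ.map_update_smul, h.act_smul]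
      -- Only the slot `j = i` differentiates `f`, and its contribution cancels the derivative of
      -- `f` that comes from letting `a` act on f·θ.
      have : ∀ j, θ (Function.update (Function.update r i (f • b)) j
            (br a (Function.update r i (f • b) j))) =
          f • θ (Function.update (Function.update r i b) j (br a (Function.update r i b j))) +
          if j = i then X a f • θ (Function.update r i b) else 0 := by
        intro j
        by_cases hj : j = i
        · subst hj
          simp [h.br_smul, θ.map_update_add, θ.map_update_smul]
        · simp only [Function.update_of_ne hj, Function.update_comm (Ne.symm hj),
            θ.map_update_smul, if_neg hj, add_zero]
      simp only [this, Finset.sum_add_distrib, Finset.sum_ite_eq', Finset.mem_univ, if_true,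
        smul_sub, Finset.smul_sum]
      abel

end KoszulTensor

end LieExt

namespace LieExt

/-! ### The Koszul formula in low degrees, and its naturality -/

section KoszulExpand

variable {Γ W : Type*} [AddCommGroup W] (br : Γ → Γ → Γ) (ρ : Γ → W → W)

lemma koszul_deg_zero (θ : (Fin 0 → Γ) → W) (α : Fin 1 → Γ) :
    koszul br ρ θ α = ρ (α 0) (θ ![]) := by
  simp [koszul, koszulBracketTerms, Subsingleton.elim (Fin.tail α) ![]]

lemma koszul_deg_one (θ : (Fin 1 → Γ) → W) (a b : Γ) :
    koszul br ρ θ ![a, b] = ρ a (θ ![b]) - ρ b (θ ![a]) - θ ![br a b] := by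
  have h0 : (0 : Fin 2).removeNth ![a, b] = ![b] := by ext i; fin_cases i; rfl
  have h1 : (1 : Fin 2).removeNth ![a, b] = ![a] := by ext i; fin_cases i; rfl
  have h2 : ∀ c : Γ, (Fin.cons c ((0 : Fin 1).removeNth ![b]) : Fin 1 → Γ) = ![c] := by
    intro c; ext i; fin_cases i; rfl
  have h3 : ∀ c : Γ, (Fin.cons c ((0 : Fin 1).removeNth ![a]) : Fin 1 → Γ) = ![c] := by
    intro c; ext i; fin_cases i; rfl
  have e : koszul br ρ θ ![a, b] = ∑ i : Fin 2, (-1 : ℤ) ^ (i : ℕ) •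
      ρ (![a, b] i) (θ (i.removeNth ![a, b])) + ∑ j : Fin 2, ∑ i : Fin 1, if i.castSucc < j then
        (-1 : ℤ) ^ ((i : ℕ) + (j : ℕ)) • θ (Fin.cons (br (![a, b] i.castSucc) (![a, b] j))
          (i.removeNth (j.removeNth ![a, b]))) else 0 := rfl
  rw [e, Fin.sum_univ_two, Fin.sum_univ_two, Fin.sum_univ_one, Fin.sum_univ_one, h0, h1, h2, h3]
  simp [sub_eq_add_neg]

lemma koszul_deg_two (θ : (Fin 2 → Γ) → W) (a b c : Γ) :
    koszul br ρ θ ![a, b, c] = ρ a (θ ![b, c]) - ρ b (θ ![a, c]) + ρ c (θ ![a, b]) -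
      θ ![br a b, c] + θ ![br a c, b] - θ ![br b c, a] := by
  have h0 : (0 : Fin 3).removeNth ![a, b, c] = ![b, c] := by ext i; fin_cases i <;> rfl
  have h1 : (1 : Fin 3).removeNth ![a, b, c] = ![a, c] := by ext i; fin_cases i <;> rfl
  have h2 : (2 : Fin 3).removeNth ![a, b, c] = ![a, b] := by ext i; fin_cases i <;> rfl
  have e0 : ∀ x y z : Γ, (Fin.cons x ((0 : Fin 2).removeNth ![y, z]) : Fin 2 → Γ) = ![x, z] := by
    intro x y z; ext i; fin_cases i <;> rfl
  have e1 : ∀ x y z : Γ, (Fin.cons x ((1 : Fin 2).removeNth ![y, z]) : Fin 2 → Γ) = ![x, y] := by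
    intro x y z; ext i; fin_cases i <;> rfl
  have e : koszul br ρ θ ![a, b, c] = ∑ i : Fin 3, (-1 : ℤ) ^ (i : ℕ) •
      ρ (![a, b, c] i) (θ (i.removeNth ![a, b, c])) + ∑ j : Fin 3, ∑ i : Fin 2,
        if i.castSucc < j then (-1 : ℤ) ^ ((i : ℕ) + (j : ℕ)) •
          θ (Fin.cons (br (![a, b, c] i.castSucc) (![a, b, c] j))
          (i.removeNth (j.removeNth ![a, b, c]))) else 0 := rfl
  rw [e]
  simp only [Fin.sum_univ_three, Fin.sum_univ_two, h0, h1, h2, e0, e1]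
  have l1 : (1 : Fin 2).castSucc < (2 : Fin 3) := by decide
  have l2 : ¬ (1 : Fin 2).castSucc < (1 : Fin 3) := by decide
  have l3 : ¬ (1 : Fin 2).castSucc < (0 : Fin 3) := by decide
  simp only [l1, l2, l3, if_true, if_false]
  simp [sub_eq_add_neg]
  abel

/-- The Koszul formula is natural for related tuples. -/
lemma koszul_natural {Γ' W' V : Type*} [AddCommGroup W'] [AddCommGroup V]
    {br' : Γ' → Γ' → Γ'} {ρ' : Γ' → W' → W'} {br ρ} (rel : Γ → Γ' → Prop)
    (hbr : ∀ a b a' b', rel a a' → rel b b' → rel (br a b) (br' a' b'))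
    (T : W →+ V) (T' : W' →+ V) {k : ℕ} (θ : (Fin k → Γ) → W) (θ' : (Fin k → Γ') → W')
    (hθ : ∀ α α', (∀ i, rel (α i) (α' i)) → T (θ α) = T' (θ' α'))
    (hρ : ∀ a a' α α', rel a a' → (∀ i, rel (α i) (α' i)) → T (ρ a (θ α)) = T' (ρ' a' (θ' α')))
    {α : Fin (k + 1) → Γ} {α' : Fin (k + 1) → Γ'} (h : ∀ i, rel (α i) (α' i)) :
    T (koszul br ρ θ α) = T' (koszul br' ρ' θ' α') := by
  simp only [koszul, map_add, map_sum, map_zsmul]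
  congr 1
  · exact Finset.sum_congr rfl fun i _ => congrArg _ (hρ _ _ _ _ (h i) fun j => h _)
  · cases k with
    | zero => simp [koszulBracketTerms]
    | succ n =>
      simp only [koszulBracketTerms, map_sum]
      refine Finset.sum_congr rfl fun j _ => Finset.sum_congr rfl fun i _ => ?_
      split_ifs
      · rw [map_zsmul, map_zsmul]
        congr 1
        refine hθ _ _ fun l => ?_
        refine Fin.cases ?_ (fun l => ?_) l
        · simpa using hbr _ _ _ _ (h _) (h _)
        · exact h _
      · simp

end KoszulExpand

/-! ### Differentials of functions and 1-forms as genuine forms -/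

section Forms

universe u

variable {EM : Type u} [NormedAddCommGroup EM] [NormedSpace ℝ EM] [FiniteDimensional ℝ EM]
  {M : Type*} [TopologicalSpace M] [T2Space M] [ChartedSpace EM M] [IsManifold 𝓘(ℝ, EM) ∞ M]

lemma LieAlgebroid.isKoszulData (A : LieAlgebroid.{v} EM M) :
    IsKoszulData (R := C^∞⟮𝓘(ℝ, EM), M; ℝ⟯) (fun a b => A.bracket a b)
      (fun a f => A.act a f) (fun a f => A.act a f) where
  br_add a b c := map_add _ _ _
  br_smul a f b := A.bracket_fsmul_right f a b
  br_skew := A.skew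
  act_add_left := A.act_add_left
  act_smul_left := fun f a w => A.act_fsmul_left f a w
  act_add := A.act_add
  act_smul a f w := by
    rw [smul_eq_mul, A.act_mul, smul_eq_mul, smul_eq_mul, mul_comm w]

/-- The arguments are exchanged one at a time, each exchange being the one-variable statement. -/
lemma VBundle.tensorial_multi {A : VBundle.{v} EM M} {k : ℕ}
    {K : (Fin k → A.Sec) → C^∞⟮𝓘(ℝ, EM), M; ℝ⟯}
    (hadd : ∀ α i b b', K (Function.update α i (b + b')) =
      K (Function.update α i b) + K (Function.update α i b'))
    (hsmul : ∀ α i (f : C^∞⟮𝓘(ℝ, EM), M; ℝ⟯) b, K (Function.update α i (f • b)) =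
      f • K (Function.update α i b)) {x : M} {α β : Fin k → A.Sec} (h : ∀ i, α i x = β i x) :
    K α x = K β x := by
  classical
  have key : ∀ S : Finset (Fin k), K (S.piecewise β α) x = K α x := by
    intro S
    induction S using Finset.induction_on with
    | empty => simp
    | insert i S hi ih =>
      rw [Finset.piecewise_insert, ← ih]
      conv_rhs => rw [← Function.update_eq_self i (S.piecewise β α)]
      refine VBundle.tensorial (W := ℝ) (y := x) (fun b => K (Function.update (S.piecewise β α) i b) x)
        (fun s t => by rw [hadd]; rfl) (fun f s => ?_) ?_
      · rw [← VBundle.smul_eq_fsmul, hsmul]; rfl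
      · rw [Finset.piecewise_eq_of_notMem _ _ _ hi, h]
  have := key Finset.univ
  rw [Finset.piecewise_univ] at this
  exact this.symm

/-- Alternating maps in two variables from bilinear alternating ones. -/
def alternatingOfBilin {V : Type*} [AddCommGroup V] [Module ℝ V] (b : V →ₗ[ℝ] V →ₗ[ℝ] ℝ)
    (h : ∀ v, b v v = 0) : V [⋀^Fin 2]→ₗ[ℝ] ℝ where
  toFun v := b (v 0) (v 1)
  map_update_add' m i x y := by
    fin_cases i
    · simp
    · simp
  map_update_smul' m i c x := by
    fin_cases i
    · simp
    · simp
  map_eq_zero_of_eq' v i j hv hij := by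
    fin_cases i <;> fin_cases j
    · exact absurd rfl hij
    · simp only [Fin.zero_eta, Fin.mk_one] at hv
      rw [hv, h]
    · simp only [Fin.zero_eta, Fin.mk_one] at hv
      rw [hv, h]
    · exact absurd rfl hij

namespace LieAlgebroid

variable (A : LieAlgebroid.{v} EM M)

/-- The differential of a `1`-form on sections. -/
def dEv (u : A.Form1) (a b : A.Sec) : C^∞⟮𝓘(ℝ, EM), M; ℝ⟯ :=
  A.act a (u.ev b) - A.act b (u.ev a) - u.ev (A.bracket a b)

end LieAlgebroid

namespace VBundle.Form1

variable {A : VBundle.{v} EM M} (u : A.Form1)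

lemma ev_add (a b : A.Sec) : u.ev (a + b) = u.ev a + u.ev b := by
  ext x; exact map_add (u.toFun x) (a x) (b x)

lemma ev_neg (a : A.Sec) : u.ev (-a) = -u.ev a := by
  ext x; exact map_neg (u.toFun x) (a x)

lemma ev_fsmul (f : C^∞⟮𝓘(ℝ, EM), M; ℝ⟯) (a : A.Sec) : u.ev (A.fsmul f a) = f * u.ev a := by
  ext x; exact map_smul (u.toFun x) (f x) (a x)

end VBundle.Form1

namespace LieAlgebroid

variable (A : LieAlgebroid.{v} EM M)

lemma dEv_add_right (u : A.Form1) (a b c : A.Sec) :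
    A.dEv u a (b + c) = A.dEv u a b + A.dEv u a c := by
  simp only [dEv, u.ev_add, A.act_add, A.act_add_left, map_add]
  ring

lemma dEv_fsmul_right (u : A.Form1) (f : C^∞⟮𝓘(ℝ, EM), M; ℝ⟯) (a b : A.Sec) :
    A.dEv u a (A.fsmul f b) = f * A.dEv u a b := by
  simp only [dEv, u.ev_fsmul, A.act_mul, A.act_fsmul_left, A.bracket_fsmul_right, u.ev_add]
  ring

lemma dEv_skew (u : A.Form1) (a b : A.Sec) : A.dEv u a b = -A.dEv u b a := by
  simp only [dEv]
  rw [A.skew b a, u.ev_neg]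
  ring

lemma dEv_add_left (u : A.Form1) (a b c : A.Sec) :
    A.dEv u (a + b) c = A.dEv u a c + A.dEv u b c := by
  rw [dEv_skew, dEv_add_right, A.dEv_skew u a c, A.dEv_skew u b c]
  ring

lemma dEv_fsmul_left (u : A.Form1) (f : C^∞⟮𝓘(ℝ, EM), M; ℝ⟯) (a b : A.Sec) :
    A.dEv u (A.fsmul f a) b = f * A.dEv u a b := by
  rw [dEv_skew, dEv_fsmul_right, A.dEv_skew u a b]
  ring

/-- The differential of a `1`-form, as a bilinear form on each fibre. -/
def dBilin (u : A.Form1) (x : M) : A.V x →ₗ[ℝ] A.V x →ₗ[ℝ] ℝ :=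
  VBundle.tensorMap x
    (fun a => VBundle.tensorMap (W := ℝ) x (fun b => A.dEv u a b x)
      (fun s t => by rw [dEv_add_right]; rfl) (fun f s => by rw [dEv_fsmul_right]; rfl))
    (fun s t => by
      ext v
      show A.dEv u (s + t) _ x = A.dEv u s _ x + A.dEv u t _ x
      rw [dEv_add_left]; rfl)
    (fun f s => by
      ext v
      show A.dEv u (A.fsmul f s) _ x = f x * A.dEv u s _ x
      rw [dEv_fsmul_left]; rfl)

lemma dBilin_apply (u : A.Form1) (x : M) (a b : A.Sec) :
    A.dBilin u x (a x) (b x) = A.dEv u a b x := by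
  rw [dBilin, VBundle.tensorMap_apply, VBundle.tensorMap_apply]

/-- The differential of a `1`-form. -/
def dForm (u : A.Form1) : A.AltForm 2 where
  toFun x := alternatingOfBilin (A.dBilin u x) fun v => by
    rw [← A.extend_self x v, dBilin_apply]
    have h := A.dEv_skew u (A.extend x v) (A.extend x v)
    have h' : A.dEv u (A.extend x v) (A.extend x v) x = -A.dEv u (A.extend x v) (A.extend x v) x :=
      congrArg (fun f : C^∞⟮𝓘(ℝ, EM), M; ℝ⟯ => f x) h
    linarith
  smooth α := by
    have : (fun x => A.dBilin u x (α 0 x) (α 1 x)) = A.dEv u (α 0) (α 1) :=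
      funext fun x => A.dBilin_apply u x _ _
    show ContMDiff _ _ _ (fun x => A.dBilin u x (α 0 x) (α 1 x))
    rw [this]
    exact (A.dEv u (α 0) (α 1)).contMDiff

/-- `IsMorphism.d_pullback` speaks only of differentials that are given as forms on the fibres; this
supplies such a form in degree 1, and `dFun_eval` does so in degree 0. -/
lemma dForm_eval (u : A.Form1) : (A.dForm u).eval = A.d u.toAltForm.eval := by
  funext α
  obtain ⟨a, b, rfl⟩ : ∃ a b, α = ![a, b] := ⟨α 0, α 1, by ext i; fin_cases i <;> rfl⟩
  funext x
  rw [LieAlgebroid.d, koszul_deg_one]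
  exact A.dBilin_apply u x a b

/-- The differential of a function. -/
def dFun (f : C^∞⟮𝓘(ℝ, EM), M; ℝ⟯) : A.Form1 where
  toFun x := (mvfderiv 𝓘(ℝ, EM) f x).toLinearMap ∘ₗ A.anchor x
  smooth s := (A.act s f).contMDiff

end LieAlgebroid

/-- A function as a form of degree `0`. -/
def VBundle.zeroForm (A : VBundle.{v} EM M) (f : C^∞⟮𝓘(ℝ, EM), M; ℝ⟯) : A.AltForm 0 where
  toFun x := AlternatingMap.constOfIsEmpty ℝ (A.V x) (Fin 0) (f x)
  smooth _ := f.contMDiff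

lemma LieAlgebroid.dFun_eval (A : LieAlgebroid.{v} EM M) (f : C^∞⟮𝓘(ℝ, EM), M; ℝ⟯) :
    (A.dFun f).toAltForm.eval = A.d (A.zeroForm f).eval := by
  funext α x
  rw [LieAlgebroid.d, koszul_deg_zero]
  rfl

end Forms

/-! ### Morphisms in terms of anchors and brackets -/

section Morphism

universe u u'

variable {EM : Type u} [NormedAddCommGroup EM] [NormedSpace ℝ EM] [FiniteDimensional ℝ EM]
  {M : Type*} [TopologicalSpace M] [T2Space M] [ChartedSpace EM M] [IsManifold 𝓘(ℝ, EM) ∞ M]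
  {EN : Type u'} [NormedAddCommGroup EN] [NormedSpace ℝ EN] [FiniteDimensional ℝ EN]
  {N : Type*} [TopologicalSpace N] [T2Space N] [ChartedSpace EN N] [IsManifold 𝓘(ℝ, EN) ∞ N]
  {A : LieAlgebroid.{v} EM M} {A' : LieAlgebroid.{v} EN N} {φ : M → N}
  {Φ : ∀ x, A.V x →ₗ[ℝ] A'.V (φ x)}

lemma mvfderiv_comp_smooth (hφ : ContMDiff 𝓘(ℝ, EM) 𝓘(ℝ, EN) ∞ φ) (f : C^∞⟮𝓘(ℝ, EN), N; ℝ⟯) (x : M)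
    (v : TangentSpace 𝓘(ℝ, EM) x) : mvfderiv 𝓘(ℝ, EM) (fun y => f (φ y)) x v =
      mvfderiv 𝓘(ℝ, EN) f (φ x) (mfderiv 𝓘(ℝ, EM) 𝓘(ℝ, EN) φ x v) :=
  mvfderiv_comp_apply x (ContMDiffMap.mdiffAt f _) (hφ.mdifferentiable (by simp) x) v

namespace IsMorphism

lemma smooth_sec (h : IsMorphism A A' φ Φ) (s : A.Sec) (x : M) :
    A'.SmoothAlongAt 𝓘(ℝ, EM) φ (fun x => Φ x (s x)) x :=
  ContMDiffAt.comp x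
    (g := fun a : TotalSpace A.F A.V => (⟨φ a.1, Φ a.1 a.2⟩ : TotalSpace A'.F A'.V))
    (h.contMDiff.contMDiffAt (x := (⟨x, s x⟩ : TotalSpace A.F A.V))) (s.contMDiff x)

/-- A morphism of Lie algebroids is compatible with the anchors. -/
lemma anchor (h : IsMorphism A A' φ Φ) (hφ : ContMDiff 𝓘(ℝ, EM) 𝓘(ℝ, EN) ∞ φ) (x : M) (v : A.V x) :
    mfderiv 𝓘(ℝ, EM) 𝓘(ℝ, EN) φ x (A.anchor x v) = A'.anchor (φ x) (Φ x v) := by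
  refine eq_of_mvfderiv_eq fun f => ?_
  -- Degree 0 of the morphism condition says that both candidate vectors differentiate every
  -- function in the same way.
  have h1 := h.d_pullback 0 (A'.zeroForm f) (A'.dFun f).toAltForm (A'.dFun_eval f)
  have h2 := congrFun (congrFun h1 ![A.extend x v]) x
  rw [LieAlgebroid.d, koszul_deg_zero] at h2
  have h3 : mvfderiv 𝓘(ℝ, EN) f (φ x) (A'.anchor (φ x) (Φ x (A.extend x v x))) =
    mvfderiv 𝓘(ℝ, EM) (fun y => f (φ y)) x (A.anchor x (A.extend x v x)) := h2
  rw [A.extend_self, mvfderiv_comp_smooth hφ] at h3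
  exact h3.symm

/-- A morphism of Lie algebroids preserves the brackets of related sections. -/
lemma bracket (h : IsMorphism A A' φ Φ) (hφ : ContMDiff 𝓘(ℝ, EM) 𝓘(ℝ, EN) ∞ φ) {s t : A.Sec}
    {a b : A'.Sec} (hs : ∀ x, Φ x (s x) = a (φ x)) (ht : ∀ x, Φ x (t x) = b (φ x)) (x : M) :
    Φ x (A.bracket s t x) = A'.bracket a b (φ x) := by
  refine VBundle.eq_of_forall_form fun u => ?_
  -- In degree 1, the two derivative terms of du agree on both sides because the anchors are
  -- compatible; what remains is the value of `u` on the two brackets.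
  have h1 := h.d_pullback 1 u.toAltForm (A'.dForm u) (A'.dForm_eval u)
  have h2 := congrFun (congrFun h1 ![s, t]) x
  rw [LieAlgebroid.d, koszul_deg_one] at h2
  have h3 : A'.dBilin u (φ x) (Φ x (s x)) (Φ x (t x)) =
    mvfderiv 𝓘(ℝ, EM) (fun y => u.toFun (φ y) (Φ y (t y))) x (A.anchor x (s x)) -
    mvfderiv 𝓘(ℝ, EM) (fun y => u.toFun (φ y) (Φ y (s y))) x (A.anchor x (t x)) -
    u.toFun (φ x) (Φ x (A.bracket s t x)) := h2
  simp only [hs, ht] at h3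
  have e : ∀ (c : A'.Sec) (v : A.V x),
      mvfderiv 𝓘(ℝ, EM) (fun y => u.toFun (φ y) (c (φ y))) x (A.anchor x v) =
      mvfderiv 𝓘(ℝ, EN) (u.ev c) (φ x) (A'.anchor (φ x) (Φ x v)) := fun c v => by
    rw [← h.anchor hφ]
    exact mvfderiv_comp_smooth hφ (u.ev c) x _
  rw [e, e, LieAlgebroid.dBilin_apply, hs, ht] at h3
  have h4 : A'.dEv u a b (φ x) = mvfderiv 𝓘(ℝ, EN) (u.ev b) (φ x) (A'.anchor (φ x) (a (φ x))) -
    mvfderiv 𝓘(ℝ, EN) (u.ev a) (φ x) (A'.anchor (φ x) (b (φ x))) -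
    u.toFun (φ x) (A'.bracket a b (φ x)) := rfl
  linarith

/-- The pullback of a form, as an alternating map over smooth functions. -/
def _root_.LieExt.pullbackAlt (hφ : ContMDiff 𝓘(ℝ, EM) 𝓘(ℝ, EN) ∞ φ)
    (hΦ : ∀ (s : A.Sec) x, A'.SmoothAlongAt 𝓘(ℝ, EM) φ (fun x => Φ x (s x)) x) {k : ℕ}
    (u : A'.AltForm k) : A.Sec [⋀^Fin k]→ₗ[C^∞⟮𝓘(ℝ, EM), M; ℝ⟯] C^∞⟮𝓘(ℝ, EM), M; ℝ⟯ where
  toFun α := ⟨pullbackEval φ Φ u α, fun x => u.smooth_along (hφ x) fun i => hΦ (α i) x⟩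
  map_update_add' {inst} α i s t := by
    ext x
    have e : ∀ r : A.Sec, (fun j => Φ x ((Function.update α i r) j x)) =
        Function.update (fun j => Φ x (α j x)) i (Φ x (r x)) := by
      intro r; ext j
      by_cases hj : j = i
      · subst hj; simp
      · simp [Function.update_of_ne hj]
    show u.toFun (φ x) _ = u.toFun (φ x) _ + u.toFun (φ x) _
    rw [e, e, e, ContMDiffSection.coe_add, Pi.add_apply, map_add, AlternatingMap.map_update_add]
  map_update_smul' {inst} α i f s := by
    ext x
    have e : ∀ r : A.Sec, (fun j => Φ x ((Function.update α i r) j x)) =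
        Function.update (fun j => Φ x (α j x)) i (Φ x (r x)) := by
      intro r; ext j
      by_cases hj : j = i
      · subst hj; simp
      · simp [Function.update_of_ne hj]
    show u.toFun (φ x) _ = f x • u.toFun (φ x) _
    rw [e, e, VBundle.smul_eq_fsmul, VBundle.fsmul_apply, map_smul, AlternatingMap.map_update_smul]
  map_eq_zero_of_eq' α i j h hij := by
    ext x
    exact (u.toFun (φ x)).map_eq_zero_of_eq _ (by rw [h]) hij

/-- A bundle map which is compatible with anchors and with brackets of related sections is a
morphism, provided that there are enough projectable sections. -/
theorem of_related (hφ : ContMDiff 𝓘(ℝ, EM) 𝓘(ℝ, EN) ∞ φ)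
    (hΦ : ∀ (s : A.Sec) x, A'.SmoothAlongAt 𝓘(ℝ, EM) φ (fun x => Φ x (s x)) x)
    (hanchor : ∀ x v, mfderiv 𝓘(ℝ, EM) 𝓘(ℝ, EN) φ x (A.anchor x v) = A'.anchor (φ x) (Φ x v))
    (hproj : ∀ x (v : A.V x), ∃ (s : A.Sec) (a : A'.Sec), s x = v ∧ ∀ y, Φ y (s y) = a (φ y))
    (hbr : ∀ (s t : A.Sec) (a b : A'.Sec), (∀ y, Φ y (s y) = a (φ y)) →
      (∀ y, Φ y (t y) = b (φ y)) → ∀ y, Φ y (A.bracket s t y) = A'.bracket a b (φ y)) :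
    IsMorphism A A' φ Φ where
  contMDiff := VBundle.contMDiff_of_sections Φ hφ hΦ
  d_pullback k u w hw := by
    funext α x
    -- At the fixed point `x` each argument is replaced by a projectable section with the same
    -- value. Tensoriality of the Koszul differential makes this harmless.
    choose s a hsv hsa using fun i => hproj x (α i x)
    let ev : C^∞⟮𝓘(ℝ, EM), M; ℝ⟯ →+ ℝ :=
      { toFun := fun f => f x, map_zero' := rfl, map_add' := fun _ _ => rfl }
    let ev' : (M → ℝ) →+ ℝ := Pi.evalAddMonoidHom _ x
    -- The tensoriality lemmas concern maps with values in smooth functions, whereas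
    -- `LieAlgebroid.d` takes arbitrary functions as values; naturality at the point `x` links the
    -- two.
    have h1 : ∀ β : Fin (k + 1) → A.Sec, ev (koszul (fun a b => A.bracket a b)
        (fun a f => A.act a f) (pullbackAlt hφ hΦ u) β) = ev' (A.d (pullbackEval φ Φ u) β) := by
      intro β
      refine koszul_natural (fun a b => a = b) ?_ ev ev' _ _ ?_ ?_ fun i => rfl
      · rintro _ _ _ _ rfl rfl; rfl
      · intro α α' h; rw [funext h]; rfl
      · intro _ _ α α' rfl h; rw [funext h]; rfl
    have h2 : A.d (pullbackEval φ Φ u) α x = A.d (pullbackEval φ Φ u) s x := by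
      refine (h1 α).symm.trans (Eq.trans ?_ (h1 s))
      exact VBundle.tensorial_multi (koszul_update_add A.isKoszulData _)
        (koszul_update_smul A.isKoszulData _) fun i => (hsv i).symm
    -- For projectable sections the Koszul formulas upstairs and downstairs agree term by term, the
    -- relation being "projects to".
    have h3 : A.d (pullbackEval φ Φ u) s x = A'.d u.eval a (φ x) := by
      have key : ∀ (α : Fin k → A.Sec) (α' : Fin k → A'.Sec),
          (∀ i y, Φ y (α i y) = α' i (φ y)) → ∀ y, pullbackEval φ Φ u α y = u.eval α' (φ y) := by
        intro α α' h y
        simp only [pullbackEval, h]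
        rfl
      show ev' (koszul (fun a b => A.bracket a b)
          (fun a f x => mvfderiv 𝓘(ℝ, EM) f x (A.anchor x (a x))) (pullbackEval φ Φ u) s) =
        Pi.evalAddMonoidHom (fun _ : N => ℝ) (φ x) (koszul (fun a b => A'.bracket a b)
          (fun a f x => mvfderiv 𝓘(ℝ, EN) f x (A'.anchor x (a x))) u.eval a)
      refine koszul_natural (fun (s : A.Sec) (a : A'.Sec) => ∀ y, Φ y (s y) = a (φ y)) ?_ ev'
        (Pi.evalAddMonoidHom (fun _ : N => ℝ) (φ x)) _ _ ?_ ?_ hsa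
      · exact fun s t a b => hbr s t a b
      · exact fun α α' h => key α α' h x
      · intro b c α α' hbc h
        show mvfderiv 𝓘(ℝ, EM) (pullbackEval φ Φ u α) x _ = _
        rw [funext (key α α' h)]
        refine (mvfderiv_comp_smooth hφ ⟨u.eval α', u.smooth α'⟩ x _).trans ?_
        rw [hanchor, hbc]
        rfl
    rw [h2, h3, ← congrFun (congrFun hw a) (φ x)]
    have : ∀ i, Φ x (α i x) = a i (φ x) := fun i => by rw [← hsv, hsa]
    simp only [pullbackEval, this]
    rfl

end IsMorphism

end Morphism

end LieExt

namespace LieExt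

universe u u'

/-! ### Extensions, splittings and existence of connections -/

section Ext

variable {EE : Type u} [NormedAddCommGroup EE] [NormedSpace ℝ EE] [FiniteDimensional ℝ EE]
  {E : Type*} [TopologicalSpace E] [T2Space E] [ChartedSpace EE E] [IsManifold 𝓘(ℝ, EE) ∞ E]
  {EB : Type u'} [NormedAddCommGroup EB] [NormedSpace ℝ EB] [FiniteDimensional ℝ EB]
  {B : Type*} [TopologicalSpace B] [T2Space B] [ChartedSpace EB B] [IsManifold 𝓘(ℝ, EB) ∞ B]
  {p : C^∞⟮𝓘(ℝ, EE), E; 𝓘(ℝ, EB), B⟯}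
  {K : LieAlgebroid.{v} EE E} {A : LieAlgebroid.{v} EB B}

namespace Extension

variable (X : Extension p K A)

lemma proj_anchor (x : E) (a : X.total.V x) :
    mfderiv 𝓘(ℝ, EE) 𝓘(ℝ, EB) p x (X.total.anchor x a) = A.anchor (p x) (X.proj x a) :=
  X.proj_morphism.anchor p.contMDiff x a

lemma incl_anchor (x : E) (k : K.V x) : X.total.anchor x (X.incl x k) = K.anchor x k := by
  have h := X.incl_morphism.anchor contMDiff_id x k
  rw [mfderiv_id] at h
  exact h.symm

lemma proj_incl (x : E) (k : K.V x) : X.proj x (X.incl x k) = 0 := by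
  have : X.incl x k ∈ LinearMap.ker (X.proj x) := by rw [← X.exact]; exact ⟨k, rfl⟩
  exact this

/-- The inclusion on sections. -/
def inclSec : K.Sec →ₗ[ℝ] X.total.Sec where
  toFun κ := ⟨fun x => X.incl x (κ x), fun x => X.incl_morphism.smooth_sec κ x⟩
  map_add' κ κ' := by ext x; exact map_add (X.incl x) (κ x) (κ' x)
  map_smul' c κ := by ext x; exact map_smul (X.incl x) c (κ x)

lemma inclSec_apply (κ : K.Sec) (x : E) : X.inclSec κ x = X.incl x (κ x) := rfl

lemma inclSec_injective : Function.Injective X.inclSec := fun κ κ' h => by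
  ext x; exact X.incl_injective x (DFunLike.congr_fun h x)

lemma inclSec_fsmul (f : C^∞⟮𝓘(ℝ, EE), E; ℝ⟯) (κ : K.Sec) :
    X.inclSec (K.fsmul f κ) = X.total.fsmul f (X.inclSec κ) := by
  ext x; exact map_smul (X.incl x) (f x) (κ x)

lemma inclSec_bracket (κ κ' : K.Sec) :
    X.inclSec (K.bracket κ κ') = X.total.bracket (X.inclSec κ) (X.inclSec κ') := by
  ext x
  exact X.incl_morphism.bracket contMDiff_id (fun _ => rfl) (fun _ => rfl) x

lemma anchorSec_inclSec (κ : K.Sec) : X.total.anchorSec (X.inclSec κ) = K.anchorSec κ := by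
  ext x; exact X.incl_anchor x (κ x)

lemma proj_bracket {s t : X.total.Sec} {a b : A.Sec} (hs : ∀ x, X.proj x (s x) = a (p x))
    (ht : ∀ x, X.proj x (t x) = b (p x)) (x : E) :
    X.proj x (X.total.bracket s t x) = A.bracket a b (p x) :=
  X.proj_morphism.bracket p.contMDiff hs ht x

/-- Exactness provides the section pointwise; it is smooth because coordinates can be recovered
smoothly through an injective bundle map. -/
lemma exists_lower (s : X.total.Sec) (h : ∀ x, X.proj x (s x) = 0) :
    ∃ κ : K.Sec, X.inclSec κ = s := by
  have h' : ∀ x, ∃ k, X.incl x k = s x := fun x => by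
    have : s x ∈ LinearMap.range (X.incl x) := by rw [X.exact]; exact h x
    exact this
  choose k hk using h'
  refine ⟨K.mkSec k fun x => ?_, ?_⟩
  · refine VBundle.smooth_of_injective X.incl X.incl_injective X.incl_morphism.smooth_sec ?_
    simp only [hk]
    exact s.contMDiff x
  · ext x; exact hk x

/-- The section of `K` corresponding to a section of the kernel of the projection. -/
def lower (s : X.total.Sec) (h : ∀ x, X.proj x (s x) = 0) : K.Sec := (X.exists_lower s h).choose

lemma inclSec_lower (s : X.total.Sec) (h : ∀ x, X.proj x (s x) = 0) :
    X.inclSec (X.lower s h) = s := (X.exists_lower s h).choose_spec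

/-- The splitting at a point defined by a lifting operator on sections. -/
def splitting (L : A.Sec → X.total.Sec) (hadd : ∀ a b, L (a + b) = L a + L b)
    (hsmul : ∀ (g : C^∞⟮𝓘(ℝ, EB), B; ℝ⟯) a, L (A.fsmul g a) = X.total.fsmul (g.comp p) (L a))
    (x : E) : A.V (p x) →ₗ[ℝ] X.total.V x :=
  VBundle.tensorMap (p x) (fun a => L a x) (fun a b => by rw [hadd]; rfl)
    (fun g a => by rw [hsmul]; rfl)

lemma splitting_apply (L : A.Sec → X.total.Sec) (hadd : ∀ a b, L (a + b) = L a + L b)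
    (hsmul : ∀ (g : C^∞⟮𝓘(ℝ, EB), B; ℝ⟯) a, L (A.fsmul g a) = X.total.fsmul (g.comp p) (L a))
    (x : E) (a : A.Sec) : X.splitting L hadd hsmul x (a (p x)) = L a x :=
  VBundle.tensorMap_apply _ _ a

/-- A connection from a lifting operator on sections. -/
def connectionOfLift (L : A.Sec → X.total.Sec) (hadd : ∀ a b, L (a + b) = L a + L b)
    (hsmul : ∀ (g : C^∞⟮𝓘(ℝ, EB), B; ℝ⟯) a, L (A.fsmul g a) = X.total.fsmul (g.comp p) (L a))
    (hproj : ∀ a x, X.proj x (L a x) = a (p x)) : X.Connection where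
  H x := LinearMap.range (X.splitting L hadd hsmul x)
  isCompl x := by
    have h : ∀ v, X.proj x (X.splitting L hadd hsmul x v) = v := fun v => by
      rw [← A.extend_self (p x) v, splitting_apply, hproj]
    refine ⟨Submodule.disjoint_def.2 ?_, Submodule.codisjoint_iff_exists_add_eq.2 fun w => ?_⟩
    · rintro _ hk ⟨v, rfl⟩
      have : v = 0 := (h v).symm.trans hk
      rw [this, map_zero]
    · refine ⟨w - X.splitting L hadd hsmul x (X.proj x w), _, ?_, ⟨X.proj x w, rfl⟩,
        sub_add_cancel _ _⟩
      rw [LinearMap.mem_ker, map_sub, h, sub_self]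
  lift := L
  lift_mem a x := ⟨a (p x), X.splitting_apply L hadd hsmul x a⟩
  proj_lift := hproj

/-- A lifting operator on sections which splits the projection up to a function not vanishing at
`x₀`. -/
lemma exists_local_lift (x₀ : E) : ∃ (G : C^∞⟮𝓘(ℝ, EE), E; ℝ⟯) (L : A.Sec → X.total.Sec), G x₀ ≠ 0 ∧
    (∀ a b, L (a + b) = L a + L b) ∧
    (∀ (g : C^∞⟮𝓘(ℝ, EB), B; ℝ⟯) a, L (A.fsmul g a) = X.total.fsmul (g.comp p) (L a)) ∧
    ∀ a x, X.proj x (L a x) = G x • a (p x) := by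
  let fr := A.frame (p x₀)
  choose w hw using fun i => X.proj_surjective x₀ (fr.sec i (p x₀))
  let e : Fin fr.n → X.total.Sec := fun i => X.total.extend x₀ (w i)
  -- The sections `e` lift the frame exactly at `x₀` only. `P` records their projections in the
  -- frame, and it is the identity at `x₀`.
  let P : E → Matrix (Fin fr.n) (Fin fr.n) ℝ := fun x i j => fr.coord j (p x) (X.proj x (e i x))
  have hP : ∀ i j x, ContMDiffAt 𝓘(ℝ, EE) 𝓘(ℝ, ℝ) ∞ (fun y => P y i j) x := fun i j x =>
    fr.contMDiffAt_coord j (X.proj_morphism.smooth_sec (e i) x)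
  have hP0 : P x₀ = 1 := by
    ext i j
    simp only [P, e]
    rw [VBundle.extend_self, hw, fr.coord_sec, Matrix.one_apply]
    simp only [eq_comm]
  let d : C^∞⟮𝓘(ℝ, EE), E; ℝ⟯ := ⟨fun x => (P x).det, fun x => contMDiffAt_det fun i j => hP i j x⟩
  let q : Fin fr.n → Fin fr.n → C^∞⟮𝓘(ℝ, EE), E; ℝ⟯ := fun i j =>
    ⟨fun x => (P x).adjugate i j, fun x => contMDiffAt_adjugate (fun i j => hP i j x) i j⟩
  let χ : C^∞⟮𝓘(ℝ, EE), E; ℝ⟯ := fr.cut.comp p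
  -- Correcting by the adjugate of `P` rather than by its inverse keeps `L` globally smooth; the
  -- price is the determinant in `G`. The other factor of `G` is the cutoff, which is needed to
  -- expand in the frame.
  let L : A.Sec → X.total.Sec := fun a =>
    X.total.fsmul χ (∑ i, ∑ j, X.total.fsmul (((fr.form i).ev a).comp p * q i j) (e j))
  have hL : ∀ a x, L a x = fr.cut (p x) • ∑ i, ∑ j,
      (fr.coord i (p x) (a (p x)) * (P x).adjugate i j) • e j x := by
    intro a x
    show fr.cut (p x) • (∑ i, ∑ j, X.total.fsmul (((fr.form i).ev a).comp p * q i j) (e j)) x = _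
    rw [VBundle.Sec.coe_sum]
    simp only [VBundle.Sec.coe_sum]
    rfl
  refine ⟨χ * d, L, ?_, ?_, ?_, ?_⟩
  · show fr.cut (p x₀) * (P x₀).det ≠ 0
    rw [fr.cut_self, hP0]
    simp
  · intro a b
    ext x
    rw [ContMDiffSection.coe_add, Pi.add_apply, hL, hL, hL, ContMDiffSection.coe_add, Pi.add_apply]
    simp only [map_add, add_mul, add_smul, Finset.sum_add_distrib, smul_add]
  · intro g a
    ext x
    show L (A.fsmul g a) x = g (p x) • L a x
    rw [hL, hL, smul_comm (g (p x)), Finset.smul_sum (r := g (p x))]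
    simp only [Finset.smul_sum (r := g (p x)), smul_smul, VBundle.fsmul_apply, map_smul, smul_eq_mul, mul_assoc]
  · intro a x
    rw [hL, map_smul]
    show _ = (fr.cut (p x) * (P x).det) • a (p x)
    have h1 : fr.cut (p x) • X.proj x (∑ i, ∑ j,
        (fr.coord i (p x) (a (p x)) * (P x).adjugate i j) • e j x) =
        ∑ l, ((P x).det * fr.coord l (p x) (a (p x))) • fr.sec l (p x) := by
      rw [← fr.sum_coord]
      refine Finset.sum_congr rfl fun l _ => ?_
      congr 1
      have h2 := congrFun (Matrix.vecMul_vecMul (fun i => fr.coord i (p x) (a (p x)))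
        (P x).adjugate (P x)) l
      rw [Matrix.adjugate_mul, Matrix.vecMul_smul, Matrix.vecMul_one] at h2
      refine Eq.trans ?_ h2
      simp only [map_sum, map_smul, smul_eq_mul, Matrix.vecMul, dotProduct, Finset.sum_mul]
      rw [Finset.sum_comm]
    rw [h1]
    simp only [mul_smul, ← Finset.smul_sum, fr.sum_coord]
    rw [smul_comm]

/-- Every extension admits a connection. -/
theorem nonempty_connection [SigmaCompactSpace E] : Nonempty X.Connection := by
  choose G L hG hadd hsmul hproj using X.exists_local_lift
  -- Wherever `G x₀` is nonzero, `L x₀` divided by it is a splitting. Splittings form an affine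
  -- space, so they can be averaged with weights supported in these open sets.
  obtain ⟨f, hf⟩ := SmoothPartitionOfUnity.exists_isSubordinate 𝓘(ℝ, EE) (isClosed_univ (X := E))
    (fun x₀ : E => {x | G x₀ x ≠ 0})
    (fun x₀ => isOpen_ne_fun (G x₀).contMDiff.continuous continuous_const)
    (fun x _ => mem_iUnion.2 ⟨x, hG x⟩)
  have hG' : ∀ i x, f i x ≠ 0 → G i x ≠ 0 := fun i x h => hf i (subset_tsupport _ h)
  have hfin : ∀ x, {i | f i x ≠ 0}.Finite := fun x => f.locallyFinite.point_finite x
  let S : E → Finset E := fun x => (hfin x).toFinset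
  have hsum : ∀ (a : A.Sec) x, ∑ᶠ i, f i x • (G i x)⁻¹ • L i a x =
      ∑ i ∈ S x, f i x • (G i x)⁻¹ • L i a x := by
    intro a x
    refine finsum_eq_sum_of_support_subset _ fun i hi => ?_
    simp only [S, Set.Finite.coe_toFinset]
    intro h0
    exact hi (by simp only [h0, zero_smul])
  have hsmooth : ∀ a : A.Sec, ContMDiff 𝓘(ℝ, EE) (𝓘(ℝ, EE).prod 𝓘(ℝ, X.total.F)) ∞
      (fun x => TotalSpace.mk' X.total.F x (∑ᶠ i, f i x • (G i x)⁻¹ • L i a x)) := by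
    intro a
    refine ContMDiff.finsum_section_of_locallyFinite ?_ fun i => ?_
    · refine f.locallyFinite.subset fun i x hx h0 => hx ?_
      show f i x • _ = _
      rw [h0, zero_smul]
    · refine ContMDiffOn.smul_section_of_tsupport (ψ := f i)
        (s := fun x => (G i x)⁻¹ • L i a x) (f i).contMDiff.contMDiffOn
        (isOpen_ne_fun (G i).contMDiff.continuous continuous_const) (hf i) fun x hx => ?_
      exact (ContMDiffAt.smul_section ((G i).contMDiff.contMDiffAt.inv₀ hx)
        (L i a).contMDiff.contMDiffAt).contMDiffWithinAt
  refine ⟨X.connectionOfLift (fun a => ⟨_, hsmooth a⟩) ?_ ?_ ?_⟩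
  · intro a b
    ext x
    show ∑ᶠ i, f i x • (G i x)⁻¹ • L i (a + b) x = ∑ᶠ i, _ + ∑ᶠ i, _
    rw [hsum, hsum, hsum, ← Finset.sum_add_distrib]
    exact Finset.sum_congr rfl fun i _ => by
      rw [hadd, ContMDiffSection.coe_add, Pi.add_apply, smul_add, smul_add]
  · intro g a
    ext x
    show ∑ᶠ i, f i x • (G i x)⁻¹ • L i (A.fsmul g a) x = g (p x) • ∑ᶠ i, _
    rw [hsum, hsum, Finset.smul_sum]
    refine Finset.sum_congr rfl fun i _ => ?_
    rw [hsmul, VBundle.fsmul_apply, smul_comm (g (p x)), smul_comm (g (p x))]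
    rfl
  · intro a x
    show X.proj x (∑ᶠ i, f i x • (G i x)⁻¹ • L i a x) = _
    rw [hsum, map_sum]
    have h1 : ∀ i ∈ S x, X.proj x (f i x • (G i x)⁻¹ • L i a x) = f i x • a (p x) := by
      intro i hi
      have hne : G i x ≠ 0 := hG' i x (by simpa [S] using hi)
      rw [map_smul, map_smul, hproj, smul_smul (G i x)⁻¹, inv_mul_cancel₀ hne, one_smul]
    rw [Finset.sum_congr rfl h1, ← Finset.sum_smul]
    have h2 : ∑ i ∈ S x, f i x = 1 := by
      rw [← f.sum_eq_one (mem_univ x)]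
      refine (finsum_eq_sum_of_support_subset _ fun i hi => ?_).symm
      simpa [S] using hi
    rw [h2, one_smul]

end Extension

end Ext

end LieExt

namespace LieExt

universe u u'

/-! ### Gauge equivalence, and the couple of a connection -/

section Ext

variable {EE : Type u} [NormedAddCommGroup EE] [NormedSpace ℝ EE] [FiniteDimensional ℝ EE]
  {E : Type*} [TopologicalSpace E] [T2Space E] [ChartedSpace EE E] [IsManifold 𝓘(ℝ, EE) ∞ E]
  {EB : Type u'} [NormedAddCommGroup EB] [NormedSpace ℝ EB] [FiniteDimensional ℝ EB]
  {B : Type*} [TopologicalSpace B] [T2Space B] [ChartedSpace EB B] [IsManifold 𝓘(ℝ, EB) ∞ B]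
  {p : C^∞⟮𝓘(ℝ, EE), E; 𝓘(ℝ, EB), B⟯}
  {K : LieAlgebroid.{v} EE E} {A : LieAlgebroid.{v} EB B}

lemma LieAlgebroid.bracket_leibniz (K : LieAlgebroid.{v} EE E) (a b c : K.Sec) :
    K.bracket a (K.bracket b c) = K.bracket (K.bracket a b) c + K.bracket b (K.bracket a c) := by
  have h := K.jacobi a b c
  rw [K.skew (K.bracket b c) a, K.skew (K.bracket c a) b, K.skew c a, map_neg, neg_neg] at h
  linear_combination (norm := module) -h

lemma LieAlgebroid.bracket_fsmul_left (K : LieAlgebroid.{v} EE E) (f : C^∞⟮𝓘(ℝ, EE), E; ℝ⟯)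
    (s t : K.Sec) :
    K.bracket (K.fsmul f s) t = K.fsmul f (K.bracket s t) - K.fsmul (K.act t f) s := by
  rw [K.skew, K.bracket_fsmul_right, K.skew t s]
  simp only [← VBundle.smul_eq_fsmul, smul_neg]
  abel

/-! ### Forms with values in sections of `K` -/

namespace KForm

/-- A `1`-form from a linear map on sections. -/
def ofLinear (d : A.Sec → K.Sec) (hadd : ∀ a b, d (a + b) = d a + d b)
    (hsmul : ∀ (g : C^∞⟮𝓘(ℝ, EB), B; ℝ⟯) a, d (A.fsmul g a) = K.fsmul (g.comp p) (d a)) :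
    KForm p K A 1 where
  toFun α := d (α 0)
  map_update_add α i b c := by
    obtain rfl : i = 0 := Subsingleton.elim _ _
    simp [hadd]
  map_update_fsmul α i g b := by
    obtain rfl : i = 0 := Subsingleton.elim _ _
    simp [hsmul]
  map_eq_zero_of_eq α i j _ hij := absurd (Subsingleton.elim i j) hij

variable (Δ : KForm p K A 1)

lemma apply_add (a b : A.Sec) : Δ.toFun ![a + b] = Δ.toFun ![a] + Δ.toFun ![b] := by
  have e : ∀ c, Function.update ![a] 0 c = ![c] := fun c => by ext i; fin_cases i; rfl
  have := Δ.map_update_add ![a] 0 a b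
  rwa [e, e, e] at this

lemma apply_fsmul (g : C^∞⟮𝓘(ℝ, EB), B; ℝ⟯) (a : A.Sec) :
    Δ.toFun ![A.fsmul g a] = K.fsmul (g.comp p) (Δ.toFun ![a]) := by
  have e : ∀ c, Function.update ![a] 0 c = ![c] := fun c => by ext i; fin_cases i; rfl
  have := Δ.map_update_fsmul ![a] 0 g a
  rwa [e, e] at this

/-- A `2`-form from an alternating bilinear map on sections. -/
def ofBilinear (w : A.Sec → A.Sec → K.Sec) (hadd : ∀ a b c, w (a + b) c = w a c + w b c)
    (hsmul : ∀ (g : C^∞⟮𝓘(ℝ, EB), B; ℝ⟯) a b, w (A.fsmul g a) b = K.fsmul (g.comp p) (w a b))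
    (hskew : ∀ a b, w a b = -w b a) : KForm p K A 2 :=
  -- Skew-symmetry gives 2w(a,a) = 0, and 2 is invertible in the real vector space of sections.
  have halt : ∀ a, w a a = 0 := fun a => by
    have h := hskew a a
    have h2 : (2 : ℝ) • w a a = 0 := by linear_combination (norm := module) h
    exact (smul_eq_zero.1 h2).resolve_left two_ne_zero
  { toFun := fun α => w (α 0) (α 1)
    map_update_add := fun α i b c => by
      fin_cases i
      · simp [hadd]
      · simp [hskew (α 0), hadd]
        abel
    map_update_fsmul := fun α i g b => by
      fin_cases i
      · simp [hsmul]
      · simp [hskew (α 0), hsmul]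
        simp only [← VBundle.smul_eq_fsmul, smul_neg]
    map_eq_zero_of_eq := fun α i j h hij => by
      fin_cases i <;> fin_cases j
      · exact absurd rfl hij
      · simp only [Fin.zero_eta, Fin.mk_one] at h
        simp only [h, halt]
      · simp only [Fin.zero_eta, Fin.mk_one] at h
        simp only [h, halt]
      · exact absurd rfl hij }

end KForm

/-! ### Couples -/

lemma LieAlgebroid.Der.ext' {D D' : K.Der} (hop : ∀ κ, D.op κ = D'.op κ)
    (hs : ∀ x, D.symbol x = D'.symbol x) : D = D' := by
  obtain ⟨op, s, _, _, _⟩ := D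
  obtain ⟨op', s', _, _, _⟩ := D'
  obtain rfl : op = op' := LinearMap.ext hop
  obtain rfl : s = s' := DFunLike.ext _ _ hs
  rfl

lemma LieAlgebroid.Der.anchorSec_op (D : K.Der) (κ : K.Sec) :
    K.anchorSec (D.op κ) = VField.lie D.symbol (K.anchorSec κ) := by
  ext x; exact D.anchor_op κ x

lemma vec_two_eta {α : Type*} (a : Fin 2 → α) : ![a 0, a 1] = a := by
  ext i; fin_cases i <;> rfl

lemma vec_three_eta {α : Type*} (a : Fin 3 → α) : ![a 0, a 1, a 2] = a := by
  ext i; fin_cases i <;> rfl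

lemma KForm.ext_two {w w' : KForm p K A 2} (h : ∀ a b, w.toFun ![a, b] = w'.toFun ![a, b]) :
    w = w' := by
  obtain ⟨f, _, _, _⟩ := w
  obtain ⟨f', _, _, _⟩ := w'
  obtain rfl : f = f' := funext fun α => by
    have := h (α 0) (α 1)
    rwa [vec_two_eta] at this
  rfl

namespace Couple

lemma ext' {c c' : Couple p K A} (hop : ∀ α κ, (c.D α).op κ = (c'.D α).op κ)
    (hs : ∀ α x, (c.D α).symbol x = (c'.D α).symbol x)
    (hf : ∀ a b, c.form.toFun ![a, b] = c'.form.toFun ![a, b]) : c = c' := by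
  obtain ⟨D, _, _, _, _, _, w⟩ := c
  obtain ⟨D', _, _, _, _, _, w'⟩ := c'
  obtain rfl : D = D' := funext fun α => LieAlgebroid.Der.ext' (hop α) (hs α)
  obtain rfl : w = w' := KForm.ext_two hf
  rfl

lemma covD_one (c : Couple p K A) (Δ : KForm p K A 1) (a b : A.Sec) :
    c.covD Δ ![a, b] = (c.D a).op (Δ.toFun ![b]) - (c.D b).op (Δ.toFun ![a]) -
      Δ.toFun ![A.bracket a b] := koszul_deg_one _ _ _ _ _

lemma covD_two (c : Couple p K A) (w : KForm p K A 2) (a b d : A.Sec) :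
    c.covD w ![a, b, d] = (c.D a).op (w.toFun ![b, d]) - (c.D b).op (w.toFun ![a, d]) +
      (c.D d).op (w.toFun ![a, b]) - w.toFun ![A.bracket a b, d] + w.toFun ![A.bracket a d, b] -
      w.toFun ![A.bracket b d, a] := koszul_deg_two _ _ _ _ _ _

end Couple

/-! ### Gauge equivalence is an equivalence relation -/

lemma IsGaugeTransform.refl (c : Couple p K A) :
    IsGaugeTransform (KForm.ofLinear (p := p) (K := K) (A := A) (fun _ => 0) (by simp)
      (fun g _ => (smul_zero (g.comp p)).symm)) c c where
  op α κ := by simp [KForm.ofLinear]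
  symbol α x := by simp [KForm.ofLinear]
  form α β := by
    rw [Couple.covD_one]
    simp [KForm.ofLinear]

/-- The inverse is −Δ: since D' = D + ad ∘ Δ, the D'-differential of Δ is ∂Δ + 2[Δ∧Δ], so the
quadratic terms cancel. -/
lemma IsGaugeTransform.symm {c c' : Couple p K A} {Δ : KForm p K A 1}
    (h : IsGaugeTransform Δ c c') :
    IsGaugeTransform (KForm.ofLinear (fun a => -Δ.toFun ![a])
      (fun a b => by rw [Δ.apply_add, neg_add])
      (fun g a => by rw [Δ.apply_fsmul]; exact (smul_neg (g.comp p) _).symm)) c' c where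
  op α κ := by
    rw [h.op]
    simp [KForm.ofLinear]
  symbol α x := by
    rw [h.symbol]
    simp [KForm.ofLinear]
  form α β := by
    rw [h.form, Couple.covD_one, Couple.covD_one]
    simp only [KForm.ofLinear, Matrix.cons_val_zero, map_neg, h.op, LinearMap.neg_apply]
    rw [K.skew (Δ.toFun ![β]) (Δ.toFun ![α])]
    module

/-- Gauge transformations compose by addition: the D'-differential of Δ' is its D-differential
together with exactly the cross terms of the bracket square of Δ + Δ'. -/
lemma IsGaugeTransform.trans {c c' c'' : Couple p K A} {Δ Δ' : KForm p K A 1}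
    (h : IsGaugeTransform Δ c c') (h' : IsGaugeTransform Δ' c' c'') :
    IsGaugeTransform (KForm.ofLinear (fun a => Δ.toFun ![a] + Δ'.toFun ![a])
      (fun a b => by rw [Δ.apply_add, Δ'.apply_add]; abel)
      (fun g a => by rw [Δ.apply_fsmul, Δ'.apply_fsmul]; exact (smul_add (g.comp p) _ _).symm))
      c c'' where
  op α κ := by
    rw [h'.op, h.op]
    simp only [KForm.ofLinear, Matrix.cons_val_zero, map_add, LinearMap.add_apply]
    module
  symbol α x := by
    rw [h'.symbol, h.symbol]
    simp only [KForm.ofLinear, Matrix.cons_val_zero, ContMDiffSection.coe_add, Pi.add_apply,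
      map_add, add_assoc]
  form α β := by
    rw [h'.form, h.form, Couple.covD_one, Couple.covD_one, Couple.covD_one]
    simp only [KForm.ofLinear, Matrix.cons_val_zero, map_add, h.op, LinearMap.add_apply]
    rw [K.skew (Δ.toFun ![β]) (Δ'.toFun ![α])]
    module

theorem gaugeEquivalent_equivalence :
    Equivalence (GaugeEquivalent (p := p) (K := K) (A := A)) where
  refl c := ⟨_, IsGaugeTransform.refl c.1⟩
  symm := fun ⟨_, h⟩ => ⟨_, h.symm⟩
  trans := fun ⟨_, h⟩ ⟨_, h'⟩ => ⟨_, h.trans h'⟩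

/-! ### Connections and couples -/

namespace Extension.Connection

variable {X : Extension p K A} (h : X.Connection)

/-- Horizontal vectors are determined by their projection. This forces the lift to be linear over
functions on the base, which the structure does not postulate. -/
lemma eq_of_proj {x : E} {v w : X.total.V x} (hv : v ∈ h.H x) (hw : w ∈ h.H x)
    (e : X.proj x v = X.proj x w) : v = w := by
  have h1 : v - w ∈ LinearMap.ker (X.proj x) := by rw [LinearMap.mem_ker, map_sub, e, sub_self]
  exact sub_eq_zero.1 (Submodule.disjoint_def.1 (h.isCompl x).disjoint _ h1 (sub_mem hv hw))

lemma lift_add (a b : A.Sec) : h.lift (a + b) = h.lift a + h.lift b := by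
  ext x
  refine h.eq_of_proj (h.lift_mem _ x) (add_mem (h.lift_mem a x) (h.lift_mem b x)) ?_
  rw [ContMDiffSection.coe_add, Pi.add_apply, map_add, h.proj_lift, h.proj_lift, h.proj_lift]
  rfl

lemma lift_fsmul (g : C^∞⟮𝓘(ℝ, EB), B; ℝ⟯) (a : A.Sec) :
    h.lift (A.fsmul g a) = X.total.fsmul (g.comp p) (h.lift a) := by
  ext x
  refine h.eq_of_proj (h.lift_mem _ x) (Submodule.smul_mem _ (g (p x)) (h.lift_mem a x)) ?_
  rw [VBundle.fsmul_apply, map_smul, h.proj_lift, h.proj_lift]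
  rfl

lemma lift_neg (a : A.Sec) : h.lift (-a) = -h.lift a := by
  refine eq_neg_of_add_eq_zero_left ?_
  rw [← h.lift_add, neg_add_cancel]
  have := h.lift_add 0 0
  rw [add_zero] at this
  exact left_eq_add.1 this

/-- The anchor of a lift is p-related to the anchor below. This makes the Leibniz terms cancel in
the curvature. -/
lemma act_lift (a : A.Sec) (g : C^∞⟮𝓘(ℝ, EB), B; ℝ⟯) :
    X.total.act (h.lift a) (g.comp p) = (A.act a g).comp p := by
  ext x
  rw [LieAlgebroid.act_apply]
  refine (mvfderiv_comp_smooth p.contMDiff g x _).trans ?_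
  rw [X.proj_anchor, h.proj_lift]
  rfl

lemma proj_bracket_lift (a b : A.Sec) (x : E) :
    X.proj x (X.total.bracket (h.lift a) (h.lift b) x) = A.bracket a b (p x) :=
  X.proj_bracket (h.proj_lift a) (h.proj_lift b) x

lemma proj_bracket_inclSec (a : A.Sec) (κ : K.Sec) (x : E) :
    X.proj x (X.total.bracket (h.lift a) (X.inclSec κ) x) = 0 := by
  rw [X.proj_bracket (b := 0) (h.proj_lift a) (fun y => X.proj_incl y (κ y)), map_zero]
  rfl

end Extension.Connection

/-- Sections of the kernel have anchors tangent to the fibres of `p`, so functions from the base are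
constants for them. For this reason D is linear over functions on the base. -/
lemma Extension.act_inclSec_comp (X : Extension p K A) (κ : K.Sec) (g : C^∞⟮𝓘(ℝ, EB), B; ℝ⟯) :
    X.total.act (X.inclSec κ) (g.comp p) = 0 := by
  ext x
  rw [LieAlgebroid.act_apply]
  refine (mvfderiv_comp_smooth p.contMDiff g x _).trans ?_
  rw [X.proj_anchor, X.inclSec_apply, X.proj_incl, map_zero, map_zero]
  rfl

/-- The couple of a connection in terms of sections. -/
lemma isCoupleOf_iff {X : Extension p K A} {h : X.Connection} {c : Couple p K A} :
    IsCoupleOf X h c ↔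
      (∀ α κ, X.inclSec ((c.D α).op κ) = X.total.bracket (h.lift α) (X.inclSec κ)) ∧
      (∀ α, (c.D α).symbol = X.total.anchorSec (h.lift α)) ∧
      ∀ α β, X.inclSec (c.form.toFun ![α, β]) =
        X.total.bracket (h.lift α) (h.lift β) - h.lift (A.bracket α β) := by
  constructor
  · intro H
    refine ⟨fun α κ => ?_, fun α => ?_, fun α β => ?_⟩
    · ext x; exact H.op α κ (X.inclSec κ) (fun _ => rfl) x
    · ext x; exact H.symbol α x
    · ext x; exact H.form α β x
  · rintro ⟨h1, h2, h3⟩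
    refine ⟨fun α κ κ' hκ x => ?_, fun α x => ?_, fun α β x => ?_⟩
    · obtain rfl : κ' = X.inclSec κ := DFunLike.ext _ _ hκ
      exact DFunLike.congr_fun (h1 α κ) x
    · rw [h2]; rfl
    · exact DFunLike.congr_fun (h3 α β) x

namespace Extension.Connection

variable {X : Extension p K A} (h : X.Connection)

/-- The covariant derivative along a horizontal lift, on sections. -/
def derOp (α : A.Sec) (κ : K.Sec) : K.Sec := X.lower _ (h.proj_bracket_inclSec α κ)

lemma inclSec_derOp (α : A.Sec) (κ : K.Sec) :
    X.inclSec (h.derOp α κ) = X.total.bracket (h.lift α) (X.inclSec κ) := X.inclSec_lower _ _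

/-- The covariant derivative along a horizontal lift. -/
def der (α : A.Sec) : K.Der where
  op :=
    { toFun := h.derOp α
      map_add' := fun κ κ' => X.inclSec_injective (by
        rw [map_add, inclSec_derOp, inclSec_derOp, inclSec_derOp, map_add, map_add])
      map_smul' := fun r κ => X.inclSec_injective (by
        rw [map_smul, inclSec_derOp, inclSec_derOp, map_smul, map_smul]; rfl) }
  symbol := X.total.anchorSec (h.lift α)
  map_fsmul f κ x := by
    refine X.incl_injective x ?_
    have e := h.inclSec_derOp α (K.fsmul f κ)
    rw [X.inclSec_fsmul, X.total.bracket_fsmul_right, ← h.inclSec_derOp, ← X.inclSec_fsmul,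
      ← X.inclSec_fsmul, ← map_add] at e
    exact DFunLike.congr_fun e x
  map_bracket κ κ' := X.inclSec_injective (by
    show X.inclSec (h.derOp α _) = X.inclSec (K.bracket (h.derOp α κ) κ' + K.bracket κ (h.derOp α κ'))
    rw [inclSec_derOp, X.inclSec_bracket, X.total.bracket_leibniz, map_add, X.inclSec_bracket,
      X.inclSec_bracket, inclSec_derOp, inclSec_derOp])
  anchor_op κ x := by
    show K.anchor x (h.derOp α κ x) = VField.lie (X.total.anchorSec (h.lift α)) (K.anchorSec κ) x
    rw [← X.anchorSec_inclSec, ← X.total.anchorSec_bracket, ← h.inclSec_derOp, X.anchorSec_inclSec]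
    rfl

lemma inclSec_der (α : A.Sec) (κ : K.Sec) :
    X.inclSec ((h.der α).op κ) = X.total.bracket (h.lift α) (X.inclSec κ) := h.inclSec_derOp α κ

lemma proj_curv (α β : A.Sec) (x : E) :
    X.proj x ((X.total.bracket (h.lift α) (h.lift β) - h.lift (A.bracket α β)) x) = 0 := by
  rw [ContMDiffSection.coe_sub, Pi.sub_apply, map_sub, h.proj_bracket_lift, h.proj_lift, sub_self]

/-- The curvature of a connection. -/
def curv (α β : A.Sec) : K.Sec := X.lower _ (h.proj_curv α β)

lemma inclSec_curv (α β : A.Sec) : X.inclSec (h.curv α β) =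
    X.total.bracket (h.lift α) (h.lift β) - h.lift (A.bracket α β) := X.inclSec_lower _ _

lemma curv_skew (α β : A.Sec) : h.curv α β = -h.curv β α := X.inclSec_injective (by
  rw [map_neg, inclSec_curv, inclSec_curv, X.total.skew, A.skew α, h.lift_neg]
  abel)

/-- The couple of a connection. -/
def couple : Couple p K A where
  D := h.der
  D_add_op α β κ := X.inclSec_injective (by
    rw [map_add, inclSec_der, inclSec_der, inclSec_der, h.lift_add, map_add, LinearMap.add_apply])
  D_add_symbol α β x := by
    show X.total.anchor x (h.lift (α + β) x) = _
    rw [h.lift_add]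
    exact map_add (X.total.anchor x) _ _
  D_fsmul_op g α κ := X.inclSec_injective (by
    rw [inclSec_der, X.inclSec_fsmul, inclSec_der, h.lift_fsmul, X.total.bracket_fsmul_left,
      X.act_inclSec_comp]
    simp only [← VBundle.smul_eq_fsmul, zero_smul, sub_zero])
  D_fsmul_symbol g α x := by
    show X.total.anchor x (h.lift (A.fsmul g α) x) = _
    rw [h.lift_fsmul]
    exact map_smul (X.total.anchor x) _ _
  symbol_projects α x := by
    refine (X.proj_anchor x (h.lift α x)).trans ?_
    rw [h.proj_lift]
  form := KForm.ofBilinear h.curv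
    (fun a b c => X.inclSec_injective (by
      rw [map_add, inclSec_curv, inclSec_curv, inclSec_curv, h.lift_add, map_add, map_add,
        LinearMap.add_apply, LinearMap.add_apply, h.lift_add]
      abel))
    -- The derivative of `g` appears both in the bracket of the lifts and in the lift of the
    -- bracket; by `act_lift` the two terms cancel.
    (fun g a b => X.inclSec_injective (by
      rw [X.inclSec_fsmul, inclSec_curv, inclSec_curv, h.lift_fsmul, X.total.bracket_fsmul_left,
        A.bracket_fsmul_left, sub_eq_add_neg (A.fsmul _ _), h.lift_add, h.lift_neg, h.lift_fsmul,
        h.lift_fsmul, h.act_lift]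
      simp only [← VBundle.smul_eq_fsmul, smul_sub]
      abel))
    h.curv_skew

lemma isCoupleOf_couple : IsCoupleOf X h h.couple :=
  isCoupleOf_iff.2 ⟨h.inclSec_der, fun _ => rfl, h.inclSec_curv⟩

end Extension.Connection

lemma IsCoupleOf.unique {X : Extension p K A} {h : X.Connection} {c c' : Couple p K A}
    (H : IsCoupleOf X h c) (H' : IsCoupleOf X h c') : c = c' := by
  obtain ⟨h1, h2, h3⟩ := isCoupleOf_iff.1 H
  obtain ⟨h1', h2', h3'⟩ := isCoupleOf_iff.1 H'
  refine Couple.ext' (fun α κ => X.inclSec_injective ?_) (fun α x => ?_)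
    fun α β => X.inclSec_injective ?_
  · rw [h1, h1']
  · rw [h2, h2']
  · rw [h3, h3']

/-- Closedness is the Jacobi identity for three lifts, a Bianchi identity. The curvature equation on
operators is Jacobi for two lifts and a section of `K`, and on symbols it says that the anchor
respects brackets. -/
lemma IsCoupleOf.isAdmissible {X : Extension p K A} {h : X.Connection} {c : Couple p K A}
    (H : IsCoupleOf X h c) : c.IsAdmissible := by
  obtain ⟨h1, h2, h3⟩ := isCoupleOf_iff.1 H
  refine ⟨fun α => ?_, fun α β κ => X.inclSec_injective ?_, fun α β x => ?_⟩
  · rw [← vec_three_eta α, Couple.covD_two]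
    refine X.inclSec_injective ?_
    generalize α 0 = a, α 1 = b, α 2 = d
    simp only [map_add, map_sub, map_zero, h1, h3]
    -- The lifts of iterated brackets cancel by Jacobi in `A`, transported by the linear map
    -- `h.lift`.
    have j0 : A.bracket (A.bracket a b) d =
        A.bracket (A.bracket a d) b + -A.bracket (A.bracket b d) a := by
      rw [A.skew (A.bracket a d) b, A.skew (A.bracket b d) a, A.bracket_leibniz a b d]
      abel
    have j1 := congrArg h.lift j0
    rw [h.lift_add, h.lift_neg] at j1
    rw [X.total.skew (h.lift d) (X.total.bracket _ _), X.total.skew (h.lift d) (h.lift _),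
      X.total.skew (h.lift (A.bracket a d)) (h.lift b),
      X.total.skew (h.lift (A.bracket b d)) (h.lift a),
      X.total.bracket_leibniz (h.lift a) (h.lift b) (h.lift d)]
    linear_combination (norm := module) j1
  · simp only [map_sub, h1, X.inclSec_bracket, h3, LinearMap.sub_apply]
    rw [X.total.bracket_leibniz (h.lift α)]
    abel
  · have e : K.anchorSec (c.form.toFun ![α, β]) =
        VField.lie (c.D α).symbol (c.D β).symbol - (c.D (A.bracket α β)).symbol := by
      rw [← X.anchorSec_inclSec, h3, h2, h2, h2, ← X.total.anchorSec_bracket]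
      ext y
      exact map_sub (X.total.anchor y) _ _
    exact (DFunLike.congr_fun e x).symm

end Ext

end LieExt

namespace LieExt

universe u u'

/-! ### Connections under change and transport; extensions with equal couples -/

section Ext

variable {EE : Type u} [NormedAddCommGroup EE] [NormedSpace ℝ EE] [FiniteDimensional ℝ EE]
  {E : Type*} [TopologicalSpace E] [T2Space E] [ChartedSpace EE E] [IsManifold 𝓘(ℝ, EE) ∞ E]
  {EB : Type u'} [NormedAddCommGroup EB] [NormedSpace ℝ EB] [FiniteDimensional ℝ EB]
  {B : Type*} [TopologicalSpace B] [T2Space B] [ChartedSpace EB B] [IsManifold 𝓘(ℝ, EB) ∞ B]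
  {p : C^∞⟮𝓘(ℝ, EE), E; 𝓘(ℝ, EB), B⟯}
  {K : LieAlgebroid.{v} EE E} {A : LieAlgebroid.{v} EB B}


/-! ### Change of connection -/

namespace IsCoupleOf

variable {X : Extension p K A} {h h' : X.Connection} {c c' : Couple p K A}

/-- Gauge transforms correspond to changes of the connection. -/
lemma iff_isGaugeTransform (H : IsCoupleOf X h c) {Δ : KForm p K A 1}
    (hΔ : ∀ α, h'.lift α = h.lift α + X.inclSec (Δ.toFun ![α])) :
    IsCoupleOf X h' c' ↔ IsGaugeTransform Δ c c' := by
  obtain ⟨h1, h2, h3⟩ := isCoupleOf_iff.1 H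
  have e1 : ∀ α κ, X.total.bracket (h'.lift α) (X.inclSec κ) =
      X.inclSec ((c.D α).op κ + K.bracket (Δ.toFun ![α]) κ) := fun α κ => by
    rw [hΔ, map_add, map_add, LinearMap.add_apply, h1, X.inclSec_bracket]
  have e2 : ∀ α, X.total.anchorSec (h'.lift α) =
      (c.D α).symbol + K.anchorSec (Δ.toFun ![α]) := fun α => by
    rw [hΔ, X.total.anchorSec_add, h2, X.anchorSec_inclSec]
  -- In the curvature of h + Δ, the terms linear in Δ assemble to ∂Δ and the quadratic term is the
  -- bracket of its values.
  have e3 : ∀ α β, X.total.bracket (h'.lift α) (h'.lift β) - h'.lift (A.bracket α β) =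
      X.inclSec (c.form.toFun ![α, β] + c.covD Δ ![α, β] +
        K.bracket (Δ.toFun ![α]) (Δ.toFun ![β])) := fun α β => by
    rw [hΔ, hΔ, hΔ, Couple.covD_one]
    simp only [map_add, map_sub, LinearMap.add_apply, h1, h3, X.inclSec_bracket]
    rw [X.total.skew (h.lift β)]
    abel
  rw [isCoupleOf_iff]
  simp only [e1, e2, e3, X.inclSec_injective.eq_iff]
  exact ⟨fun ⟨a, b, d⟩ => ⟨a, fun α x => DFunLike.congr_fun (b α) x, d⟩,
    fun ⟨a, b, d⟩ => ⟨a, fun α => DFunLike.ext _ _ (b α), d⟩⟩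

/-- The difference of two lifts of the same section lies in the kernel, hence comes from `K`. -/
lemma exists_isGaugeTransform (H : IsCoupleOf X h c) (H' : IsCoupleOf X h' c') :
    ∃ Δ, IsGaugeTransform Δ c c' := by
  have h0 : ∀ α x, X.proj x ((h'.lift α - h.lift α) x) = 0 := fun α x => by
    rw [ContMDiffSection.coe_sub, Pi.sub_apply, map_sub, h.proj_lift, h'.proj_lift, sub_self]
  let d : A.Sec → K.Sec := fun α => X.lower _ (h0 α)
  have hd : ∀ α, X.inclSec (d α) = h'.lift α - h.lift α := fun α => X.inclSec_lower _ _
  refine ⟨KForm.ofLinear d (fun a b => X.inclSec_injective ?_) fun g a => X.inclSec_injective ?_,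
    (H.iff_isGaugeTransform fun α => ?_).1 H'⟩
  · rw [map_add, hd, hd, hd, h.lift_add, h'.lift_add]
    abel
  · rw [X.inclSec_fsmul, hd, hd, h.lift_fsmul, h'.lift_fsmul]
    exact (smul_sub (g.comp p) _ _).symm
  · exact (eq_add_of_sub_eq' (hd α).symm)

/-- Adding Δ to the lift gives another lift, so every couple gauge equivalent to `c` already occurs
on the same extension. -/
lemma exists_connection (H : IsCoupleOf X h c) {Δ : KForm p K A 1} (hΔ : IsGaugeTransform Δ c c') :
    ∃ h' : X.Connection, IsCoupleOf X h' c' := by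
  refine ⟨X.connectionOfLift (fun α => h.lift α + X.inclSec (Δ.toFun ![α])) (fun a b => ?_)
    (fun g a => ?_) fun a x => ?_, (H.iff_isGaugeTransform fun α => rfl).2 hΔ⟩
  · rw [h.lift_add, Δ.apply_add, map_add]
    abel
  · rw [h.lift_fsmul, Δ.apply_fsmul, X.inclSec_fsmul]
    exact (smul_add (g.comp p) _ _).symm
  · rw [ContMDiffSection.coe_add, Pi.add_apply, map_add, h.proj_lift, X.inclSec_apply, X.proj_incl,
      add_zero]

end IsCoupleOf

/-! ### Morphisms over the identity -/

namespace IsMorphism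

variable {L L' L'' : LieAlgebroid.{v} EE E} {Φ : ∀ x, L.V x →ₗ[ℝ] L'.V x}
  {Ψ : ∀ x, L'.V x →ₗ[ℝ] L''.V x}

lemma refl (L : LieAlgebroid.{v} EE E) : IsMorphism L L id (fun _ => LinearMap.id) where
  contMDiff := contMDiff_id
  d_pullback _ _ _ h := h

lemma comp_id (hΨ : IsMorphism L' L'' id Ψ) (hΦ : IsMorphism L L' id Φ) :
    IsMorphism L L'' id (fun x => Ψ x ∘ₗ Φ x) where
  contMDiff := hΨ.contMDiff.comp hΦ.contMDiff
  d_pullback k u w h := by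
    -- The middle step of the composition needs pullbacks along `Ψ` as forms, so that the condition
    -- on `Φ` applies to them.
    let pull : ∀ {k}, L''.AltForm k → L'.AltForm k := fun u =>
      { toFun := fun x => (u.toFun x).compLinearMap (Ψ x)
        smooth := fun α x => u.smooth_along (φ := id) (n₀ := x) contMDiffAt_id
          (t := fun i x => Ψ x (α i x)) fun i => hΨ.smooth_sec (α i) x }
    exact hΦ.d_pullback k (pull u) (pull w) (hΨ.d_pullback k u w h)

/-- The section map of a smooth bundle map over the identity. -/
def secMap (hΦ : ∀ (s : L.Sec) x, L'.SmoothAlongAt 𝓘(ℝ, EE) id (fun x => Φ x (s x)) x) :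
    L.Sec →ₗ[ℝ] L'.Sec where
  toFun s := ⟨fun x => Φ x (s x), fun x => hΦ s x⟩
  map_add' s t := by ext x; exact map_add (Φ x) (s x) (t x)
  map_smul' c s := by ext x; exact map_smul (Φ x) c (s x)

/-- A bundle map over the identity which is compatible with the anchors is a morphism as soon as it
preserves the brackets of sufficiently many sections. -/
theorem of_generators
    (hΦ : ∀ (s : L.Sec) x, L'.SmoothAlongAt 𝓘(ℝ, EE) id (fun x => Φ x (s x)) x)
    (hanchor : ∀ x v, L'.anchor x (Φ x v) = L.anchor x v) (G : Set L.Sec)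
    (hG : ∀ x v, ∃ s ∈ G, s x = v)
    (hbr : ∀ s ∈ G, ∀ t ∈ G, secMap hΦ (L.bracket s t) = L'.bracket (secMap hΦ s) (secMap hΦ t)) :
    IsMorphism L L' id Φ := by
  have hact : ∀ s f, L'.act (secMap hΦ s) f = L.act s f := fun s f => by
    ext x
    rw [LieAlgebroid.act_apply, LieAlgebroid.act_apply]
    exact congrArg _ (hanchor x (s x))
  have hsmul : ∀ f s, secMap hΦ (L.fsmul f s) = L'.fsmul f (secMap hΦ s) := fun f s => by
    ext x; exact map_smul (Φ x) (f x) (s x)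
  -- The failure to preserve brackets is skew, and linear over functions because the anchors agree.
  -- It thus depends only on the values at a point and vanishes once it vanishes on generators.
  let T : L.Sec → L.Sec → L'.Sec := fun s t =>
    secMap hΦ (L.bracket s t) - L'.bracket (secMap hΦ s) (secMap hΦ t)
  have T_skew : ∀ s t, T s t = -T t s := fun s t => by
    simp only [T]
    rw [L.skew, L'.skew, map_neg]
    abel
  have T_add : ∀ s t t', T s (t + t') = T s t + T s t' := fun s t t' => by
    simp only [T, map_add]
    abel
  have T_fsmul : ∀ s f t, T s (L.fsmul f t) = L'.fsmul f (T s t) := fun s f t => by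
    simp only [T, hsmul, L.bracket_fsmul_right, L'.bracket_fsmul_right, map_add, hact]
    simp only [← VBundle.smul_eq_fsmul, smul_sub]
    abel
  have tens : ∀ s x {t t' : L.Sec}, t x = t' x → T s t x = T s t' x := fun s x t t' h =>
    VBundle.tensorial (fun t => T s t x) (fun a b => by rw [T_add]; rfl)
      (fun f a => by rw [T_fsmul]; rfl) h
  have T_zero : ∀ s t x, T s t x = 0 := by
    intro s t x
    obtain ⟨t', ht', et⟩ := hG x (t x)
    obtain ⟨s', hs', es⟩ := hG x (s x)
    rw [tens s x et.symm, T_skew, ContMDiffSection.coe_neg, Pi.neg_apply, tens t' x es.symm]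
    have : T t' s' = 0 := sub_eq_zero.2 (hbr t' ht' s' hs')
    rw [this]
    exact neg_zero
  have hbr' : ∀ s t, secMap hΦ (L.bracket s t) = L'.bracket (secMap hΦ s) (secMap hΦ t) :=
    fun s t => sub_eq_zero.1 (by ext x; exact T_zero s t x)
  refine of_related contMDiff_id hΦ (fun x v => ?_)
    (fun x v => ⟨L.extend x v, secMap hΦ (L.extend x v), L.extend_self x v, fun _ => rfl⟩)
    fun s t a b hs ht y => ?_
  · rw [mfderiv_id]
    exact (hanchor x v).symm
  · obtain rfl : a = secMap hΦ s := DFunLike.ext _ _ fun y => (hs y).symm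
    obtain rfl : b = secMap hΦ t := DFunLike.ext _ _ fun y => (ht y).symm
    exact DFunLike.congr_fun (hbr' s t) y

end IsMorphism

/-! ### Equivalence of extensions -/

namespace Extension

theorem equivalent_equivalence : Equivalence (Extension.Equivalent (p := p) (K := K) (A := A)) where
  refl X := ⟨fun x => LinearEquiv.refl ℝ _, IsMorphism.refl _, IsMorphism.refl _, fun _ _ => rfl,
    fun _ _ => rfl⟩
  symm := fun ⟨Φ, h1, h2, h3, h4⟩ => ⟨fun x => (Φ x).symm, h2, h1,
    fun x k => by rw [← h3, LinearEquiv.symm_apply_apply],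
    fun x a => by rw [← h4, LinearEquiv.apply_symm_apply]⟩
  trans := fun ⟨Φ, h1, h2, h3, h4⟩ ⟨Ψ, k1, k2, k3, k4⟩ => ⟨fun x => (Φ x).trans (Ψ x),
    k1.comp_id h1, h2.comp_id k2, fun x k => by rw [LinearEquiv.trans_apply, h3, k3],
    fun x a => by rw [LinearEquiv.trans_apply, k4, h4]⟩

/-- Equivalent extensions have the same couples. -/
lemma Equivalent.exists_connection {X Y : Extension p K A} (e : X.Equivalent Y) {h : X.Connection}
    {c : Couple p K A} (H : IsCoupleOf X h c) : ∃ h' : Y.Connection, IsCoupleOf Y h' c := by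
  obtain ⟨Φ, hΦ, -, hincl, hproj⟩ := e
  obtain ⟨h1, h2, h3⟩ := isCoupleOf_iff.1 H
  let S : X.total.Sec →ₗ[ℝ] Y.total.Sec := IsMorphism.secMap hΦ.smooth_sec
  have hS : ∀ s t, S (X.total.bracket s t) = Y.total.bracket (S s) (S t) := fun s t => by
    ext x; exact hΦ.bracket contMDiff_id (a := S s) (b := S t) (fun _ => rfl) (fun _ => rfl) x
  have hS' : ∀ κ, S (X.inclSec κ) = Y.inclSec κ := fun κ => by ext x; exact hincl x (κ x)
  refine ⟨Y.connectionOfLift (fun α => S (h.lift α)) (fun a b => by rw [h.lift_add, map_add])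
    (fun g a => by rw [h.lift_fsmul]; ext x; exact map_smul (Φ x) _ _)
    (fun a x => (hproj x _).trans (h.proj_lift a x)), isCoupleOf_iff.2 ⟨fun α κ => ?_, fun α => ?_,
    fun α β => ?_⟩⟩
  · show _ = Y.total.bracket (S (h.lift α)) _
    rw [← hS', ← hS', h1, hS]
  · rw [h2]
    ext x
    have := hΦ.anchor contMDiff_id x (h.lift α x)
    rw [mfderiv_id] at this
    exact this
  · show _ = Y.total.bracket (S (h.lift α)) (S (h.lift β)) - S (h.lift _)
    rw [← hS', h3, map_sub, hS]

namespace Connection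

variable {X Y : Extension p K A} (h : X.Connection) (h' : Y.Connection)

/-- The splitting of the projection defined by a connection. -/
def hor (x : E) : A.V (p x) →ₗ[ℝ] X.total.V x := X.splitting h.lift h.lift_add h.lift_fsmul x

lemma hor_apply (x : E) (a : A.Sec) : h.hor x (a (p x)) = h.lift a x :=
  X.splitting_apply h.lift h.lift_add h.lift_fsmul x a

lemma proj_hor (x : E) (v : A.V (p x)) : X.proj x (h.hor x v) = v := by
  rw [← A.extend_self (p x) v, hor_apply, h.proj_lift]

lemma smooth_hor {t : ∀ x, A.V (p x)} {x : E} (ht : A.SmoothAlongAt 𝓘(ℝ, EE) p t x) :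
    X.total.SmoothAlongAt 𝓘(ℝ, EE) id (fun x => h.hor x (t x)) x :=
  (A.frame (p x)).smooth_map (ψ := id) h.hor contMDiffAt_id
    (fun i => by simp only [hor_apply]; exact (h.lift _).contMDiff x) ht

/-- The decomposition of the fibres defined by a connection. -/
def decomp (x : E) : (A.V (p x) × K.V x) ≃ₗ[ℝ] X.total.V x :=
  LinearEquiv.ofBijective ((h.hor x).coprod (X.incl x)) (by
    constructor
    · rw [injective_iff_map_eq_zero]
      rintro ⟨v, k⟩ e
      rw [LinearMap.coprod_apply] at e
      have hv : v = 0 := by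
        have := congrArg (X.proj x) e
        rwa [map_add, h.proj_hor, X.proj_incl, add_zero, map_zero] at this
      subst hv
      rw [map_zero, zero_add] at e
      have hk : k = 0 := X.incl_injective x (e.trans (map_zero (X.incl x)).symm)
      rw [hk, Prod.mk_zero_zero]
    · intro a
      have : a - h.hor x (X.proj x a) ∈ LinearMap.range (X.incl x) := by
        rw [X.exact, LinearMap.mem_ker, map_sub, h.proj_hor, sub_self]
      obtain ⟨k, hk⟩ := this
      exact ⟨(X.proj x a, k), by rw [LinearMap.coprod_apply, hk]; abel⟩)

lemma decomp_apply (x : E) (v : A.V (p x)) (k : K.V x) :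
    h.decomp x (v, k) = h.hor x v + X.incl x k := rfl

lemma decomp_symm_fst (x : E) (a : X.total.V x) : ((h.decomp x).symm a).1 = X.proj x a := by
  obtain ⟨⟨v, k⟩, rfl⟩ := (h.decomp x).surjective a
  rw [LinearEquiv.symm_apply_apply, decomp_apply, map_add, h.proj_hor, X.proj_incl, add_zero]

/-- The vertical part of a section. -/
lemma smooth_vert (s : X.total.Sec) (x : E) :
    K.SmoothAlongAt 𝓘(ℝ, EE) id (fun x => ((h.decomp x).symm (s x)).2) x := by
  refine VBundle.smooth_of_injective X.incl X.incl_injective X.incl_morphism.smooth_sec ?_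
  -- The vertical part, included in the total algebroid, is the section minus the horizontal lift of
  -- its projection; smoothness then descends through the injective inclusion.
  have h1 : X.total.SmoothAlongAt 𝓘(ℝ, EE) id
      (fun x => s x + (-1 : ℝ) • h.hor x (X.proj x (s x))) x :=
    VBundle.SmoothAlongAt.add (s.contMDiff x) (VBundle.SmoothAlongAt.smul contMDiffAt_const
      (h.smooth_hor (X.proj_morphism.smooth_sec s x)))
  refine h1.congr (Filter.Eventually.of_forall fun y => ?_)
  have e : s y = h.hor y ((h.decomp y).symm (s y)).1 + X.incl y ((h.decomp y).symm (s y)).2 :=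
    ((h.decomp y).apply_symm_apply (s y)).symm
  rw [decomp_symm_fst] at e
  conv_rhs => enter [1]; rw [e]
  module

/-- The bundle isomorphism matching two connections. -/
def identify (x : E) : X.total.V x ≃ₗ[ℝ] Y.total.V x := (h.decomp x).symm.trans (h'.decomp x)

lemma identify_hor (x : E) (v : A.V (p x)) : h.identify h' x (h.hor x v) = h'.hor x v := by
  have : h.hor x v = h.decomp x (v, 0) := by rw [decomp_apply, map_zero, add_zero]
  rw [identify, LinearEquiv.trans_apply, this, LinearEquiv.symm_apply_apply, decomp_apply, map_zero,
    add_zero]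

lemma identify_incl (x : E) (k : K.V x) : h.identify h' x (X.incl x k) = Y.incl x k := by
  have : X.incl x k = h.decomp x (0, k) := by rw [decomp_apply, map_zero, zero_add]
  rw [identify, LinearEquiv.trans_apply, this, LinearEquiv.symm_apply_apply, decomp_apply, map_zero,
    zero_add]

lemma smooth_identify (s : X.total.Sec) (x : E) :
    Y.total.SmoothAlongAt 𝓘(ℝ, EE) id (fun x => h.identify h' x (s x)) x := by
  have h1 := (h'.smooth_hor (X.proj_morphism.smooth_sec s x)).add
    (Y.incl_morphism.smooth_sec ⟨_, h.smooth_vert s⟩ x)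
  refine h1.congr (Filter.Eventually.of_forall fun y => ?_)
  show h'.decomp y ((h.decomp y).symm (s y)) = _
  rw [← h.decomp_symm_fst]
  rfl

/-- On sections h(α)+κ, anchors and brackets are expressed by the couple and by the structures of
`A` and `K`. The identification matches lifts with lifts and `K` with `K`, so it respects them. -/
lemma identify_morphism {c : Couple p K A} (H : IsCoupleOf X h c) (H' : IsCoupleOf Y h' c) :
    IsMorphism X.total Y.total id (fun x => (h.identify h' x).toLinearMap) := by
  obtain ⟨h1, h2, h3⟩ := isCoupleOf_iff.1 H
  obtain ⟨h1', h2', h3'⟩ := isCoupleOf_iff.1 H'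
  let S : X.total.Sec →ₗ[ℝ] Y.total.Sec :=
    IsMorphism.secMap (Φ := fun x => (h.identify h' x).toLinearMap) (h.smooth_identify h')
  have S1 : ∀ a, S (h.lift a) = h'.lift a := fun a => by
    ext x
    rw [← hor_apply, ← h.identify_hor, hor_apply]
    rfl
  have S2 : ∀ κ, S (X.inclSec κ) = Y.inclSec κ := fun κ => by
    ext x; exact h.identify_incl h' x (κ x)
  refine IsMorphism.of_generators (h.smooth_identify h') (fun x v => ?_)
    {s | ∃ α κ, s = h.lift α + X.inclSec κ} (fun x v => ?_) ?_
  · obtain ⟨⟨v, k⟩, rfl⟩ := (h.decomp x).surjective v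
    rw [decomp_apply, ← A.extend_self (p x) v, LinearEquiv.coe_coe, map_add, identify_hor, identify_incl,
      map_add, map_add, hor_apply, hor_apply, X.incl_anchor, Y.incl_anchor]
    have := DFunLike.congr_fun ((h2 (A.extend (p x) v)).symm.trans (h2' (A.extend (p x) v))) x
    exact congrArg (· + _) this.symm
  · obtain ⟨⟨v, k⟩, rfl⟩ := (h.decomp x).surjective v
    refine ⟨_, ⟨A.extend (p x) v, K.extend x k, rfl⟩, ?_⟩
    rw [ContMDiffSection.coe_add, Pi.add_apply, ← hor_apply, X.inclSec_apply, A.extend_self,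
      K.extend_self]
    rfl
  · rintro _ ⟨α, κ, rfl⟩ _ ⟨β, lam, rfl⟩
    show S _ = Y.total.bracket (S _) (S _)
    have e : X.total.bracket (h.lift α) (h.lift β) =
        X.inclSec (c.form.toFun ![α, β]) + h.lift (A.bracket α β) := by rw [h3]; abel
    have e' : Y.total.bracket (h'.lift α) (h'.lift β) =
        Y.inclSec (c.form.toFun ![α, β]) + h'.lift (A.bracket α β) := by rw [h3']; abel
    simp only [map_add, LinearMap.add_apply, S1, S2, e, e']
    rw [X.total.skew (X.inclSec κ) (h.lift β), Y.total.skew (Y.inclSec κ) (h'.lift β)]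
    simp only [← h1, ← h1', ← X.inclSec_bracket, ← Y.inclSec_bracket, map_neg, S2]

end Connection

/-- Extensions with the same couple are equivalent. -/
theorem equivalent_of_isCoupleOf {X Y : Extension p K A} {h : X.Connection} {h' : Y.Connection}
    {c : Couple p K A} (H : IsCoupleOf X h c) (H' : IsCoupleOf Y h' c) : X.Equivalent Y :=
  ⟨h.identify h', h.identify_morphism h' H H', h'.identify_morphism h H' H, h.identify_incl h', fun x a => by
    rw [← h'.decomp_symm_fst, ← h.decomp_symm_fst, Connection.identify, LinearEquiv.trans_apply,
      LinearEquiv.symm_apply_apply]⟩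

end Extension

end Ext

end LieExt

namespace LieExt

universe u u'

/-! ### Lie algebroids from axioms on generators -/

section Generators

variable {EM : Type u} [NormedAddCommGroup EM] [NormedSpace ℝ EM] [FiniteDimensional ℝ EM]
  {M : Type*} [TopologicalSpace M] [T2Space M] [ChartedSpace EM M] [IsManifold 𝓘(ℝ, EM) ∞ M]

/-- A bilinear bracket from an additive skew operation with the Leibniz rule. -/
def bracketOfLeibniz (V : VBundle.{v} EM M) (ρ : V.Sec → VField EM M) (b : V.Sec → V.Sec → V.Sec)
    (hadd : ∀ s t r, b s (t + r) = b s t + b s r)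
    (leib : ∀ f s t, b s (V.fsmul f t) = V.fsmul f (b s t) + V.fsmul (VField.der (ρ s) f) t)
    (skew : ∀ s t, b s t = -b t s) : V.Sec →ₗ[ℝ] V.Sec →ₗ[ℝ] V.Sec :=
  -- Real homogeneity is the Leibniz rule for a constant function.
  have hsmul : ∀ (r : ℝ) s t, b s (r • t) = r • b s t := fun r s t => by
    have h := leib (ContMDiffMap.const r) s t
    have h0 : VField.der (ρ s) (ContMDiffMap.const r : C^∞⟮𝓘(ℝ, EM), M; ℝ⟯) = 0 := by
      ext x
      show mvfderiv 𝓘(ℝ, EM) (fun _ : M => r) x (ρ s x) = 0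
      rw [mvfderiv_const]
      rfl
    rw [h0, ← VBundle.smul_eq_fsmul _ 0, zero_smul, add_zero] at h
    exact h
  LinearMap.mk₂ ℝ b (fun s s' t => by rw [skew, hadd, skew s, skew s', neg_add])
    (fun r s t => by rw [skew, hsmul, skew s, smul_neg]) (fun s t t' => hadd s t t')
    (fun r s t => hsmul r s t)

/-- A Lie algebroid from a skew bracket with the Leibniz rule, which satisfies the remaining axioms
on sufficiently many sections. -/
def LieAlgebroid.ofGenerators (V : VBundle.{v} EM M)
    (anchor : ∀ x : M, V.V x →ₗ[ℝ] TangentSpace 𝓘(ℝ, EM) x) (ρ : V.Sec → VField EM M)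
    (hρ : ∀ s x, ρ s x = anchor x (s x)) (br : V.Sec →ₗ[ℝ] V.Sec →ₗ[ℝ] V.Sec)
    (leib : ∀ f s t, br s (V.fsmul f t) = V.fsmul f (br s t) + V.fsmul (VField.der (ρ s) f) t)
    (skew : ∀ s t, br s t = -br t s) (G : Set V.Sec) (hG : ∀ x v, ∃ s ∈ G, s x = v)
    (hanchor : ∀ s ∈ G, ∀ t ∈ G, ρ (br s t) = VField.lie (ρ s) (ρ t))
    (hjac : ∀ s ∈ G, ∀ t ∈ G, ∀ r ∈ G, br s (br t r) = br (br s t) r + br t (br s r)) :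
    LieAlgebroid.{v} EM M :=
  have ρ_add : ∀ s t, ρ (s + t) = ρ s + ρ t := fun s t => by
    ext x
    rw [hρ, ContMDiffSection.coe_add, Pi.add_apply, map_add, ← hρ, ← hρ]
    rfl
  have ρ_fsmul : ∀ f s, ρ (V.fsmul f s) = VField.fsmul f (ρ s) := fun f s => by
    ext x
    rw [hρ, VBundle.fsmul_apply, map_smul, ← hρ]
    rfl
  -- The anchor defect is skew and linear over functions, so vanishing on generators suffices. It is
  -- treated before the Jacobiator, whose linearity over functions requires the anchor to respect
  -- brackets.
  let N : V.Sec → V.Sec → VField EM M := fun s t => ρ (br s t) - VField.lie (ρ s) (ρ t)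
  have N_skew : ∀ s t x, N s t x = -N t s x := fun s t x => by
    have e : ρ (-br t s) = -ρ (br t s) := by
      ext x
      rw [hρ, ContMDiffSection.coe_neg, Pi.neg_apply, map_neg, ← hρ]
      rfl
    have : N s t = -N t s := by
      simp only [N]
      rw [skew s t, VField.lie_swap (ρ s), e]
      abel
    rw [this]; rfl
  have N_tens : ∀ s x {t t' : V.Sec}, t x = t' x → N s t x = N s t' x := fun s x t t' h => by
    refine VBundle.tensorial (W := TangentSpace 𝓘(ℝ, EM) x) (fun t => N s t x) (fun a b => ?_)
      (fun f a => ?_) h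
    · have : N s (a + b) = N s a + N s b := by
        simp only [N, map_add, ρ_add, VField.lie_add_right]
        abel
      rw [this]; rfl
    · have : N s (V.fsmul f a) = VField.fsmul f (N s a) := by
        simp only [N, leib, ρ_add, ρ_fsmul, VField.lie_fsmul_right]
        have e : ∀ X Y : VField EM M,
            VField.fsmul f (X - Y) = VField.fsmul f X - VField.fsmul f Y :=
          fun X Y => by ext x; exact smul_sub (f x) (X x) (Y x)
        rw [e]
        abel
      rw [this]; rfl
  have N_zero : ∀ s t, ρ (br s t) = VField.lie (ρ s) (ρ t) := fun s t => by
    refine sub_eq_zero.1 (ContMDiffSection.ext fun x => ?_)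
    obtain ⟨t', ht', et⟩ := hG x (t x)
    obtain ⟨s', hs', es⟩ := hG x (s x)
    refine (N_tens s x et.symm).trans ((N_skew s t' x).trans ?_)
    rw [N_tens t' x es.symm, show N t' s' = 0 from sub_eq_zero.2 (hanchor t' ht' s' hs')]
    exact neg_zero
  let J : V.Sec → V.Sec → V.Sec → V.Sec := fun s t r =>
    br s (br t r) - br (br s t) r - br t (br s r)
  have J_skew : ∀ s t r x, J s t r x = -J t s r x := fun s t r x => by
    have : J s t r = -J t s r := by
      simp only [J]
      rw [skew s t, map_neg, LinearMap.neg_apply]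
      abel
    rw [this]; rfl
  have J_skew' : ∀ s t r x, J s t r x = -J s r t x := fun s t r x => by
    have : J s t r = -J s r t := by
      simp only [J]
      rw [skew t r, skew t (br s r), skew r (br s t), map_neg]
      abel
    rw [this]; rfl
  have J_tens : ∀ s t x {r r' : V.Sec}, r x = r' x → J s t r x = J s t r' x :=
    fun s t x r r' h => by
    refine VBundle.tensorial (fun r => J s t r x) (fun a b => ?_) (fun f a => ?_) h
    · have : J s t (a + b) = J s t a + J s t b := by
        simp only [J, map_add]
        abel
      rw [this]; rfl
    · have : J s t (V.fsmul f a) = V.fsmul f (J s t a) := by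
        simp only [J, leib, map_add, N_zero, VField.der_lie]
        simp only [← VBundle.smul_eq_fsmul, smul_sub, sub_smul]
        abel
      rw [this]; rfl
  have J_zero : ∀ s t r, J s t r = 0 := fun s t r => by
    refine ContMDiffSection.ext fun x => ?_
    obtain ⟨r', hr', er⟩ := hG x (r x)
    obtain ⟨t', ht', et⟩ := hG x (t x)
    obtain ⟨s', hs', es⟩ := hG x (s x)
    -- Linearity over functions is available in the last slot only; skew-symmetry brings each
    -- argument there in turn, hence the reversed order.
    have h1 : J r' t' s' = 0 := sub_eq_zero.2 (by
      rw [hjac r' hr' t' ht' s' hs']; abel)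
    rw [J_tens s t x er.symm, J_skew', J_tens s r' x et.symm, J_skew, J_skew', J_tens _ _ x es.symm,
      h1]
    simp
  { V with
    anchor := anchor
    contMDiff_anchor := VBundle.contMDiff_of_sections (A' := tangentVBundle EM M) (ψ := id) anchor
      contMDiff_id fun s x => by
        have := (ρ s).contMDiff x
        simp only [hρ] at this
        exact this
    bracket := br
    leibniz := fun f s t x => by
      rw [leib, ← hρ]; rfl
    skew := skew
    anchor_bracket := fun s t x => by
      rw [← hρ, N_zero, VField.lie_apply]
      simp only [← hρ]
    jacobi := fun s t r => by
      have h := J_zero s t r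
      simp only [J] at h
      rw [skew (br t r) s, skew (br r s) t, skew r s, map_neg]
      linear_combination (norm := module) -h }

end Generators

/-! ### Vectors as functionals on 1-forms -/

section Dual

variable {EM : Type u} [NormedAddCommGroup EM] [NormedSpace ℝ EM] [FiniteDimensional ℝ EM]
  {M : Type*} [TopologicalSpace M] [T2Space M] [ChartedSpace EM M] [IsManifold 𝓘(ℝ, EM) ∞ M]

namespace VBundle.Form1

variable {A : VBundle.{v} EM M}

@[ext] lemma ext {u w : A.Form1} (h : u.toFun = w.toFun) : u = w := by
  cases u; cases w; congr

instance : Zero A.Form1 := ⟨⟨fun _ => 0, fun _ => contMDiff_const⟩⟩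
instance : Add A.Form1 := ⟨fun u w => ⟨fun x => u.toFun x + w.toFun x,
  fun s => (u.smooth s).add (w.smooth s)⟩⟩
instance : SMul ℕ A.Form1 := ⟨fun n u => ⟨fun x => n • u.toFun x, fun s => by
  simp only [LinearMap.smul_apply, nsmul_eq_mul]
  exact contMDiff_const.mul (u.smooth s)⟩⟩
instance : AddCommMonoid A.Form1 :=
  Function.Injective.addCommMonoid toFun (fun _ _ => ext) rfl (fun _ _ => rfl) (fun _ _ => rfl)

/-- The product of a function and a `1`-form. -/
def fsmul (f : C^∞⟮𝓘(ℝ, EM), M; ℝ⟯) (u : A.Form1) : A.Form1 :=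
  ⟨fun x => f x • u.toFun x, fun s => f.contMDiff.mul (u.smooth s)⟩

lemma add_toFun (u w : A.Form1) (x : M) : (u + w).toFun x = u.toFun x + w.toFun x := rfl

lemma sum_toFun {ι : Type*} (t : Finset ι) (u : ι → A.Form1) (x : M) :
    (∑ i ∈ t, u i).toFun x = ∑ i ∈ t, (u i).toFun x := by
  induction t using Finset.cons_induction with
  | empty => rfl
  | cons a t ha ih => rw [Finset.sum_cons, Finset.sum_cons, add_toFun, ih]

end VBundle.Form1

/-- A functional on `1`-forms which is linear over functions is the evaluation on a vector. -/
lemma VBundle.exists_dual {A : VBundle.{v} EM M} {y : M} (R : A.Form1 → ℝ)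
    (hadd : ∀ u w, R (u + w) = R u + R w) (hsmul : ∀ f u, R (u.fsmul f) = f y * R u) :
    ∃ v : A.V y, ∀ u : A.Form1, u.toFun y v = R u := by
  let fr := A.frame y
  let R' : A.Form1 →+ ℝ := AddMonoidHom.mk' R hadd
  -- The value of `R` on the i-th coordinate form must be the i-th coordinate of the vector; the
  -- expansion of cut·u in coordinate forms shows that this choice works for every `u`.
  refine ⟨∑ i, R (fr.form i) • fr.sec i y, fun u => ?_⟩
  have h1 : u.fsmul fr.cut = ∑ i, (fr.form i).fsmul (u.ev (fr.sec i)) := by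
    ext x v
    rw [Form1.sum_toFun, LinearMap.sum_apply]
    show fr.cut x • u.toFun x v = ∑ i, u.toFun x (fr.sec i x) • fr.coord i x v
    rw [← map_smul, ← fr.sum_coord, map_sum]
    exact Finset.sum_congr rfl fun i _ => by rw [map_smul, smul_eq_mul, smul_eq_mul, mul_comm]
  have h2 : R (u.fsmul fr.cut) = R u := by rw [hsmul, fr.cut_self, one_mul]
  rw [← h2, h1, map_sum]
  refine Eq.trans ?_ (map_sum R' _ _).symm
  refine Finset.sum_congr rfl fun i _ => ?_
  show _ = R ((fr.form i).fsmul _)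
  rw [map_smul, hsmul, smul_eq_mul, mul_comm]
  rfl

namespace LieAlgebroid

variable (A : LieAlgebroid.{v} EM M)

lemma dEv_add_form (u w : A.Form1) (a b : A.Sec) :
    A.dEv (u + w) a b = A.dEv u a b + A.dEv w a b := by
  have e : ∀ c, (u + w).ev c = u.ev c + w.ev c := fun c => rfl
  simp only [dEv, e, A.act_add]
  ring

/-- This is d(fu) = f du + df ∧ u. The wedge term later offsets the Leibniz terms in the dual
definition of the horizontal bracket. -/
lemma dEv_fsmul_form (f : C^∞⟮𝓘(ℝ, EM), M; ℝ⟯) (u : A.Form1) (a b : A.Sec) :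
    A.dEv (u.fsmul f) a b = f * A.dEv u a b + A.act a f * u.ev b - A.act b f * u.ev a := by
  have e : ∀ c, (u.fsmul f).ev c = f * u.ev c := fun c => rfl
  simp only [dEv, e, A.act_mul]
  ring

end LieAlgebroid

end Dual

/-! ### The bundle underlying the extension of a couple -/

section Model

variable {EE : Type u} [NormedAddCommGroup EE] [NormedSpace ℝ EE] [FiniteDimensional ℝ EE]
  {E : Type*} [TopologicalSpace E] [T2Space E] [ChartedSpace EE E] [IsManifold 𝓘(ℝ, EE) ∞ E]
  {EB : Type u'} [NormedAddCommGroup EB] [NormedSpace ℝ EB] [FiniteDimensional ℝ EB]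
  {B : Type*} [TopologicalSpace B] [T2Space B] [ChartedSpace EB B] [IsManifold 𝓘(ℝ, EB) ∞ B]
  (p : C^∞⟮𝓘(ℝ, EE), E; 𝓘(ℝ, EB), B⟯) (K : VBundle.{v} EE E) (A : VBundle.{v} EB B)

/-- The direct sum of a pullback bundle and a bundle. -/
def VBundle.pullbackSum : VBundle.{v} EE E where
  F := A.F × K.F
  V := (p *ᵖ A.V) ×ᵇ K.V
  addV x := inferInstanceAs (AddCommGroup (A.V (p x) × K.V x))
  modV x := inferInstanceAs (Module ℝ (A.V (p x) × K.V x))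
  fiberBundle := inferInstanceAs (FiberBundle (A.F × K.F) ((p *ᵖ A.V) ×ᵇ K.V))
  vectorBundle := inferInstanceAs (VectorBundle ℝ (A.F × K.F) ((p *ᵖ A.V) ×ᵇ K.V))
  smoothBundle := inferInstanceAs
    (ContMDiffVectorBundle ∞ (A.F × K.F) ((p *ᵖ A.V) ×ᵇ K.V) 𝓘(ℝ, EE))

/-- The trivialization of the sum is the pair of the two trivializations, so smoothness splits; the
first component is smooth along `p`, not over the identity. -/
lemma VBundle.pullbackSum_smooth_iff (s : ∀ x, A.V (p x)) (t : ∀ x, K.V x) (x : E) :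
    (VBundle.pullbackSum p K A).SmoothAlongAt 𝓘(ℝ, EE) id (fun x => (s x, t x)) x ↔
      A.SmoothAlongAt 𝓘(ℝ, EE) p s x ∧ K.SmoothAlongAt 𝓘(ℝ, EE) id t x := by
  rw [SmoothAlongAt.iff_coord (A := A), SmoothAlongAt.iff_coord (A := K)]
  refine (SmoothAlongAt.iff_coord (A := pullbackSum p K A)).trans ?_
  have h1 : ContMDiffAt 𝓘(ℝ, EE) 𝓘(ℝ, EE) ∞ (id : E → E) x := contMDiffAt_id
  have h2 : ContMDiffAt 𝓘(ℝ, EE) 𝓘(ℝ, EB) ∞ p x := p.contMDiff x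
  simp only [h1, h2, true_and]
  have h3 : ∀ (f : E → A.F) (g : E → K.F), ContMDiffAt 𝓘(ℝ, EE) 𝓘(ℝ, A.F × K.F) ∞
      (fun n => (f n, g n)) x ↔ ContMDiffAt 𝓘(ℝ, EE) 𝓘(ℝ, A.F) ∞ f x ∧
        ContMDiffAt 𝓘(ℝ, EE) 𝓘(ℝ, K.F) ∞ g x := fun f g =>
    contMDiffAt_prod_module_iff _
  exact h3 (fun n => (trivializationAt A.F A.V (p x) ⟨p n, s n⟩).2)
    (fun n => (trivializationAt K.F K.V x ⟨n, t n⟩).2)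

namespace VBundle.pullbackSum

variable {p K A}

/-- The section of the direct sum with given components. -/
def ofParts (s : ∀ x, A.V (p x)) (hs : ∀ x, A.SmoothAlongAt 𝓘(ℝ, EE) p s x) (t : K.Sec) :
    (VBundle.pullbackSum p K A).Sec :=
  VBundle.mkSec _ (fun x => (s x, t x)) fun x =>
    (VBundle.pullbackSum_smooth_iff p K A s t x).2 ⟨hs x, t.contMDiff x⟩

/-- The first component of a section of the direct sum. -/
def fst (s : (VBundle.pullbackSum p K A).Sec) (x : E) : A.V (p x) := (s x).1

lemma smooth (s : (VBundle.pullbackSum p K A).Sec) (x : E) :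
    A.SmoothAlongAt 𝓘(ℝ, EE) p (fst s) x ∧
      K.SmoothAlongAt 𝓘(ℝ, EE) id (fun x => (s x).2) x :=
  (VBundle.pullbackSum_smooth_iff p K A (fun x => (s x).1) (fun x => (s x).2) x).1 (s.contMDiff x)

/-- The second component of a section of the direct sum. -/
def snd (s : (VBundle.pullbackSum p K A).Sec) : K.Sec :=
  K.mkSec (fun x => (s x).2) fun x => (smooth s x).2

lemma ext_parts {s t : (VBundle.pullbackSum p K A).Sec} (h : ∀ x, fst s x = fst t x)
    (h' : snd s = snd t) : s = t := by
  ext x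
  exact Prod.ext (h x) (DFunLike.congr_fun h' x)

lemma fst_add (s t : (VBundle.pullbackSum p K A).Sec) (x : E) :
    fst (s + t) x = fst s x + fst t x := rfl

lemma fst_fsmul (f : C^∞⟮𝓘(ℝ, EE), E; ℝ⟯) (s : (VBundle.pullbackSum p K A).Sec) (x : E) :
    fst (VBundle.fsmul _ f s) x = f x • fst s x := rfl

lemma snd_add (s t : (VBundle.pullbackSum p K A).Sec) : snd (s + t) = snd s + snd t := rfl

lemma snd_fsmul (f : C^∞⟮𝓘(ℝ, EE), E; ℝ⟯) (s : (VBundle.pullbackSum p K A).Sec) :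
    snd (VBundle.fsmul _ f s) = K.fsmul f (snd s) := rfl

end VBundle.pullbackSum

end Model

end LieExt

namespace LieExt

universe u u'

/-! ### The horizontal bracket, defined by duality -/

section Ext

variable {EE : Type u} [NormedAddCommGroup EE] [NormedSpace ℝ EE] [FiniteDimensional ℝ EE]
  {E : Type*} [TopologicalSpace E] [T2Space E] [ChartedSpace EE E] [IsManifold 𝓘(ℝ, EE) ∞ E]
  {EB : Type u'} [NormedAddCommGroup EB] [NormedSpace ℝ EB] [FiniteDimensional ℝ EB]
  {B : Type*} [TopologicalSpace B] [T2Space B] [ChartedSpace EB B] [IsManifold 𝓘(ℝ, EB) ∞ B]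
  {p : C^∞⟮𝓘(ℝ, EE), E; 𝓘(ℝ, EB), B⟯}

section Horizontal

variable {K : VBundle.{v} EE E} {A : LieAlgebroid.{v} EB B}

lemma LieAlgebroid.dBilin_skew (A : LieAlgebroid.{v} EB B) (u : A.Form1) (y : B) (a b : A.V y) :
    A.dBilin u y a b = -A.dBilin u y b a := by
  rw [← A.extend_self y a, ← A.extend_self y b, A.dBilin_apply, A.dBilin_apply, A.dEv_skew]
  rfl

lemma LieAlgebroid.dBilin_add_form (A : LieAlgebroid.{v} EB B) (u w : A.Form1) (y : B)
    (a b : A.V y) : A.dBilin (u + w) y a b = A.dBilin u y a b + A.dBilin w y a b := by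
  rw [← A.extend_self y a, ← A.extend_self y b, A.dBilin_apply, A.dBilin_apply, A.dBilin_apply,
    A.dEv_add_form]
  rfl

lemma LieAlgebroid.dBilin_fsmul_form (A : LieAlgebroid.{v} EB B) (f : C^∞⟮𝓘(ℝ, EB), B; ℝ⟯)
    (u : A.Form1) (y : B) (a b : A.V y) : A.dBilin (u.fsmul f) y a b =
      f y * A.dBilin u y a b + mvfderiv 𝓘(ℝ, EB) f y (A.anchor y a) * u.toFun y b -
        mvfderiv 𝓘(ℝ, EB) f y (A.anchor y b) * u.toFun y a := by
  conv_lhs => rw [← A.extend_self y a, ← A.extend_self y b, A.dBilin_apply, A.dEv_fsmul_form]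
  show f y * A.dEv u (A.extend y a) (A.extend y b) y +
    mvfderiv 𝓘(ℝ, EB) f y (A.anchor y (A.extend y a y)) * u.toFun y (A.extend y b y) -
    mvfderiv 𝓘(ℝ, EB) f y (A.anchor y (A.extend y b y)) * u.toFun y (A.extend y a y) = _
  rw [← A.dBilin_apply, A.extend_self, A.extend_self]

open VBundle.pullbackSum

/-- The evaluation of a `1`-form along the first component of a section. -/
def evalAlong (u : A.Form1) (s : (VBundle.pullbackSum p K A.toVBundle).Sec) :
    C^∞⟮𝓘(ℝ, EE), E; ℝ⟯ :=
  ⟨fun x => u.toFun (p x) (fst s x), fun x => u.smooth_along (smooth s x).1⟩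

/-- The evaluation of the differential of a `1`-form along the first components of sections. -/
def dEvalAlong (u : A.Form1) (s t : (VBundle.pullbackSum p K A.toVBundle).Sec) :
    C^∞⟮𝓘(ℝ, EE), E; ℝ⟯ :=
  ⟨fun x => A.dBilin u (p x) (fst s x) (fst t x), fun x => by
    refine (A.dForm u).smooth_along (t := ![fst s, fst t]) (p.contMDiff x) fun i => ?_
    fin_cases i
    · exact (smooth s x).1
    · exact (smooth t x).1⟩

variable (ρ : (VBundle.pullbackSum p K A.toVBundle).Sec → VField EE E)

/-- The components of the bracket of the first components of sections. -/
def horComp (u : A.Form1) (s t : (VBundle.pullbackSum p K A.toVBundle).Sec) :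
    C^∞⟮𝓘(ℝ, EE), E; ℝ⟯ :=
  VField.der (ρ s) (evalAlong u t) - VField.der (ρ t) (evalAlong u s) - dEvalAlong u s t

lemma horComp_skew (u : A.Form1) (s t : (VBundle.pullbackSum p K A.toVBundle).Sec) :
    horComp ρ u s t = -horComp ρ u t s := by
  have e : dEvalAlong u s t = -dEvalAlong u t s := by
    ext x; exact A.dBilin_skew u (p x) _ _
  simp only [horComp, e]
  ring

lemma horComp_add (hadd : ∀ s t, ρ (s + t) = ρ s + ρ t) (u : A.Form1)
    (s t r : (VBundle.pullbackSum p K A.toVBundle).Sec) :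
    horComp ρ u s (t + r) = horComp ρ u s t + horComp ρ u s r := by
  have e : dEvalAlong u s (t + r) = dEvalAlong u s t + dEvalAlong u s r := by
    ext x; exact map_add (A.dBilin u (p x) (fst s x)) _ _
  have e' : evalAlong u (t + r) = evalAlong u t + evalAlong u r := by
    ext x; exact map_add (u.toFun (p x)) _ _
  simp only [horComp, e, e', hadd, VField.der_add, VField.der_add_fun]
  ring

lemma horComp_fsmul (hfsmul : ∀ f s, ρ (VBundle.fsmul _ f s) = VField.fsmul f (ρ s)) (u : A.Form1)
    (f : C^∞⟮𝓘(ℝ, EE), E; ℝ⟯) (s t : (VBundle.pullbackSum p K A.toVBundle).Sec) :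
    horComp ρ u s (VBundle.fsmul _ f t) =
      f * horComp ρ u s t + VField.der (ρ s) f * evalAlong u t := by
  have e : dEvalAlong u s (VBundle.fsmul _ f t) = f * dEvalAlong u s t := by
    ext x; exact map_smul (A.dBilin u (p x) (fst s x)) (f x) _
  have e' : evalAlong u (VBundle.fsmul _ f t) = f * evalAlong u t := by
    ext x; exact map_smul (u.toFun (p x)) (f x) _
  have e2 : ∀ (V : VField EE E) g, VField.der (VField.fsmul f V) g = f * VField.der V g :=
    fun V g => by ext x; exact map_smul (mvfderiv 𝓘(ℝ, EE) g x) (f x) (V x)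
  simp only [horComp, e, e', hfsmul, e2, VField.der_mul]
  ring

lemma der_comp_of_projects
    (hρ : ∀ s x, mfderiv 𝓘(ℝ, EE) 𝓘(ℝ, EB) p x (ρ s x) = A.anchor (p x) (fst s x))
    (s : (VBundle.pullbackSum p K A.toVBundle).Sec)
    (f : C^∞⟮𝓘(ℝ, EB), B; ℝ⟯) (x : E) :
    VField.der (ρ s) (f.comp p) x = mvfderiv 𝓘(ℝ, EB) f (p x) (A.anchor (p x) (fst s x)) := by
  rw [← hρ]
  exact mvfderiv_comp_smooth p.contMDiff f x _

/-- The expression is linear over functions in `u`: replacing `u` by f·u produces derivatives of f∘p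
along `ρ`, which cancel df ∧ u because `ρ` projects to the anchor of `A`. -/
lemma exists_horBracket
    (hρ : ∀ s x, mfderiv 𝓘(ℝ, EE) 𝓘(ℝ, EB) p x (ρ s x) = A.anchor (p x) (fst s x))
    (s t : (VBundle.pullbackSum p K A.toVBundle).Sec) (x : E) :
    ∃ v : A.V (p x), ∀ u : A.Form1, u.toFun (p x) v = horComp ρ u s t x := by
  refine VBundle.exists_dual (fun u => horComp ρ u s t x) (fun u w => ?_) fun f u => ?_
  · have e : ∀ r : (VBundle.pullbackSum p K A.toVBundle).Sec,
        evalAlong (u + w) r = evalAlong u r + evalAlong w r := fun r => rfl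
    have e' : dEvalAlong (u + w) s t = dEvalAlong u s t + dEvalAlong w s t := by
      ext x; exact A.dBilin_add_form u w _ _ _
    have : horComp ρ (u + w) s t = horComp ρ u s t + horComp ρ w s t := by
      simp only [horComp, e, e', VField.der_add_fun]
      ring
    rw [this]
    rfl
  · have e : ∀ r : (VBundle.pullbackSum p K A.toVBundle).Sec,
        evalAlong (u.fsmul f) r = f.comp p * evalAlong u r := fun r => rfl
    have e' : dEvalAlong (u.fsmul f) s t x = f (p x) * dEvalAlong u s t x +
        VField.der (ρ s) (f.comp p) x * evalAlong u t x -
        VField.der (ρ t) (f.comp p) x * evalAlong u s x := by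
      rw [der_comp_of_projects ρ hρ, der_comp_of_projects ρ hρ]
      exact A.dBilin_fsmul_form f u _ _ _
    show VField.der (ρ s) (evalAlong (u.fsmul f) t) x - VField.der (ρ t) (evalAlong (u.fsmul f) s) x
      - dEvalAlong (u.fsmul f) s t x = f (p x) * (VField.der (ρ s) (evalAlong u t) x -
        VField.der (ρ t) (evalAlong u s) x - dEvalAlong u s t x)
    rw [e, e, e', VField.der_mul, VField.der_mul]
    show f (p x) * _ + _ * _ - (f (p x) * _ + _ * _) - _ = _
    ring

variable (hρ : ∀ s x, mfderiv 𝓘(ℝ, EE) 𝓘(ℝ, EB) p x (ρ s x) = A.anchor (p x) (fst s x))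

/-- The bracket of the first components of sections. -/
def horBracket (s t : (VBundle.pullbackSum p K A.toVBundle).Sec) (x : E) : A.V (p x) :=
  (exists_horBracket ρ hρ s t x).choose

lemma form_horBracket (u : A.Form1) (s t : (VBundle.pullbackSum p K A.toVBundle).Sec) (x : E) :
    u.toFun (p x) (horBracket ρ hρ s t x) = horComp ρ u s t x :=
  (exists_horBracket ρ hρ s t x).choose_spec u

lemma smooth_horBracket (s t : (VBundle.pullbackSum p K A.toVBundle).Sec) (x : E) :
    A.SmoothAlongAt 𝓘(ℝ, EE) p (horBracket ρ hρ s t) x := by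
  refine (A.frame (p x)).smooth_of_coord (p.contMDiff x) fun i => ?_
  have : ∀ y, (A.frame (p x)).coord i (p y) (horBracket ρ hρ s t y) =
      horComp ρ ((A.frame (p x)).form i) s t y :=
    fun y => form_horBracket ρ hρ ((A.frame (p x)).form i) s t y
  simp only [this]
  exact (horComp ρ ((A.frame (p x)).form i) s t).contMDiff x

lemma horBracket_skew (s t : (VBundle.pullbackSum p K A.toVBundle).Sec) (x : E) :
    horBracket ρ hρ s t x = -horBracket ρ hρ t s x :=
  VBundle.eq_of_forall_form fun u => by
    rw [map_neg, form_horBracket, form_horBracket, horComp_skew]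
    rfl

lemma horBracket_add (hadd : ∀ s t, ρ (s + t) = ρ s + ρ t)
    (s t r : (VBundle.pullbackSum p K A.toVBundle).Sec) (x : E) :
    horBracket ρ hρ s (t + r) x = horBracket ρ hρ s t x + horBracket ρ hρ s r x :=
  VBundle.eq_of_forall_form fun u => by
    rw [map_add, form_horBracket, form_horBracket, form_horBracket, horComp_add ρ hadd]
    rfl

lemma horBracket_fsmul (hfsmul : ∀ f s, ρ (VBundle.fsmul _ f s) = VField.fsmul f (ρ s))
    (f : C^∞⟮𝓘(ℝ, EE), E; ℝ⟯) (s t : (VBundle.pullbackSum p K A.toVBundle).Sec) (x : E) :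
    horBracket ρ hρ s (VBundle.fsmul _ f t) x =
      f x • horBracket ρ hρ s t x + VField.der (ρ s) f x • fst t x :=
  VBundle.eq_of_forall_form fun u => by
    rw [map_add, map_smul, map_smul, form_horBracket, form_horBracket, horComp_fsmul ρ hfsmul]
    rfl

/-- For pulled-back sections the dual definition is the formula for du solved for its bracket term.
-/
lemma horBracket_of_projects {s t : (VBundle.pullbackSum p K A.toVBundle).Sec} {a b : A.Sec}
    (hs : ∀ x, fst s x = a (p x)) (ht : ∀ x, fst t x = b (p x)) (x : E) :
    horBracket ρ hρ s t x = A.bracket a b (p x) :=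
  VBundle.eq_of_forall_form fun u => by
    rw [form_horBracket]
    have e1 : evalAlong u s = (u.ev a).comp p := by
      ext y; exact congrArg (u.toFun (p y)) (hs y)
    have e2 : evalAlong u t = (u.ev b).comp p := by
      ext y; exact congrArg (u.toFun (p y)) (ht y)
    have e3 : dEvalAlong u s t x = A.dEv u a b (p x) := by
      rw [← A.dBilin_apply, ← hs, ← ht]
      rfl
    show VField.der (ρ s) (evalAlong u t) x - VField.der (ρ t) (evalAlong u s) x
      - dEvalAlong u s t x = _
    rw [e1, e2, e3, der_comp_of_projects ρ hρ, der_comp_of_projects ρ hρ, hs, ht]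
    show A.act a (u.ev b) (p x) - A.act b (u.ev a) (p x) - (A.act a (u.ev b) (p x) -
      A.act b (u.ev a) (p x) - u.ev (A.bracket a b) (p x)) = u.ev (A.bracket a b) (p x)
    ring

end Horizontal

end Ext

end LieExt

namespace LieExt

universe u u'

/-! ### Bracket and anchor defined by a couple -/

section Ext

variable {EE : Type u} [NormedAddCommGroup EE] [NormedSpace ℝ EE] [FiniteDimensional ℝ EE]
  {E : Type*} [TopologicalSpace E] [T2Space E] [ChartedSpace EE E] [IsManifold 𝓘(ℝ, EE) ∞ E]
  {EB : Type u'} [NormedAddCommGroup EB] [NormedSpace ℝ EB] [FiniteDimensional ℝ EB]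
  {B : Type*} [TopologicalSpace B] [T2Space B] [ChartedSpace EB B] [IsManifold 𝓘(ℝ, EB) ∞ B]
  {p : C^∞⟮𝓘(ℝ, EE), E; 𝓘(ℝ, EB), B⟯}
  {K : LieAlgebroid.{v} EE E} {A : LieAlgebroid.{v} EB B}

namespace KForm

variable (w : KForm p K A 2)

lemma apply_skew (a b : A.Sec) : w.toFun ![a, b] = -w.toFun ![b, a] := by
  have e0 : ∀ c d e : A.Sec, Function.update ![c, d] 0 e = ![e, d] := fun c d e => by
    ext i; fin_cases i <;> rfl
  have e1 : ∀ c d e : A.Sec, Function.update ![c, d] 1 e = ![c, e] := fun c d e => by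
    ext i; fin_cases i <;> rfl
  have h0 : ∀ c, w.toFun ![c, c] = 0 := fun c => w.map_eq_zero_of_eq _ 0 1 rfl (by simp)
  have h := w.map_update_add ![a + b, a + b] 0 a b
  have h1 := w.map_update_add ![a, a] 1 a b
  have h2 := w.map_update_add ![b, b] 1 a b
  simp only [e0] at h
  simp only [e1] at h1 h2
  rw [h0, h1, h2, h0, h0, zero_add, add_zero] at h
  exact eq_neg_of_add_eq_zero_left h.symm

lemma apply_add_left (a b c : A.Sec) :
    w.toFun ![a + b, c] = w.toFun ![a, c] + w.toFun ![b, c] := by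
  have e0 : ∀ c d e : A.Sec, Function.update ![c, d] 0 e = ![e, d] := fun c d e => by
    ext i; fin_cases i <;> rfl
  have h := w.map_update_add ![a, c] 0 a b
  simpa only [e0] using h

lemma apply_fsmul_left (g : C^∞⟮𝓘(ℝ, EB), B; ℝ⟯) (a c : A.Sec) :
    w.toFun ![A.fsmul g a, c] = K.fsmul (g.comp p) (w.toFun ![a, c]) := by
  have e0 : ∀ c d e : A.Sec, Function.update ![c, d] 0 e = ![e, d] := fun c d e => by
    ext i; fin_cases i <;> rfl
  have h := w.map_update_fsmul ![a, c] 0 g a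
  simpa only [e0] using h

lemma apply_add_right (a b c : A.Sec) :
    w.toFun ![c, a + b] = w.toFun ![c, a] + w.toFun ![c, b] := by
  rw [apply_skew, apply_add_left, w.apply_skew a, w.apply_skew b]
  abel

lemma apply_fsmul_right (g : C^∞⟮𝓘(ℝ, EB), B; ℝ⟯) (a c : A.Sec) :
    w.toFun ![c, A.fsmul g a] = K.fsmul (g.comp p) (w.toFun ![c, a]) := by
  rw [apply_skew, apply_fsmul_left, w.apply_skew a, ← VBundle.smul_eq_fsmul,
    ← VBundle.smul_eq_fsmul, smul_neg, neg_neg]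

/-- A `2`-form as a bilinear map at a point. -/
def bilin (x : E) : A.V (p x) →ₗ[ℝ] A.V (p x) →ₗ[ℝ] K.V x :=
  VBundle.tensorMap (p x)
    (fun a => VBundle.tensorMap (p x) (fun b => w.toFun ![a, b] x)
      (fun s t => by rw [apply_add_right]; rfl) (fun f s => by rw [apply_fsmul_right]; rfl))
    (fun s t => by
      ext v
      show w.toFun ![s + t, _] x = w.toFun ![s, _] x + w.toFun ![t, _] x
      rw [apply_add_left]; rfl)
    (fun f s => by
      ext v
      show w.toFun ![A.fsmul f s, _] x = f (p x) • w.toFun ![s, _] x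
      rw [apply_fsmul_left]; rfl)

lemma bilin_apply (x : E) (a b : A.Sec) : w.bilin x (a (p x)) (b (p x)) = w.toFun ![a, b] x := by
  rw [bilin, VBundle.tensorMap_apply, VBundle.tensorMap_apply]

lemma bilin_skew (x : E) (a b : A.V (p x)) : w.bilin x a b = -w.bilin x b a := by
  rw [← A.extend_self (p x) a, ← A.extend_self (p x) b, bilin_apply, bilin_apply, apply_skew]
  rfl

lemma smooth_bilin {s t : ∀ x, A.V (p x)} {x : E} (hs : A.SmoothAlongAt 𝓘(ℝ, EE) p s x)
    (ht : A.SmoothAlongAt 𝓘(ℝ, EE) p t x) :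
    K.SmoothAlongAt 𝓘(ℝ, EE) id (fun x => w.bilin x (s x) (t x)) x := by
  refine (A.frame (p x)).smooth_map (ψ := id) (fun x => (w.bilin x).flip (t x)) contMDiffAt_id
    (fun i => ?_) hs
  refine (A.frame (p x)).smooth_map (ψ := id)
    (fun y => w.bilin y ((A.frame (p x)).sec i (p y))) contMDiffAt_id (fun j => ?_) ht
  simp only [bilin_apply]
  exact (w.toFun _).contMDiff x

end KForm

namespace Couple

variable (c : Couple p K A)

/-- The symbol at a point. -/
def sym (x : E) : A.V (p x) →ₗ[ℝ] TangentSpace 𝓘(ℝ, EE) x :=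
  VBundle.tensorMap (p x) (fun a => (c.D a).symbol x) (fun a b => c.D_add_symbol a b x)
    (fun g a => c.D_fsmul_symbol g a x)

lemma sym_apply (x : E) (a : A.Sec) : c.sym x (a (p x)) = (c.D a).symbol x :=
  VBundle.tensorMap_apply _ _ a

/-- The covariant derivative of a section at a point. -/
def nabla (κ : K.Sec) (x : E) : A.V (p x) →ₗ[ℝ] K.V x :=
  VBundle.tensorMap (p x) (fun a => (c.D a).op κ x) (fun a b => by rw [c.D_add_op]; rfl)
    (fun g a => by rw [c.D_fsmul_op]; rfl)

lemma nabla_apply (κ : K.Sec) (x : E) (a : A.Sec) : c.nabla κ x (a (p x)) = (c.D a).op κ x :=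
  VBundle.tensorMap_apply _ _ a

lemma nabla_add (κ κ' : K.Sec) (x : E) (v : A.V (p x)) :
    c.nabla (κ + κ') x v = c.nabla κ x v + c.nabla κ' x v := by
  rw [← A.extend_self (p x) v, nabla_apply, nabla_apply, nabla_apply, map_add]
  rfl

lemma nabla_fsmul (f : C^∞⟮𝓘(ℝ, EE), E; ℝ⟯) (κ : K.Sec) (x : E) (v : A.V (p x)) :
    c.nabla (K.fsmul f κ) x v =
      f x • c.nabla κ x v + mvfderiv 𝓘(ℝ, EE) f x (c.sym x v) • κ x := by
  rw [← A.extend_self (p x) v, nabla_apply, nabla_apply, sym_apply, (c.D _).map_fsmul]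

lemma sym_projects (x : E) (v : A.V (p x)) :
    mfderiv 𝓘(ℝ, EE) 𝓘(ℝ, EB) p x (c.sym x v) = A.anchor (p x) v := by
  rw [← A.extend_self (p x) v, sym_apply, c.symbol_projects]

variable (p K A) in
/-- The direct sum of the pullback of `A` and of `K`. -/
abbrev _root_.LieExt.sumBundle : VBundle.{v} EE E :=
  VBundle.pullbackSum p K.toVBundle A.toVBundle

open VBundle.pullbackSum

lemma smooth_sym {t : ∀ x, A.V (p x)} {x : E} (ht : A.SmoothAlongAt 𝓘(ℝ, EE) p t x) :
    (tangentVBundle EE E).SmoothAlongAt 𝓘(ℝ, EE) id (fun x => c.sym x (t x)) x :=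
  (A.frame (p x)).smooth_map (A' := tangentVBundle EE E) (ψ := id) c.sym contMDiffAt_id
    (fun i => by
      have := (c.D ((A.frame (p x)).sec i)).symbol.contMDiff x
      simp only [← sym_apply] at this
      exact this) ht

lemma smooth_nabla (κ : K.Sec) {t : ∀ x, A.V (p x)} {x : E}
    (ht : A.SmoothAlongAt 𝓘(ℝ, EE) p t x) :
    K.SmoothAlongAt 𝓘(ℝ, EE) id (fun x => c.nabla κ x (t x)) x :=
  (A.frame (p x)).smooth_map (ψ := id) (c.nabla κ) contMDiffAt_id
    (fun i => by simp only [nabla_apply]; exact ((c.D _).op κ).contMDiff x) ht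

/-- The anchor of the extension defined by a couple. -/
def extAnchor (x : E) : (sumBundle p K A).V x →ₗ[ℝ] TangentSpace 𝓘(ℝ, EE) x :=
  (c.sym x).coprod (K.anchor x)

/-- The symbol of the first component of a section. -/
def symSec (s : (sumBundle p K A).Sec) : VField EE E :=
  (tangentVBundle EE E).mkSec (fun x => c.sym x (fst s x)) (fun x => c.smooth_sym (smooth s x).1)

/-- The anchor on sections. -/
def extAnchorSec (s : (sumBundle p K A).Sec) : VField EE E := c.symSec s + K.anchorSec (snd s)

lemma extAnchorSec_apply (s : (sumBundle p K A).Sec) (x : E) :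
    c.extAnchorSec s x = c.sym x (fst s x) + K.anchor x (snd s x) := rfl

lemma extAnchorSec_add (s t : (sumBundle p K A).Sec) :
    c.extAnchorSec (s + t) = c.extAnchorSec s + c.extAnchorSec t := by
  ext x
  exact map_add (c.extAnchor x) (s x) (t x)

lemma extAnchorSec_fsmul (f : C^∞⟮𝓘(ℝ, EE), E; ℝ⟯) (s : (sumBundle p K A).Sec) :
    c.extAnchorSec (VBundle.fsmul _ f s) = VField.fsmul f (c.extAnchorSec s) := by
  ext x
  exact map_smul (c.extAnchor x) (f x) (s x)

/-- Verticality of the anchor of `K` enters here: the new anchor projects to the anchor of the first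
component, as the horizontal bracket requires. -/
lemma extAnchorSec_projects
    (hK : ∀ (x : E) (k : K.V x), mfderiv 𝓘(ℝ, EE) 𝓘(ℝ, EB) p x (K.anchor x k) = 0)
    (s : (sumBundle p K A).Sec) (x : E) :
    mfderiv 𝓘(ℝ, EE) 𝓘(ℝ, EB) p x (c.extAnchorSec s x) = A.anchor (p x) (fst s x) := by
  rw [extAnchorSec_apply, map_add, hK, add_zero, sym_projects]

/-- The vertical part of the bracket of the extension defined by a couple. -/
def vertBracket (s t : (sumBundle p K A).Sec) : K.Sec :=
  K.mkSec (fun x => c.form.bilin x (fst s x) (fst t x))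
      (fun x => c.form.smooth_bilin (smooth s x).1 (smooth t x).1) +
    K.mkSec (fun x => c.nabla (snd t) x (fst s x)) (fun x => c.smooth_nabla _ (smooth s x).1) -
    K.mkSec (fun x => c.nabla (snd s) x (fst t x)) (fun x => c.smooth_nabla _ (smooth t x).1) +
    K.bracket (snd s) (snd t)

lemma vertBracket_apply (s t : (sumBundle p K A).Sec) (x : E) :
    c.vertBracket s t x = c.form.bilin x (fst s x) (fst t x) + c.nabla (snd t) x (fst s x) -
      c.nabla (snd s) x (fst t x) + K.bracket (snd s) (snd t) x := rfl

lemma vertBracket_skew (s t : (sumBundle p K A).Sec) :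
    c.vertBracket s t = -c.vertBracket t s := by
  ext x
  rw [ContMDiffSection.coe_neg, Pi.neg_apply, vertBracket_apply, vertBracket_apply, K.skew,
    c.form.bilin_skew, ContMDiffSection.coe_neg, Pi.neg_apply]
  abel

lemma vertBracket_add (s t r : (sumBundle p K A).Sec) :
    c.vertBracket s (t + r) = c.vertBracket s t + c.vertBracket s r := by
  ext x
  rw [ContMDiffSection.coe_add, Pi.add_apply, vertBracket_apply, vertBracket_apply,
    vertBracket_apply, fst_add, snd_add, map_add, map_add, map_add, nabla_add,
    ContMDiffSection.coe_add, Pi.add_apply]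
  abel

lemma vertBracket_fsmul (f : C^∞⟮𝓘(ℝ, EE), E; ℝ⟯) (s t : (sumBundle p K A).Sec) :
    c.vertBracket s (VBundle.fsmul _ f t) =
      K.fsmul f (c.vertBracket s t) + K.fsmul (VField.der (c.extAnchorSec s) f) (snd t) := by
  ext x
  rw [ContMDiffSection.coe_add, Pi.add_apply, vertBracket_apply, VBundle.fsmul_apply,
    VBundle.fsmul_apply, vertBracket_apply, fst_fsmul, snd_fsmul, map_smul, map_smul, nabla_fsmul,
    K.leibniz, VField.der_apply, extAnchorSec_apply, map_add]
  module

variable (hK : ∀ (x : E) (k : K.V x), mfderiv 𝓘(ℝ, EE) 𝓘(ℝ, EB) p x (K.anchor x k) = 0)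

/-- The bracket of the extension defined by a couple. -/
def extBracket (s t : (sumBundle p K A).Sec) : (sumBundle p K A).Sec :=
  ofParts (horBracket c.extAnchorSec (c.extAnchorSec_projects hK) s t)
    (smooth_horBracket c.extAnchorSec (c.extAnchorSec_projects hK) s t) (c.vertBracket s t)

lemma extBracket_skew (s t : (sumBundle p K A).Sec) :
    c.extBracket hK s t = -c.extBracket hK t s :=
  ext_parts (fun x => horBracket_skew _ (c.extAnchorSec_projects hK) s t x) (c.vertBracket_skew s t)

lemma extBracket_add (s t r : (sumBundle p K A).Sec) :
    c.extBracket hK s (t + r) = c.extBracket hK s t + c.extBracket hK s r :=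
  ext_parts (fun x => horBracket_add _ (c.extAnchorSec_projects hK) c.extAnchorSec_add s t r x)
    (c.vertBracket_add s t r)

lemma extBracket_fsmul (f : C^∞⟮𝓘(ℝ, EE), E; ℝ⟯) (s t : (sumBundle p K A).Sec) :
    c.extBracket hK s (VBundle.fsmul _ f t) = VBundle.fsmul _ f (c.extBracket hK s t) +
      VBundle.fsmul _ (VField.der (c.extAnchorSec s) f) t :=
  ext_parts (fun x => horBracket_fsmul _ (c.extAnchorSec_projects hK) c.extAnchorSec_fsmul f s t x)
    (c.vertBracket_fsmul f s t)

variable (p) in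
/-- The section with first component the pullback of `a` and second component `κ`. -/
def _root_.LieExt.genSec (a : A.Sec) (κ : K.Sec) : (sumBundle p K A).Sec :=
  ofParts (fun x => a (p x)) (fun x => .of_section a (p.contMDiff x)) κ

/-- This is the model formula for the bracket, now without any fibrewise maps; all axioms are
verified from it. -/
lemma extBracket_genSec (a b : A.Sec) (κ l : K.Sec) :
    c.extBracket hK (genSec p a κ) (genSec p b l) = genSec p (A.bracket a b)
      (c.form.toFun ![a, b] + (c.D a).op l - (c.D b).op κ + K.bracket κ l) := by
  refine ext_parts (fun x => horBracket_of_projects _ (c.extAnchorSec_projects hK) (fun _ => rfl)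
    (fun _ => rfl) x) ?_
  ext x
  show c.vertBracket _ _ x = _
  rw [vertBracket_apply]
  show c.form.bilin x (a (p x)) (b (p x)) + c.nabla l x (a (p x)) - c.nabla κ x (b (p x)) + _ = _
  rw [KForm.bilin_apply, nabla_apply, nabla_apply]
  rfl

lemma extAnchorSec_genSec (a : A.Sec) (κ : K.Sec) :
    c.extAnchorSec (genSec p a κ) = (c.D a).symbol + K.anchorSec κ := by
  ext x
  show c.sym x (a (p x)) + _ = _
  rw [sym_apply]
  rfl

variable {c}

/-- The horizontal–horizontal part is the curvature equation for symbols, the mixed parts are the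
anchor condition on derivations, and the last is the anchor axiom of `K`. -/
lemma IsAdmissible.anchor_genSec (hc : c.IsAdmissible) (a b : A.Sec) (κ l : K.Sec) :
    c.extAnchorSec (c.extBracket hK (genSec p a κ) (genSec p b l)) =
      VField.lie (c.extAnchorSec (genSec p a κ)) (c.extAnchorSec (genSec p b l)) := by
  have h1 : VField.lie (c.D a).symbol (c.D b).symbol =
      (c.D (A.bracket a b)).symbol + K.anchorSec (c.form.toFun ![a, b]) := by
    ext x
    exact eq_add_of_sub_eq' (hc.curv_symbol a b x)
  have e : ∀ κ l : K.Sec, K.anchorSec (κ - l) = K.anchorSec κ - K.anchorSec l := fun κ l => by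
    ext x; exact map_sub (K.anchor x) _ _
  rw [extBracket_genSec]
  simp only [extAnchorSec_genSec, LieAlgebroid.anchorSec_add, e, VField.lie_add_right,
    LieAlgebroid.Der.anchorSec_op, LieAlgebroid.anchorSec_bracket]
  rw [VField.lie_swap ((c.D a).symbol + _) (c.D b).symbol,
    VField.lie_swap ((c.D a).symbol + _) (K.anchorSec l), VField.lie_add_right,
    VField.lie_add_right, VField.lie_swap (c.D b).symbol (c.D a).symbol,
    VField.lie_swap (K.anchorSec l) (c.D a).symbol, VField.lie_swap (K.anchorSec l), h1]
  abel

/-- The first component is Jacobi in `A`. The second is the sum of closedness of ω, three instances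
of the curvature equation (one for each section of `K`), the derivation property of D, and Jacobi in
`K`. -/
lemma IsAdmissible.jacobi_genSec (hc : c.IsAdmissible) (a b d : A.Sec) (κ l m : K.Sec) :
    c.extBracket hK (genSec p a κ) (c.extBracket hK (genSec p b l) (genSec p d m)) =
      c.extBracket hK (c.extBracket hK (genSec p a κ) (genSec p b l)) (genSec p d m) +
      c.extBracket hK (genSec p b l) (c.extBracket hK (genSec p a κ) (genSec p d m)) := by
  have hadd : ∀ (a b : A.Sec) (κ l : K.Sec),
      genSec p a κ + genSec p b l = genSec p (a + b) (κ + l) := fun _ _ _ _ => rfl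
  simp only [extBracket_genSec, hadd]
  rw [A.bracket_leibniz a b d]
  congr 1
  have h0 := hc.closed ![a, b, d]
  rw [covD_two] at h0
  have h1 := hc.curv_op a b m
  have h2 := hc.curv_op a d l
  have h3 := hc.curv_op b d κ
  have h4 := K.bracket_leibniz κ l m
  simp only [map_add, map_sub, LinearMap.add_apply, LinearMap.sub_apply,
    LieAlgebroid.Der.map_bracket] at h0 h1 h2 h3 ⊢
  rw [K.skew l (c.form.toFun ![a, d]), K.skew κ (c.form.toFun ![b, d]),
    K.skew l ((c.D d).op κ), c.form.apply_skew a (A.bracket b d),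
    c.form.apply_skew b (A.bracket a d)]
  linear_combination (norm := module) h0 + h1 - h2 + h3 + h4

end Couple

end Ext

end LieExt

namespace LieExt

universe u u'

/-! ### The extension of an admissible couple -/

section Ext

variable {EE : Type u} [NormedAddCommGroup EE] [NormedSpace ℝ EE] [FiniteDimensional ℝ EE]
  {E : Type*} [TopologicalSpace E] [T2Space E] [ChartedSpace EE E] [IsManifold 𝓘(ℝ, EE) ∞ E]
  {EB : Type u'} [NormedAddCommGroup EB] [NormedSpace ℝ EB] [FiniteDimensional ℝ EB]
  {B : Type*} [TopologicalSpace B] [T2Space B] [ChartedSpace EB B] [IsManifold 𝓘(ℝ, EB) ∞ B]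
  {p : C^∞⟮𝓘(ℝ, EE), E; 𝓘(ℝ, EB), B⟯}
  {K : LieAlgebroid.{v} EE E} {A : LieAlgebroid.{v} EB B}


namespace Couple

open VBundle.pullbackSum

variable {c : Couple p K A}
  (hK : ∀ (x : E) (k : K.V x), mfderiv 𝓘(ℝ, EE) 𝓘(ℝ, EB) p x (K.anchor x k) = 0)

/-- The total algebroid of the extension defined by an admissible couple. -/
def extAlgebroid (hc : c.IsAdmissible) : LieAlgebroid.{v} EE E :=
  LieAlgebroid.ofGenerators (sumBundle p K A) c.extAnchor c.extAnchorSec (fun _ _ => rfl)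
    (bracketOfLeibniz _ c.extAnchorSec (c.extBracket hK) (c.extBracket_add hK)
      (c.extBracket_fsmul hK) (c.extBracket_skew hK))
    (c.extBracket_fsmul hK) (c.extBracket_skew hK) {s | ∃ a κ, s = genSec p a κ}
    (fun x v => ⟨genSec p (A.extend (p x) v.1) (K.extend x v.2), ⟨_, _, rfl⟩,
      Prod.ext (A.extend_self (p x) v.1) (K.extend_self x v.2)⟩)
    (by
      rintro _ ⟨a, κ, rfl⟩ _ ⟨b, l, rfl⟩
      exact hc.anchor_genSec hK a b κ l)
    (by
      rintro _ ⟨a, κ, rfl⟩ _ ⟨b, l, rfl⟩ _ ⟨d, m, rfl⟩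
      exact hc.jacobi_genSec hK a b d κ l m)

lemma extAlgebroid_bracket (hc : c.IsAdmissible) (s t : (sumBundle p K A).Sec) :
    (extAlgebroid hK hc).bracket s t = c.extBracket hK s t := rfl

/-- The extension defined by an admissible couple. -/
def extension (hc : c.IsAdmissible) : Extension p K A where
  total := extAlgebroid hK hc
  proj x := LinearMap.fst ℝ (A.V (p x)) (K.V x)
  incl x := LinearMap.inr ℝ (A.V (p x)) (K.V x)
  proj_morphism := by
    refine IsMorphism.of_related p.contMDiff (fun s x => (smooth s x).1) (fun x v => ?_)
      (fun x v => ⟨genSec p (A.extend (p x) v.1) (K.extend x v.2), A.extend (p x) v.1,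
        Prod.ext (A.extend_self (p x) v.1) (K.extend_self x v.2), fun _ => rfl⟩)
      fun s t a b hs ht y => ?_
    · show mfderiv 𝓘(ℝ, EE) 𝓘(ℝ, EB) p x (c.sym x v.1 + K.anchor x v.2) = A.anchor (p x) v.1
      rw [map_add, hK, add_zero]
      exact c.sym_projects x v.1
    · exact horBracket_of_projects _ (c.extAnchorSec_projects hK) hs ht y
  incl_morphism := by
    refine IsMorphism.of_related contMDiff_id (fun s x => (genSec p 0 s).contMDiff x)
      (fun x v => ?_)
      (fun x v => ⟨K.extend x v, genSec p 0 (K.extend x v), K.extend_self x v, fun _ => rfl⟩)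
      fun s t a b hs ht y => ?_
    · rw [mfderiv_id]
      show K.anchor x v = c.sym x 0 + K.anchor x v
      rw [map_zero, zero_add]
    · have ha : a = genSec p 0 s := ContMDiffSection.ext fun x => (hs x).symm
      have hb : b = genSec p 0 t := ContMDiffSection.ext fun x => (ht x).symm
      rw [ha, hb, extAlgebroid_bracket, extBracket_genSec]
      -- With zero horizontal components, the terms in D and ω drop out of the model bracket and
      -- only the bracket of `K` is left.
      have h1 : ∀ κ : K.Sec, (c.D 0).op κ = 0 := fun κ => by
        have := c.D_add_op 0 0 κ
        rw [add_zero] at this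
        exact left_eq_add.1 this
      have h2 : c.form.toFun ![0, 0] = 0 := c.form.map_eq_zero_of_eq _ 0 1 rfl (by simp)
      rw [h1, h1, h2, add_zero, sub_zero, zero_add, map_zero]
      rfl
  proj_surjective x := Prod.fst_surjective
  incl_injective x := LinearMap.inr_injective
  exact x := LinearMap.range_inr ℝ _ _

/-- The connection on the extension defined by an admissible couple. -/
def extConnection (hc : c.IsAdmissible) : (extension hK hc).Connection :=
  (extension hK hc).connectionOfLift (fun a => genSec p a 0)
    (fun _ _ => ext_parts (fun _ => rfl) (add_zero (0 : K.Sec)).symm)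
    (fun g _ => ext_parts (fun _ => rfl) (smul_zero (A := K.Sec) (g.comp p)).symm)
    (fun _ _ => rfl)

/-- The constant lift a ↦ (a, 0) reads D and ω off the model bracket, so the construction returns
the couple it started from. -/
lemma isCoupleOf_extConnection (hc : c.IsAdmissible) :
    IsCoupleOf (extension hK hc) (extConnection hK hc) c := by
  refine isCoupleOf_iff.2 ⟨fun a κ => ?_, fun a => ?_, fun a b => ?_⟩
  · show genSec p 0 _ = c.extBracket hK (genSec p a 0) (genSec p 0 κ)
    have h2 : c.form.toFun ![a, 0] = 0 := by
      have := c.form.apply_add_right 0 0 a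
      rw [add_zero] at this
      exact left_eq_add.1 this
    rw [extBracket_genSec, h2, map_zero, map_zero, map_zero, LinearMap.zero_apply, zero_add,
      sub_zero, add_zero]
  · show _ = c.extAnchorSec (genSec p a 0)
    rw [extAnchorSec_genSec]
    ext x
    show _ = _ + K.anchor x 0
    rw [map_zero, add_zero]
  · show genSec p 0 _ = c.extBracket hK (genSec p a 0) (genSec p b 0) - genSec p (A.bracket a b) 0
    rw [extBracket_genSec, map_zero, map_zero, map_zero, add_zero, sub_zero, add_zero]
    exact ext_parts (fun x => (sub_self _).symm) (sub_zero _).symm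

end Couple

end Ext

end LieExt

end

/-! ### The classification -/

theorem mainTheorem1
    {EE : Type*} [NormedAddCommGroup EE] [NormedSpace ℝ EE] [FiniteDimensional ℝ EE]
    {E : Type*} [TopologicalSpace E] [T2Space E] [SigmaCompactSpace E] [ChartedSpace EE E]
    [IsManifold 𝓘(ℝ, EE) ∞ E]
    {EB : Type*} [NormedAddCommGroup EB] [NormedSpace ℝ EB] [FiniteDimensional ℝ EB]
    {B : Type*} [TopologicalSpace B] [T2Space B] [SigmaCompactSpace B] [ChartedSpace EB B]
    [IsManifold 𝓘(ℝ, EB) ∞ B]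
    (p : C^∞⟮𝓘(ℝ, EE), E; 𝓘(ℝ, EB), B⟯)
    (hp : IsSubmersion 𝓘(ℝ, EE) 𝓘(ℝ, EB) ∞ p)
    (K : LieExt.LieAlgebroid.{v} EE E) (A : LieExt.LieAlgebroid.{v} EB B)
    (hK : ∀ (x : E) (k : K.V x), mfderiv 𝓘(ℝ, EE) 𝓘(ℝ, EB) p x (K.anchor x k) = 0) :
    Equivalence (LieExt.Extension.Equivalent (p := p) (K := K) (A := A)) ∧
    Equivalence (LieExt.GaugeEquivalent (p := p) (K := K) (A := A)) ∧
    (∀ X : LieExt.Extension p K A, Nonempty X.Connection) ∧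
    (∀ (X : LieExt.Extension p K A) (h : X.Connection),
      ∃! c : LieExt.AdmissibleCouple p K A, LieExt.IsCoupleOf X h c.1) ∧
    ∃ Ψ : Quot (LieExt.Extension.Equivalent (p := p) (K := K) (A := A)) ≃
        Quot (LieExt.GaugeEquivalent (p := p) (K := K) (A := A)),
      ∀ (X : LieExt.Extension p K A) (h : X.Connection) (c : LieExt.AdmissibleCouple p K A),
        LieExt.IsCoupleOf X h c.1 → Ψ (Quot.mk _ X) = Quot.mk _ c := by
  have exists_couple : ∀ (X : LieExt.Extension p K A) (h : X.Connection),
      ∃! c : LieExt.AdmissibleCouple p K A, LieExt.IsCoupleOf X h c.1 := fun X h =>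
    ⟨⟨h.couple, h.isCoupleOf_couple.isAdmissible⟩, h.isCoupleOf_couple,
      fun c hc => Subtype.ext (hc.unique h.isCoupleOf_couple)⟩
  refine ⟨LieExt.Extension.equivalent_equivalence, LieExt.gaugeEquivalent_equivalence,
    fun X => X.nonempty_connection, exists_couple, ?_⟩
  -- Well-definedness in both choices at once: transport the connection along the equivalence, which
  -- preserves its couple, then compare two connections on `Y`.
  have gauge : ∀ {X Y : LieExt.Extension p K A} (_ : X.Equivalent Y) {h : X.Connection}
      {h' : Y.Connection} {c c' : LieExt.AdmissibleCouple p K A}, LieExt.IsCoupleOf X h c.1 →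
      LieExt.IsCoupleOf Y h' c'.1 → LieExt.GaugeEquivalent c c' := by
    intro X Y e h h' c c' H H'
    obtain ⟨h'', H''⟩ := e.exists_connection H
    exact H''.exists_isGaugeTransform H'
  let h : ∀ X : LieExt.Extension p K A, X.Connection := fun X => X.nonempty_connection.some
  let c : LieExt.Extension p K A → LieExt.AdmissibleCouple p K A := fun X =>
    (exists_couple X (h X)).exists.choose
  have hc : ∀ X, LieExt.IsCoupleOf X (h X) (c X).1 := fun X =>
    (exists_couple X (h X)).exists.choose_spec
  let Ψ : Quot (LieExt.Extension.Equivalent (p := p) (K := K) (A := A)) →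
      Quot (LieExt.GaugeEquivalent (p := p) (K := K) (A := A)) :=
    Quot.lift (fun X => Quot.mk _ (c X)) fun X Y e => Quot.sound (gauge e (hc X) (hc Y))
  have hΨ : ∀ (X : LieExt.Extension p K A) (h : X.Connection) (c : LieExt.AdmissibleCouple p K A),
      LieExt.IsCoupleOf X h c.1 → Ψ (Quot.mk _ X) = Quot.mk _ c := fun X h' c' H =>
    Quot.sound (gauge (LieExt.Extension.equivalent_equivalence.refl X) (hc X) H)
  refine ⟨Equiv.ofBijective Ψ ⟨?_, ?_⟩, hΨ⟩
  -- Injectivity. Equality in the quotient means gauge equivalence, because that relation is already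
  -- an equivalence. The gauge transformation is absorbed into a new connection on `X`, whose couple
  -- is the one of `Y`.
  · rintro ⟨X⟩ ⟨Y⟩ e
    obtain ⟨Δ, hΔ⟩ := (Quot.eq.trans
      LieExt.gaugeEquivalent_equivalence.eqvGen_iff).1 e
    obtain ⟨h', H'⟩ := (hc X).exists_connection hΔ
    exact Quot.sound (LieExt.Extension.equivalent_of_isCoupleOf H' (hc Y))
  · rintro ⟨c'⟩
    exact ⟨Quot.mk _ (LieExt.Couple.extension hK c'.2),
      hΨ _ _ c' (LieExt.Couple.isCoupleOf_extConnection hK c'.2)⟩
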